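/- Throughout, $\mathrm{sinc}(s)=\sin(\pi s)/(\pi s)$, $\mathrm{sinc}(0)=1$, and mutual informations are in bits. Let $T>0$, $\tau,\gamma\in\mathbb R$, $P\ge 0$, $N>0$, and let $\nu$ be a probability law on $\mathbb C$ with $\int|u|^2\,d\nu=1$. Two satellites transmit the same signal $x(t)=\sum_{i=0}^{n-1}x_i\,\mathrm{sinc}((t-iT)/T)$, where $x_i=\sqrt P\,u_i$ and the $u_i$ are i.i.d. of law $\nu$. The second signal is received with gain $\gamma$, delay $\tau$ and slowly varying phase, so that the samples at the times $kT$ are $$y_k=x(kT)+\gamma e^{j\phi_k}x(kT-\tau)+w_k,\qquad 0\le k<n,$$ with $w_k$ i.i.d. circularly symmetric complex Gaussian of variance $N$. The phase process $(\phi_k)_{k\ge0}$ is independent of symbols and noise and known to the receiver; $(e^{j\phi_k})_k$ is stationary and ergodic, and $\mathrm E[\cos\phi_0]=0$ (for instance $\phi_0$ uniform on $[0,2\pi)$). Let $\boldsymbol x=(x_0,\dots,x_{n-1})$, $\boldsymbol y=(y_0,\dots,y_{n-1})$, let $I(\boldsymbol x;\boldsymbol y\,|\,\phi)$ be their mutual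 information for a given realization $\phi$ of the phases, and let $I(\rho)$ be the mutual information between $u\sim\nu$ and $\sqrt\rho\,u+w$, where $w$ is independent circularly symmetric complex Gaussian noise of variance $1$. Then: 1. The channel is time-varying and frequency-selective: for every realization of the phases, $y_k=\sum_{i=0}^{n-1}h_{k,k-i}x_i+w_k$, with $h_{k,m}=\gamma e^{j\phi_k}\mathrm{sinc}(m-\tau/T)$ for $m\ne0$ and $h_{k,0}=1+\gamma e^{j\phi_k}\mathrm{sinc}(-\tau/T)$. 2. For almost every realization $\phi$ of the phases, $$\limsup_{n\to\infty}\frac{I(\boldsymbol x;\boldsymbol y\,|\,\phi)}n\le I\Big((1+\gamma^2)\frac PN\Big).$$ 3. The ergodic rate obeys the same bound: $$\limsup_{n\to\infty}\frac{\mathrm E_\phi[I(\boldsymbol x;\boldsymbol y\,|\,\phi)]}n\le I\Big((1+\gamma^2)\frac PN\Big).$$ 4. For every phase $\theta$, $I((1+\gamma^2)P/N)$ is the rate per channel use of the Alamouti scheme with the same input distribution: it equals $\frac12 I(x_1,x_2;y_a,y_b)$, where $y_a=x_1+\gamma e^{j\theta}x_2+w_a$, $y_b=x_2^*-\gamma e^{j\theta}x_1^*+w_b$,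 $x_i=\sqrt P u_i$ with $u_1,u_2$ i.i.d. of law $\nu$, and $w_a,w_b$ are independent noise of variance $N$. 5. If $\nu$ is invariant under $u\mapsto-u$, then $I((1+\gamma^2)P/N)\le I(x_1,x_2;\,x_1+\gamma x_2+w)$, the rate with independent signals $x_1,x_2$ as in 4 and noise $w$ of variance $N$. 6. If $\nu$ is circularly symmetric complex Gaussian, then for every $\theta$ the rate with independent signals is $$I(x_1,x_2;\,x_1+\gamma e^{j\theta}x_2+w)=I\Big((1+\gamma^2)\frac PN\Big)=\log_2\Big(1+(1+\gamma^2)\frac PN\Big).$$ -/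

import Mathlib

open MeasureTheory ProbabilityTheory Filter
open scoped ENNReal NNReal

noncomputable section

/-- Mutual information `I(X; Y)`, in bits, of two random variables on `(Ω, P)`: the
Kullback-Leibler divergence of the joint law from the product of the marginals. -/
def mutualInfoBits {Ω α β : Type*} [MeasurableSpace Ω] [MeasurableSpace α] [MeasurableSpace β]
    (P : Measure Ω) (X : Ω → α) (Y : Ω → β) : ℝ≥0∞ :=
  InformationTheory.klDiv (P.map fun ω => (X ω, Y ω)) ((P.map X).prod (P.map Y))
    / ENNReal.ofReal (Real.log 2)

/-- The circularly symmetric complex Gaussian law of mean `0` and total variance `v`. -/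
def complexGaussian (v : ℝ≥0) : Measure ℂ :=
  ((gaussianReal 0 (v / 2)).prod (gaussianReal 0 (v / 2))).map
    fun p => (p.1 : ℂ) + (p.2 : ℂ) * Complex.I

/-- The rate, in bits, of the scalar channel `y = √ρ u + w` at signal-to-noise ratio `ρ`, where
`u` has law `ν` (of unit power) and the noise `w` is complex Gaussian of variance `1`. -/
def scalarRate (ν : Measure ℂ) (ρ : ℝ≥0) : ℝ≥0∞ :=
  mutualInfoBits (ν.prod (complexGaussian 1)) (fun p => p.1)
    (fun p => (Real.sqrt ρ : ℂ) * p.1 + p.2)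

/-- The shaping pulse `p(t) = sinc(t / T)`, with `sinc(s) = sin(π s) / (π s)`. -/
def shapingPulse (T t : ℝ) : ℝ := Real.sinc (Real.pi * (t / T))

/-- The signal `x(t) = ∑ i, x_i p(t - i T)` carrying the block `x_0, …, x_{n-1}`. -/
def waveform (T : ℝ) {n : ℕ} (x : Fin n → ℂ) (t : ℝ) : ℂ :=
  ∑ i : Fin n, x i * (shapingPulse T (t - (i : ℝ) * T) : ℂ)

/-- The noiseless received sample at time `k T` when both satellites transmit the same signal,
`x(t) + γ e^{jφ(t)} x(t - τ)`; here `φ k` is the phase at time `k T`. -/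
def sameSignalSample (T τ γ : ℝ) (φ : ℕ → ℝ) {n : ℕ} (x : Fin n → ℂ) (k : ℕ) : ℂ :=
  waveform T x ((k : ℝ) * T)
    + (γ : ℂ) * Complex.exp ((φ k : ℂ) * Complex.I) * waveform T x ((k : ℝ) * T - τ)

/-- The time-varying impulse response `h_{k,m}`: `γ e^{jφ_k} sinc(m - τ/T)`, plus `1` if `m = 0`. -/
def impulseResponse (T τ γ : ℝ) (φ : ℕ → ℝ) (k : ℕ) (m : ℤ) : ℂ :=
  (if m = 0 then 1 else 0)
    + (γ : ℂ) * Complex.exp ((φ k : ℂ) * Complex.I)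
      * (Real.sinc (Real.pi * ((m : ℝ) - τ / T)) : ℂ)

/-- The mutual information `I(x; y)`, in bits, between the transmitted block `x_k = √P u_k`, `k < n`,
with `u_k` independent of law `ν`, and the received block `y_k` observed in independent complex
Gaussian noise of variance `N`, for the given realization `φ` of the phases (which the receiver
knows). -/
def sameSignalInfo (T τ γ : ℝ) (P N : ℝ≥0) (ν : Measure ℂ) (φ : ℕ → ℝ) (n : ℕ) : ℝ≥0∞ :=
  mutualInfoBits
    ((Measure.pi fun _ : Fin n => ν).prod (Measure.pi fun _ : Fin n => complexGaussian N))
    (fun p (k : Fin n) => (Real.sqrt P : ℂ) * p.1 k)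
    (fun p (k : Fin n) =>
      sameSignalSample T τ γ φ (fun i => (Real.sqrt P : ℂ) * p.1 i) (k : ℕ) + p.2 k)

/-- The sum rate `I(x₁, x₂; y)`, in bits, of the channel `y = x₁ + γ e^{jθ} x₂ + w` with independent
signals `x_i = √P u_i`, `u_i` of law `ν`, and complex Gaussian noise of variance `N`. -/
def independentRate (γ θ : ℝ) (P N : ℝ≥0) (ν : Measure ℂ) : ℝ≥0∞ :=
  mutualInfoBits ((ν.prod ν).prod (complexGaussian N))
    (fun p => ((Real.sqrt P : ℂ) * p.1.1, (Real.sqrt P : ℂ) * p.1.2))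
    (fun p => (Real.sqrt P : ℂ) * p.1.1
      + (γ : ℂ) * Complex.exp ((θ : ℂ) * Complex.I) * ((Real.sqrt P : ℂ) * p.1.2) + p.2)

/-- The rate per channel use, in bits, of the Alamouti scheme: the satellites transmit `x₁, x₂`
and then `x₂*, -x₁*`, with `x_i = √P u_i`, the `u_i` independent of law `ν`, over the channel of
relative gain `γ e^{jθ}` and complex Gaussian noise of variance `N`. -/
def alamoutiRate (γ θ : ℝ) (P N : ℝ≥0) (ν : Measure ℂ) : ℝ≥0∞ :=
  mutualInfoBits
    ((ν.prod ν).prod ((complexGaussian N).prod (complexGaussian N)))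
    (fun p => ((Real.sqrt P : ℂ) * p.1.1, (Real.sqrt P : ℂ) * p.1.2))
    (fun p =>
      ((Real.sqrt P : ℂ) * p.1.1
          + (γ : ℂ) * Complex.exp ((θ : ℂ) * Complex.I) * ((Real.sqrt P : ℂ) * p.1.2) + p.2.1,
        starRingEnd ℂ ((Real.sqrt P : ℂ) * p.1.2)
          + (γ : ℂ) * Complex.exp ((θ : ℂ) * Complex.I)
            * (-(starRingEnd ℂ ((Real.sqrt P : ℂ) * p.1.1))) + p.2.2)) / 2

/-- A complex-valued random sequence is stationary and ergodic: the shift preserves its law on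
sequence space and is ergodic for it. -/
def IsStationaryErgodic {Ω : Type*} [MeasurableSpace Ω] (μ : Measure Ω) (Z : ℕ → Ω → ℂ) : Prop :=
  Ergodic (fun (s : ℕ → ℂ) (k : ℕ) => s (k + 1)) (μ.map fun ω k => Z k ω)

end

/-! All informations are computed relative to the noise law. A translate of Gaussian noise has the
Cameron-Martin density `exp (B c y - B c c / 2)`, so the mutual information is the mean of the
log-likelihood minus the log output density (`IsGaussianNoise.klDiv_joint`). The general
inequalities on informations then follow from `E e^{-g} ≤ 1`: nonnegativity, submodularity in
independent observations (`gaussianInfo_submodular`), and subadditivity over independent signals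
added in the same noise (`gaussianInfo_add_le`).

For the bound on the common signal, the received block is the sum over `i` of the symbol `x_i` times
its signature, the `i`-th column of the channel matrix, plus noise. By subadditivity the block
carries at most the sum of what each symbol would carry alone, and a symbol alone is, after matched
filtering, a scalar channel whose signal-to-noise ratio is governed by the energy of the signature
(`gaussianInfo_le_sum_scalarInfo`). Off the diagonal the phase has no effect on moduli; on the
diagonal it interferes with the direct path. Since the squares of shifted cardinal sines sum to at
most `1`, the energy is at most `1 + γ² + 2 γ sinc(τ/T) cos φ_i` (`sum_norm_impulseResponse_sq_le`).

The scalar information is concave in the signal-to-noise ratio: independent observations combine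
into one at the sum of their ratios, so submodularity says that its increments decrease
(`hasDecreasingIncrements_scalarInfo`). The supporting line at `1 + γ²` bounds the block information
by `n` times the target plus a constant times `∑ cos φ_i` (`exists_sameSignalInfo_le`). This sum has
mean zero, which gives the ergodic rate, and is almost surely at most `o(n)` by the upper half of
Birkhoff's theorem, which gives the almost sure rate.

Alamouti's scheme is, up to conjugation, phases and scaling, a plane rotation of the pair of
observations, which turns it into two scalar channels (`gaussianInfo_alamouti`). For symmetric
inputs each of its slots is distributed as the superposition of independent signals, and two
observations carry at most the sum of their informations. Gaussian inputs are computed explicitly.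
-/

/-- The law `γ` on `E` behaves like a centered Gaussian law whose Cameron-Martin inner product
is `B`: its translates have the exponential densities of the Cameron-Martin formula. -/
structure IsGaussianNoise {E : Type*} [AddCommGroup E] [MeasurableSpace E]
    (γ : Measure E) (B : E → E → ℝ) : Prop where
  isProbabilityMeasure : IsProbabilityMeasure γ
  measurable : Measurable fun p : E × E => B p.1 p.2
  symm : ∀ x y, B x y = B y x
  add_left : ∀ x y z, B (x + y) z = B x z + B y z
  nonneg : ∀ x, 0 ≤ B x x
  integrable : Integrable (fun w => B w w) γ
  map_add : ∀ c, γ.map (fun w => c + w)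
    = γ.withDensity fun y => ENNReal.ofReal (Real.exp (B c y - B c c / 2))

/-! ### Likelihoods, output densities and their integrability. -/

section Channel

variable {E : Type*}

/-- The log-likelihood of the signal `c` given the observation `y`. -/
noncomputable def logLikelihood (B : E → E → ℝ) (c y : E) : ℝ := B c y - B c c / 2

/-- The density of the law of the observation with respect to the noise law, for a signal
of law `σ`. -/
noncomputable def outputDensity [MeasurableSpace E] (B : E → E → ℝ) (σ : Measure E) (y : E) :
    ℝ≥0∞ :=
  ∫⁻ c, ENNReal.ofReal (Real.exp (logLikelihood B c y)) ∂σ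

/-- The logarithm of the output density. -/
noncomputable def logOutput [MeasurableSpace E] (B : E → E → ℝ) (σ : Measure E) (y : E) : ℝ :=
  Real.log (outputDensity B σ y).toReal

/-- The mutual information, in nats, between a signal of law `σ` and the same signal observed in
independent noise of law `γ`. -/
noncomputable def gaussianInfo [AddCommGroup E] [MeasurableSpace E] (γ : Measure E)
    (B : E → E → ℝ) (σ : Measure E) : ℝ :=
  ∫ p : E × E, (logLikelihood B p.1 (p.1 + p.2) - logOutput B σ (p.1 + p.2)) ∂(σ.prod γ)

/-- A nonnegative expectation from the bound `E e^{-g} ≤ 1`. -/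
lemma integral_nonneg_of_lintegral_exp_neg_le_one {Z : Type*} [MeasurableSpace Z] {M : Measure Z}
    [IsProbabilityMeasure M] {g : Z → ℝ} (hg : Integrable g M)
    (h : ∫⁻ z, ENNReal.ofReal (Real.exp (-g z)) ∂M ≤ 1) : 0 ≤ ∫ z, g z ∂M := by
  have hm : AEStronglyMeasurable (fun z => Real.exp (-g z)) M :=
    Real.continuous_exp.comp_aestronglyMeasurable hg.1.neg
  have hi : Integrable (fun z => Real.exp (-g z)) M := by
    refine ⟨hm, ?_⟩
    rw [hasFiniteIntegral_iff_ofReal (Eventually.of_forall fun z => (Real.exp_pos _).le)]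
    exact h.trans_lt ENNReal.one_lt_top
  have h1 : ∫ z, Real.exp (-g z) ∂M ≤ 1 := by
    rw [integral_eq_lintegral_of_nonneg_ae (Eventually.of_forall fun z => (Real.exp_pos _).le) hm]
    exact ENNReal.toReal_le_of_le_ofReal zero_le_one (by simpa using h)
  -- The tangent inequality `1 - e^{-g} ≤ g` takes the place of Jensen.
  have h2 : ∫ z, (1 - Real.exp (-g z)) ∂M ≤ ∫ z, g z ∂M := by
    refine integral_mono ((integrable_const _).sub hi) hg fun z => ?_
    have := Real.add_one_le_exp (-g z)
    simp only
    linarith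
  rw [integral_sub (integrable_const _) hi] at h2
  simp at h2
  linarith

namespace IsGaussianNoise

variable [AddCommGroup E] [MeasurableSpace E] {γ : Measure E} {B : E → E → ℝ}

lemma add_right (h : IsGaussianNoise γ B) (x y z : E) : B x (y + z) = B x y + B x z := by
  rw [h.symm, h.add_left, h.symm y, h.symm z]

lemma zero_left (h : IsGaussianNoise γ B) (y : E) : B 0 y = 0 := by
  have := h.add_left 0 0 y
  simpa using this

lemma neg_left (h : IsGaussianNoise γ B) (x y : E) : B (-x) y = -B x y := by
  have := h.add_left x (-x) y
  rw [add_neg_cancel, h.zero_left] at this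
  linarith

lemma neg_right (h : IsGaussianNoise γ B) (x y : E) : B x (-y) = -B x y := by
  rw [h.symm, h.neg_left, h.symm]

lemma two_mul_le (h : IsGaussianNoise γ B) (x y : E) : 2 * B x y ≤ B x x + B y y := by
  have := h.nonneg (x + -y)
  simp only [h.add_left, h.add_right, h.neg_left, h.neg_right, h.symm y x] at this
  linarith

lemma neg_two_mul_le (h : IsGaussianNoise γ B) (x y : E) : -(2 * B x y) ≤ B x x + B y y := by
  have := h.two_mul_le (-x) y
  simp only [h.neg_left, h.neg_right] at this
  linarith

lemma add_self_le (h : IsGaussianNoise γ B) (x y : E) :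
    B (x + y) (x + y) ≤ 2 * B x x + 2 * B y y := by
  have := h.two_mul_le x y
  simp only [h.add_left, h.add_right, h.symm y x]
  linarith

lemma measurable_logLikelihood (h : IsGaussianNoise γ B) :
    Measurable fun p : E × E => logLikelihood B p.1 p.2 := by
  have h2 : Measurable fun p : E × E => B p.1 p.1 :=
    h.measurable.comp (measurable_fst.prodMk measurable_fst)
  exact h.measurable.sub (h2.div_const 2)

lemma measurable_diag (h : IsGaussianNoise γ B) : Measurable fun x : E => B x x :=
  h.measurable.comp (measurable_id.prodMk measurable_id)

lemma measurable_likelihood (h : IsGaussianNoise γ B) :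
    Measurable fun p : E × E => ENNReal.ofReal (Real.exp (logLikelihood B p.1 p.2)) :=
  (Real.measurable_exp.comp h.measurable_logLikelihood).ennreal_ofReal

lemma measurable_outputDensity (h : IsGaussianNoise γ B) (σ : Measure E) [SFinite σ] :
    Measurable (outputDensity B σ) :=
  (h.measurable_likelihood.comp measurable_swap).lintegral_prod_right'

lemma measurable_logOutput (h : IsGaussianNoise γ B) (σ : Measure E) [SFinite σ] :
    Measurable (logOutput B σ) :=
  Real.measurable_log.comp (h.measurable_outputDensity σ).ennreal_toReal

/-- Integrating over the noisy observation is integrating against the likelihood. -/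
lemma lintegral_add [MeasurableAdd₂ E] (h : IsGaussianNoise γ B) (c : E) {F : E → ℝ≥0∞} (hF : Measurable F) :
    ∫⁻ w, F (c + w) ∂γ = ∫⁻ y, ENNReal.ofReal (Real.exp (logLikelihood B c y)) * F y ∂γ := by
  rw [← lintegral_map (g := fun w => c + w) hF (measurable_const_add c), h.map_add,
    lintegral_withDensity_eq_lintegral_mul _ _ hF]
  · rfl
  · exact h.measurable_likelihood.comp measurable_prodMk_left

lemma lintegral_likelihood [MeasurableAdd₂ E] (h : IsGaussianNoise γ B) (c : E) :
    ∫⁻ y, ENNReal.ofReal (Real.exp (logLikelihood B c y)) ∂γ = 1 := by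
  have := h.isProbabilityMeasure
  have := h.lintegral_add c (F := fun _ => 1) measurable_const
  simpa using this.symm

/-- Completing the square bounds the exponent by `B y y / 2` uniformly in the signal. -/
lemma outputDensity_le (h : IsGaussianNoise γ B) (σ : Measure E) [IsProbabilityMeasure σ] (y : E) :
    outputDensity B σ y ≤ ENNReal.ofReal (Real.exp (B y y / 2)) := by
  calc outputDensity B σ y ≤ ∫⁻ _, ENNReal.ofReal (Real.exp (B y y / 2)) ∂σ := by
        refine lintegral_mono fun c => ENNReal.ofReal_le_ofReal (Real.exp_le_exp.2 ?_)
        have := h.two_mul_le c y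
        simp only [logLikelihood]
        linarith
    _ = _ := by simp

/-- Since `-2 B c y ≤ B c c + B y y`, each likelihood is at least `exp (-B c c) exp (-B y y / 2)`.
The mean of the first factor is a positive constant for any signal law, without a moment condition.
-/
lemma exists_le_outputDensity (h : IsGaussianNoise γ B) (σ : Measure E) [IsProbabilityMeasure σ] :
    ∃ C : ℝ, ∀ y, ENNReal.ofReal (Real.exp (-C - B y y / 2)) ≤ outputDensity B σ y := by
  set κ := ∫⁻ c, ENNReal.ofReal (Real.exp (-B c c)) ∂σ with hκ
  have hmeas : Measurable fun c : E => ENNReal.ofReal (Real.exp (-B c c)) :=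
    (Real.measurable_exp.comp h.measurable_diag.neg).ennreal_ofReal
  have hpos : 0 < κ := by
    rw [hκ, lintegral_pos_iff_support hmeas]
    have : Function.support (fun c : E => ENNReal.ofReal (Real.exp (-B c c))) = Set.univ := by
      ext c; simp [Real.exp_pos]
    rw [this]; simp
  have hle : κ ≤ 1 := by
    calc κ ≤ ∫⁻ _, 1 ∂σ := lintegral_mono fun c => by
          simpa using h.nonneg c
      _ = 1 := by simp
  have hfin : κ ≠ ∞ := (hle.trans_lt ENNReal.one_lt_top).ne
  refine ⟨-Real.log κ.toReal, fun y => ?_⟩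
  have hκpos : 0 < κ.toReal := ENNReal.toReal_pos hpos.ne' hfin
  rw [neg_neg, sub_eq_add_neg, Real.exp_add, Real.exp_log hκpos, ENNReal.ofReal_mul hκpos.le,
    ENNReal.ofReal_toReal hfin, hκ, ← lintegral_mul_const _ hmeas]
  refine lintegral_mono fun c => ?_
  simp only
  rw [← ENNReal.ofReal_mul (Real.exp_pos _).le, ← Real.exp_add]
  refine ENNReal.ofReal_le_ofReal (Real.exp_le_exp.2 ?_)
  have := h.neg_two_mul_le c y
  simp only [logLikelihood]
  linarith

lemma outputDensity_ne_top (h : IsGaussianNoise γ B) (σ : Measure E) [IsProbabilityMeasure σ]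
    (y : E) : outputDensity B σ y ≠ ∞ :=
  ((h.outputDensity_le σ y).trans_lt ENNReal.ofReal_lt_top).ne

lemma outputDensity_ne_zero (h : IsGaussianNoise γ B) (σ : Measure E) [IsProbabilityMeasure σ]
    (y : E) : outputDensity B σ y ≠ 0 := by
  obtain ⟨C, hC⟩ := h.exists_le_outputDensity σ
  exact (lt_of_lt_of_le (by simp [Real.exp_pos]) (hC y)).ne'

lemma ofReal_exp_logOutput (h : IsGaussianNoise γ B) (σ : Measure E) [IsProbabilityMeasure σ]
    (y : E) : ENNReal.ofReal (Real.exp (logOutput B σ y)) = outputDensity B σ y := by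
  rw [logOutput, Real.exp_log (ENNReal.toReal_pos (h.outputDensity_ne_zero σ y)
    (h.outputDensity_ne_top σ y)), ENNReal.ofReal_toReal (h.outputDensity_ne_top σ y)]

lemma ofReal_exp_neg_logOutput (h : IsGaussianNoise γ B) (σ : Measure E) [IsProbabilityMeasure σ]
    (y : E) : ENNReal.ofReal (Real.exp (-logOutput B σ y)) = (outputDensity B σ y)⁻¹ := by
  rw [Real.exp_neg, ENNReal.ofReal_inv_of_pos (Real.exp_pos _), h.ofReal_exp_logOutput]

/-- Quadratic growth of the log output density is what makes it integrable when signal and noise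
have finite energy. -/
lemma exists_abs_logOutput_le (h : IsGaussianNoise γ B) (σ : Measure E) [IsProbabilityMeasure σ] :
    ∃ C : ℝ, ∀ y, |logOutput B σ y| ≤ C + B y y := by
  obtain ⟨C, hC⟩ := h.exists_le_outputDensity σ
  refine ⟨|C|, fun y => ?_⟩
  have h1 := h.outputDensity_le σ y
  have h2 := hC y
  rw [← h.ofReal_exp_logOutput σ, ENNReal.ofReal_le_ofReal_iff (Real.exp_pos _).le,
    Real.exp_le_exp] at h1 h2
  have := h.nonneg y
  have := neg_abs_le C
  have := le_abs_self C
  rw [abs_le]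
  constructor <;> linarith

lemma integrable_diag_add (h : IsGaussianNoise γ B) {A : Type*} [MeasurableSpace A] [MeasurableAdd₂ E]
    {π : Measure A} [IsProbabilityMeasure π] {f : A → E} (hf : Measurable f)
    (hπ : Integrable (fun a => B (f a) (f a)) π) :
    Integrable (fun p : A × E => B (f p.1 + p.2) (f p.1 + p.2)) (π.prod γ) := by
  have := h.isProbabilityMeasure
  have h1 : Integrable (fun p : A × E => 2 * B (f p.1) (f p.1) + 2 * B p.2 p.2) (π.prod γ) :=
    ((hπ.comp_fst γ).const_mul 2).add ((h.integrable.comp_snd π).const_mul 2)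
  refine h1.mono' ?_ (Eventually.of_forall fun p => ?_)
  · exact (h.measurable_diag.comp ((hf.comp measurable_fst).add measurable_snd)).aestronglyMeasurable
  · rw [Real.norm_of_nonneg (h.nonneg _)]
    exact h.add_self_le _ _

lemma integrable_logOutput (h : IsGaussianNoise γ B) {A : Type*} [MeasurableSpace A]
    [MeasurableAdd₂ E] {π : Measure A} [IsProbabilityMeasure π] {f : A → E} (hf : Measurable f)
    (hπ : Integrable (fun a => B (f a) (f a)) π) (σ : Measure E) [IsProbabilityMeasure σ] :
    Integrable (fun p : A × E => logOutput B σ (f p.1 + p.2)) (π.prod γ) := by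
  have := h.isProbabilityMeasure
  obtain ⟨C, hC⟩ := h.exists_abs_logOutput_le σ
  refine ((integrable_const C).add (h.integrable_diag_add hf hπ)).mono' ?_
    (Eventually.of_forall fun p => hC _)
  exact ((h.measurable_logOutput σ).comp
    ((hf.comp measurable_fst).add measurable_snd)).aestronglyMeasurable

lemma integrable_logLikelihood (h : IsGaussianNoise γ B) {A : Type*} [MeasurableSpace A]
    [MeasurableAdd₂ E] {π : Measure A} [IsProbabilityMeasure π] {f : A → E} (hf : Measurable f)
    (hπ : Integrable (fun a => B (f a) (f a)) π) :
    Integrable (fun p : A × E => logLikelihood B (f p.1) (f p.1 + p.2)) (π.prod γ) := by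
  have := h.isProbabilityMeasure
  refine ((hπ.comp_fst γ).add (h.integrable_diag_add hf hπ)).mono' ?_
    (Eventually.of_forall fun p => ?_)
  · exact (h.measurable_logLikelihood.comp ((hf.comp measurable_fst).prodMk
      ((hf.comp measurable_fst).add measurable_snd))).aestronglyMeasurable
  · have h1 := h.two_mul_le (f p.1) (f p.1 + p.2)
    have h2 := h.neg_two_mul_le (f p.1) (f p.1 + p.2)
    have h3 := h.nonneg (f p.1)
    have h4 := h.nonneg (f p.1 + p.2)
    simp only [logLikelihood, Real.norm_eq_abs, Pi.add_apply]
    rw [abs_le]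
    constructor <;> linarith

end IsGaussianNoise
end Channel

/-! ### Sufficient statistics, and identification with the relative entropy. -/

section Channel

variable {E F A : Type*} [MeasurableSpace A]

lemma outputDensity_map [AddCommGroup E] [MeasurableSpace E] {γ : Measure E} {B : E → E → ℝ}
    (h : IsGaussianNoise γ B) {π : Measure A} {f : A → E} (hf : Measurable f) (y : E) :
    outputDensity B (π.map f) y
      = ∫⁻ a, ENNReal.ofReal (Real.exp (logLikelihood B (f a) y)) ∂π :=
  lintegral_map (h.measurable_likelihood.comp measurable_prodMk_right) hf

/-- The channel information as an expectation over an input and a noise space of which the signal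
and the noise are measurable functions. -/
lemma gaussianInfo_map [AddCommGroup E] [MeasurableSpace E] [MeasurableAdd₂ E] {γ : Measure E}
    {B : E → E → ℝ} (h : IsGaussianNoise γ B) {Z : Type*} [MeasurableSpace Z] {ζ : Measure Z}
    [SFinite ζ] {t : Z → E} (ht : Measurable t) (hγ : ζ.map t = γ)
    {π : Measure A} [IsProbabilityMeasure π] {f : A → E} (hf : Measurable f) :
    gaussianInfo γ B (π.map f) = ∫ p : A × Z, (logLikelihood B (f p.1) (f p.1 + t p.2)
      - logOutput B (π.map f) (f p.1 + t p.2)) ∂(π.prod ζ) := by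
  have := h.isProbabilityMeasure
  have h1 : (π.map f).prod γ = (π.prod ζ).map (Prod.map f t) := by
    rw [← hγ, Measure.map_prod_map _ _ hf ht]
  have hadd : Measurable fun p : E × E => p.1 + p.2 := measurable_add
  rw [gaussianInfo, h1, integral_map (hf.prodMap ht).aemeasurable]
  · rfl
  · exact ((h.measurable_logLikelihood.comp (measurable_fst.prodMk hadd)).sub
      ((h.measurable_logOutput _).comp hadd)).aestronglyMeasurable

/-- A sufficient statistic keeps the information. -/
lemma gaussianInfo_map_eq_of_sufficient [AddCommGroup E] [MeasurableSpace E] [MeasurableAdd₂ E]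
    [AddCommGroup F] [MeasurableSpace F] [MeasurableAdd₂ F]
    {γ : Measure E} {B : E → E → ℝ} (h : IsGaussianNoise γ B)
    {γ' : Measure F} {B' : F → F → ℝ} (h' : IsGaussianNoise γ' B')
    {t : E → F} (ht : Measurable t) (hγ : γ.map t = γ') (hadd : ∀ x y, t (x + y) = t x + t y)
    {π : Measure A} [IsProbabilityMeasure π] {f : A → E} (hf : Measurable f) {g : A → F}
    (hg : Measurable g) (htf : ∀ a, t (f a) = g a) (hB : ∀ a y, B (f a) y = B' (g a) (t y)) :
    gaussianInfo γ B (π.map f) = gaussianInfo γ' B' (π.map g) := by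
  have := h.isProbabilityMeasure
  -- The likelihood sees the observation only through `t`; the output density, an average of
  -- likelihoods, does too.
  have hL : ∀ a y, logLikelihood B (f a) y = logLikelihood B' (g a) (t y) := fun a y => by
    simp only [logLikelihood, hB, htf]
  rw [gaussianInfo_map h measurable_id Measure.map_id hf, gaussianInfo_map h' ht hγ hg]
  refine integral_congr_ae (Eventually.of_forall fun p => ?_)
  simp only [logOutput, outputDensity_map h hf, outputDensity_map h' hg, hL, id, hadd, htf]

/-- With a null signal all likelihoods equal `1`. This settles the degenerate cases: empty blocks,
signatures of zero energy, void observations, Gaussian inputs of variance zero. -/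
lemma gaussianInfo_dirac_zero [AddCommGroup E] [MeasurableSpace E] [MeasurableAdd₂ E]
    {γ : Measure E} {B : E → E → ℝ} (h : IsGaussianNoise γ B) (π : Measure A)
    [IsProbabilityMeasure π] : gaussianInfo γ B (π.map fun _ => (0 : E)) = 0 := by
  have := h.isProbabilityMeasure
  rw [gaussianInfo_map h measurable_id Measure.map_id measurable_const]
  have h1 : ∀ y, logOutput B (π.map fun _ => (0 : E)) y = 0 := fun y => by
    rw [logOutput, outputDensity_map h measurable_const]
    simp [logLikelihood, h.zero_left]
  simp only [h1]
  simp [logLikelihood, h.zero_left]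

namespace IsGaussianNoise

variable [AddCommGroup E] [MeasurableSpace E] [MeasurableAdd₂ E] {γ : Measure E} {B : E → E → ℝ}

/-- The law of the input and the noisy observation. -/
lemma lintegral_prod_add (h : IsGaussianNoise γ B) {π : Measure A} [IsProbabilityMeasure π]
    {f : A → E} (hf : Measurable f) {G : A × E → ℝ≥0∞} (hG : Measurable G) :
    ∫⁻ p, G (p.1, f p.1 + p.2) ∂(π.prod γ)
      = ∫⁻ p, ENNReal.ofReal (Real.exp (logLikelihood B (f p.1) p.2)) * G p ∂(π.prod γ) := by
  have := h.isProbabilityMeasure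
  have hadd : Measurable fun p : A × E => (p.1, f p.1 + p.2) :=
    measurable_fst.prodMk ((hf.comp measurable_fst).add measurable_snd)
  have hG' : Measurable fun p : A × E => G (p.1, f p.1 + p.2) := hG.comp hadd
  rw [lintegral_prod _ hG'.aemeasurable, lintegral_prod]
  · refine lintegral_congr fun a => ?_
    exact h.lintegral_add (f a) (F := fun y => G (a, y)) (hG.comp measurable_prodMk_left)
  · exact ((h.measurable_likelihood.comp
      ((hf.comp measurable_fst).prodMk measurable_snd)).mul hG).aemeasurable

/-- The law of the noisy observation. -/
lemma lintegral_comp_add (h : IsGaussianNoise γ B) {π : Measure A} [IsProbabilityMeasure π]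
    {f : A → E} (hf : Measurable f) {G : E → ℝ≥0∞} (hG : Measurable G) :
    ∫⁻ p : A × E, G (f p.1 + p.2) ∂(π.prod γ)
      = ∫⁻ y, outputDensity B (π.map f) y * G y ∂γ := by
  have := h.isProbabilityMeasure
  rw [h.lintegral_prod_add hf (G := fun p => G p.2) (hG.comp measurable_snd), lintegral_prod_symm]
  · refine lintegral_congr fun y => ?_
    rw [outputDensity_map h hf]
    have hm : Measurable fun a => ENNReal.ofReal (Real.exp (logLikelihood B (f a) y)) :=
      h.measurable_likelihood.comp (hf.prodMk measurable_const)
    exact lintegral_mul_const (G y) hm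
  · exact ((h.measurable_likelihood.comp
      ((hf.comp measurable_fst).prodMk measurable_snd)).mul
        (hG.comp measurable_snd)).aemeasurable

lemma lintegral_outputDensity (h : IsGaussianNoise γ B) (σ : Measure E) [IsProbabilityMeasure σ] :
    ∫⁻ y, outputDensity B σ y ∂γ = 1 := by
  have := h.isProbabilityMeasure
  have := h.lintegral_comp_add (π := σ) measurable_id (G := fun _ => 1) measurable_const
  simpa using this.symm

/-- Here `e^{-g}` is output density over likelihood; the joint law has the likelihood as density, so
the mean of `e^{-g}` is the total mass `1` of the output law. -/
lemma gaussianInfo_nonneg (h : IsGaussianNoise γ B) {σ : Measure E} [IsProbabilityMeasure σ]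
    (hσ : Integrable (fun c => B c c) σ) : 0 ≤ gaussianInfo γ B σ := by
  have := h.isProbabilityMeasure
  refine integral_nonneg_of_lintegral_exp_neg_le_one
    ((h.integrable_logLikelihood measurable_id hσ).sub
      (h.integrable_logOutput measurable_id hσ σ)) ?_
  simp only [neg_sub]
  set G : E × E → ℝ≥0∞ := fun p =>
    ENNReal.ofReal (Real.exp (logOutput B σ p.2 - logLikelihood B p.1 p.2)) with hG
  have hGm : Measurable G := (Real.measurable_exp.comp
    (((h.measurable_logOutput σ).comp measurable_snd).sub h.measurable_logLikelihood)).ennreal_ofReal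
  have h1 := h.lintegral_prod_add (π := σ) measurable_id hGm
  simp only [id] at h1
  rw [h1]
  have h2 : ∀ p : E × E, ENNReal.ofReal (Real.exp (logLikelihood B p.1 p.2)) * G p
      = outputDensity B σ p.2 := fun p => by
    rw [hG, ← ENNReal.ofReal_mul (Real.exp_pos _).le, ← Real.exp_add, add_sub_cancel,
      h.ofReal_exp_logOutput]
  have h3 : Measurable fun p : E × E => outputDensity B σ p.2 :=
    (h.measurable_outputDensity σ).comp measurable_snd
  simp only [h2]
  rw [lintegral_prod _ h3.aemeasurable]
  simp [h.lintegral_outputDensity]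

/-- The mutual information of the channel is the channel information. -/
lemma klDiv_joint (h : IsGaussianNoise γ B) {π : Measure A} [IsProbabilityMeasure π]
    {f : A → E} (hf : Measurable f) (hπ : Integrable (fun a => B (f a) (f a)) π) :
    InformationTheory.klDiv ((π.prod γ).map fun p => (p.1, f p.1 + p.2))
      (((π.prod γ).map fun p => p.1).prod ((π.prod γ).map fun p => f p.1 + p.2))
      = ENNReal.ofReal (gaussianInfo γ B (π.map f)) := by
  have := h.isProbabilityMeasure
  have : IsProbabilityMeasure (π.map f) := Measure.isProbabilityMeasure_map hf.aemeasurable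
  set σ := π.map f with hσ
  have hadd : Measurable fun p : A × E => (p.1, f p.1 + p.2) :=
    measurable_fst.prodMk ((hf.comp measurable_fst).add measurable_snd)
  have hadd' : Measurable fun p : A × E => f p.1 + p.2 := measurable_snd.comp hadd
  have hL : Measurable fun p : A × E =>
      ENNReal.ofReal (Real.exp (logLikelihood B (f p.1) p.2)) :=
    h.measurable_likelihood.comp ((hf.comp measurable_fst).prodMk measurable_snd)
  have hΛ := h.measurable_outputDensity σ
  have hjoint : (π.prod γ).map (fun p => (p.1, f p.1 + p.2)) = (π.prod γ).withDensity
      fun p => ENNReal.ofReal (Real.exp (logLikelihood B (f p.1) p.2)) := by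
    refine Measure.ext_of_lintegral _ fun G hG => ?_
    rw [lintegral_map hG hadd, h.lintegral_prod_add hf hG,
      lintegral_withDensity_eq_lintegral_mul _ hL hG]
    rfl
  have hout : (π.prod γ).map (fun p => f p.1 + p.2) = γ.withDensity (outputDensity B σ) := by
    refine Measure.ext_of_lintegral _ fun G hG => ?_
    rw [lintegral_map hG hadd', h.lintegral_comp_add hf hG,
      lintegral_withDensity_eq_lintegral_mul _ hΛ hG]
    rfl
  have hfst : (π.prod γ).map (fun p => p.1) = π := by
    rw [Measure.map_fst_prod]; simp
  have hprod : ((π.prod γ).map fun p => p.1).prod ((π.prod γ).map fun p => f p.1 + p.2)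
      = (π.prod γ).withDensity fun p => outputDensity B σ p.2 := by
    rw [hfst, hout, prod_withDensity_right hΛ]
  have hp1 : IsProbabilityMeasure ((π.prod γ).map fun p => (p.1, f p.1 + p.2)) :=
    Measure.isProbabilityMeasure_map hadd.aemeasurable
  have hp2 : IsProbabilityMeasure
      (((π.prod γ).map fun p => p.1).prod ((π.prod γ).map fun p => f p.1 + p.2)) := by
    have := Measure.isProbabilityMeasure_map (μ := π.prod γ) hadd'.aemeasurable
    rw [hfst]
    infer_instance
  set J := (π.prod γ).map fun p => (p.1, f p.1 + p.2) with hJ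
  set Q := ((π.prod γ).map fun p => p.1).prod ((π.prod γ).map fun p => f p.1 + p.2) with hQ
  -- Relative to `π.prod γ`, the joint law has density the likelihood and the product of the
  -- marginals has density the output density. The latter is neither `0` nor `∞`, so their quotient
  -- `r` is the density of `J` with respect to `Q`.
  set r : A × E → ℝ≥0∞ := fun p =>
    ENNReal.ofReal (Real.exp (logLikelihood B (f p.1) p.2 - logOutput B σ p.2)) with hr
  have hlog : Measurable fun p : A × E => logLikelihood B (f p.1) p.2 - logOutput B σ p.2 :=
    (h.measurable_logLikelihood.comp ((hf.comp measurable_fst).prodMk measurable_snd)).sub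
      ((h.measurable_logOutput σ).comp measurable_snd)
  have hrm : Measurable r := (Real.measurable_exp.comp hlog).ennreal_ofReal
  have hJQ : J = Q.withDensity r := by
    have hΛ' : Measurable fun p : A × E => outputDensity B σ p.2 := hΛ.comp measurable_snd
    rw [hjoint, hprod, ← withDensity_mul _ hΛ' hrm]
    congr 1
    ext p
    simp only [Pi.mul_apply, hr]
    rw [← h.ofReal_exp_logOutput σ, ← ENNReal.ofReal_mul (Real.exp_pos _).le, ← Real.exp_add,
      add_sub_cancel]
  have hac : J ≪ Q := hJQ ▸ withDensity_absolutelyContinuous _ _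
  have hllr : llr J Q =ᵐ[J] fun p => logLikelihood B (f p.1) p.2 - logOutput B σ p.2 := by
    have : J.rnDeriv Q =ᵐ[Q] r := by
      rw [hJQ]
      exact Measure.rnDeriv_withDensity Q hrm
    filter_upwards [hac.ae_le this] with p hp
    rw [llr, hp, hr, ENNReal.toReal_ofReal (Real.exp_pos _).le, Real.log_exp]
  have hint : Integrable (fun p : A × E => logLikelihood B (f p.1) p.2 - logOutput B σ p.2) J := by
    rw [hJ, integrable_map_measure hlog.aestronglyMeasurable hadd.aemeasurable]
    exact (h.integrable_logLikelihood hf hπ).sub (h.integrable_logOutput hf hπ σ)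
  rw [InformationTheory.klDiv_of_ac_of_integrable hac ((integrable_congr hllr).2 hint),
    integral_congr_ae hllr, hJ, integral_map hadd.aemeasurable hlog.aestronglyMeasurable,
    gaussianInfo_map h measurable_id Measure.map_id hf]
  simp [σ]

end IsGaussianNoise
end Channel

/-! ### Independent noises, submodularity, and sums of independent signals. -/

section Channel

variable {E E₁ E₂ E₃ A : Type*} [MeasurableSpace A]

lemma integrable_gaussianInfo [AddCommGroup E] [MeasurableSpace E] [MeasurableAdd₂ E]
    {γ : Measure E} {B : E → E → ℝ} (h : IsGaussianNoise γ B) {Z : Type*} [MeasurableSpace Z]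
    {ζ : Measure Z} [SFinite ζ] {t : Z → E} (ht : Measurable t) (hγ : ζ.map t = γ)
    {π : Measure A} [IsProbabilityMeasure π] {f : A → E} (hf : Measurable f)
    (hπ : Integrable (fun a => B (f a) (f a)) π) :
    Integrable (fun p : A × Z => logLikelihood B (f p.1) (f p.1 + t p.2)
      - logOutput B (π.map f) (f p.1 + t p.2)) (π.prod ζ) := by
  have : IsProbabilityMeasure (π.map f) := Measure.isProbabilityMeasure_map hf.aemeasurable
  have h1 := (h.integrable_logLikelihood hf hπ).sub (h.integrable_logOutput hf hπ (π.map f))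
  have h2 : π.prod γ = (π.prod ζ).map (Prod.map id t) := by
    rw [← hγ, ← Measure.map_prod_map _ _ measurable_id ht, Measure.map_id]
  rw [h2] at h1
  exact h1.comp_measurable (measurable_id.prodMap ht)

/-- Comparison of expectations from an exponential moment. -/
lemma integral_le_add_of_lintegral_exp_neg_le_one {M : Measure A} [IsProbabilityMeasure M]
    {f g k : A → ℝ} (hf : Integrable f M) (hg : Integrable g M) (hk : Integrable k M)
    (h : ∫⁻ z, ENNReal.ofReal (Real.exp (-(f z + g z - k z))) ∂M ≤ 1) :
    ∫ z, k z ∂M ≤ ∫ z, f z ∂M + ∫ z, g z ∂M := by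
  have h1 := integral_nonneg_of_lintegral_exp_neg_le_one ((hf.add hg).sub hk) h
  have h2 : ∫ z, (f + g - k) z ∂M = ∫ z, f z ∂M + ∫ z, g z ∂M - ∫ z, k z ∂M := by
    rw [integral_sub' (hf.add hg) hk, integral_add' hf hg]
  linarith

instance [Add E₁] [MeasurableSpace E₁] [MeasurableAdd₂ E₁] [Add E₂] [MeasurableSpace E₂]
    [MeasurableAdd₂ E₂] : MeasurableAdd₂ (E₁ × E₂) where
  measurable_add :=
    ((measurable_fst.comp measurable_fst).add (measurable_fst.comp measurable_snd)).prodMk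
      ((measurable_snd.comp measurable_fst).add (measurable_snd.comp measurable_snd))

/-- The Cameron-Martin form of a pair of independent noises. -/
def prodForm (B₁ : E₁ → E₁ → ℝ) (B₂ : E₂ → E₂ → ℝ) (x y : E₁ × E₂) : ℝ :=
  B₁ x.1 y.1 + B₂ x.2 y.2

lemma logLikelihood_prodForm (B₁ : E₁ → E₁ → ℝ) (B₂ : E₂ → E₂ → ℝ) (x y : E₁ × E₂) :
    logLikelihood (prodForm B₁ B₂) x y
      = logLikelihood B₁ x.1 y.1 + logLikelihood B₂ x.2 y.2 := by
  simp only [logLikelihood, prodForm]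
  ring

lemma ofReal_exp_add (a b : ℝ) :
    ENNReal.ofReal (Real.exp (a + b))
      = ENNReal.ofReal (Real.exp a) * ENNReal.ofReal (Real.exp b) := by
  rw [Real.exp_add, ENNReal.ofReal_mul (Real.exp_pos _).le]

variable [AddCommGroup E₁] [MeasurableSpace E₁] [MeasurableAdd₂ E₁]
  [AddCommGroup E₂] [MeasurableSpace E₂] [MeasurableAdd₂ E₂]
  [AddCommGroup E₃] [MeasurableSpace E₃] [MeasurableAdd₂ E₃]
  {γ₁ : Measure E₁} {B₁ : E₁ → E₁ → ℝ} {γ₂ : Measure E₂} {B₂ : E₂ → E₂ → ℝ}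
  {γ₃ : Measure E₃} {B₃ : E₃ → E₃ → ℝ}

namespace IsGaussianNoise

lemma prod (h₁ : IsGaussianNoise γ₁ B₁) (h₂ : IsGaussianNoise γ₂ B₂) :
    IsGaussianNoise (γ₁.prod γ₂) (prodForm B₁ B₂) := by
  have := h₁.isProbabilityMeasure
  have := h₂.isProbabilityMeasure
  have hm : Measurable fun p : (E₁ × E₂) × (E₁ × E₂) => prodForm B₁ B₂ p.1 p.2 :=
    (h₁.measurable.comp ((measurable_fst.comp measurable_fst).prodMk
      (measurable_fst.comp measurable_snd))).add
    (h₂.measurable.comp ((measurable_snd.comp measurable_fst).prodMk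
      (measurable_snd.comp measurable_snd)))
  refine ⟨inferInstance, hm, fun x y => ?_, fun x y z => ?_, fun x => ?_, ?_, fun c => ?_⟩
  · simp only [prodForm, h₁.symm x.1, h₂.symm x.2]
  · simp only [prodForm, Prod.fst_add, Prod.snd_add, h₁.add_left, h₂.add_left]
    ring
  · exact add_nonneg (h₁.nonneg _) (h₂.nonneg _)
  · exact (h₁.integrable.comp_fst γ₂).add (h₂.integrable.comp_snd γ₁)
  · have h3 : (fun w : E₁ × E₂ => c + w) = Prod.map (fun w => c.1 + w) (fun w => c.2 + w) := by
      ext w <;> rfl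
    have hd₁ : Measurable fun y => ENNReal.ofReal (Real.exp (B₁ c.1 y - B₁ c.1 c.1 / 2)) :=
      h₁.measurable_likelihood.comp measurable_prodMk_left
    have hd₂ : Measurable fun y => ENNReal.ofReal (Real.exp (B₂ c.2 y - B₂ c.2 c.2 / 2)) :=
      h₂.measurable_likelihood.comp measurable_prodMk_left
    rw [h3, ← Measure.map_prod_map _ _ (measurable_const_add _) (measurable_const_add _),
      h₁.map_add, h₂.map_add, prod_withDensity hd₁ hd₂]
    congr 1
    ext y
    rw [← ofReal_exp_add]
    congr 2
    simp only [prodForm]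
    ring

/-- Independent signals over independent noises: the informations add up. -/
lemma gaussianInfo_prod (h₁ : IsGaussianNoise γ₁ B₁) (h₂ : IsGaussianNoise γ₂ B₂)
    {σ₁ : Measure E₁} [IsProbabilityMeasure σ₁] {σ₂ : Measure E₂} [IsProbabilityMeasure σ₂]
    (hσ₁ : Integrable (fun c => B₁ c c) σ₁) (hσ₂ : Integrable (fun c => B₂ c c) σ₂) :
    gaussianInfo (γ₁.prod γ₂) (prodForm B₁ B₂) (σ₁.prod σ₂)
      = gaussianInfo γ₁ B₁ σ₁ + gaussianInfo γ₂ B₂ σ₂ := by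
  have := h₁.isProbabilityMeasure
  have := h₂.isProbabilityMeasure
  have hout : ∀ y, logOutput (prodForm B₁ B₂) (σ₁.prod σ₂) y
      = logOutput B₁ σ₁ y.1 + logOutput B₂ σ₂ y.2 := fun y => by
    have : outputDensity (prodForm B₁ B₂) (σ₁.prod σ₂) y
        = outputDensity B₁ σ₁ y.1 * outputDensity B₂ σ₂ y.2 := by
      simp only [outputDensity, logLikelihood_prodForm, ofReal_exp_add]
      exact lintegral_prod_mul
        (h₁.measurable_likelihood.comp measurable_prodMk_right).aemeasurable
        (h₂.measurable_likelihood.comp measurable_prodMk_right).aemeasurable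
    rw [logOutput, this, ENNReal.toReal_mul, Real.log_mul]
    · rfl
    · exact (ENNReal.toReal_pos (h₁.outputDensity_ne_zero _ _) (h₁.outputDensity_ne_top _ _)).ne'
    · exact (ENNReal.toReal_pos (h₂.outputDensity_ne_zero _ _) (h₂.outputDensity_ne_top _ _)).ne'
  have e₁ : (σ₁.prod σ₂).map Prod.fst = σ₁ := by rw [Measure.map_fst_prod]; simp
  have e₂ : (σ₁.prod σ₂).map Prod.snd = σ₂ := by rw [Measure.map_snd_prod]; simp
  have g₁ : (γ₁.prod γ₂).map Prod.fst = γ₁ := by rw [Measure.map_fst_prod]; simp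
  have g₂ : (γ₁.prod γ₂).map Prod.snd = γ₂ := by rw [Measure.map_snd_prod]; simp
  have i₁ := integrable_gaussianInfo h₁ measurable_fst g₁ (π := σ₁.prod σ₂) measurable_fst
    (hσ₁.comp_fst σ₂)
  have i₂ := integrable_gaussianInfo h₂ measurable_snd g₂ (π := σ₁.prod σ₂) measurable_snd
    (hσ₂.comp_snd σ₁)
  have k₁ := gaussianInfo_map h₁ measurable_fst g₁ (π := σ₁.prod σ₂) measurable_fst
  have k₂ := gaussianInfo_map h₂ measurable_snd g₂ (π := σ₁.prod σ₂) measurable_snd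
  rw [e₁] at k₁ i₁
  rw [e₂] at k₂ i₂
  rw [k₁, k₂, ← integral_add i₁ i₂, gaussianInfo]
  refine integral_congr_ae (Eventually.of_forall fun p => ?_)
  simp only [logLikelihood_prodForm, hout, Prod.fst_add, Prod.snd_add]
  ring

/-- Given the signal, the second likelihood integrates to `1`, so integrating out the second
observation leaves the density of the first. -/
lemma lintegral_outputDensity_snd (h₁ : IsGaussianNoise γ₁ B₁) (h₂ : IsGaussianNoise γ₂ B₂)
    {π : Measure A} [IsProbabilityMeasure π] {f₁ : A → E₁} (hf₁ : Measurable f₁) {f₂ : A → E₂}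
    (hf₂ : Measurable f₂) (y : E₁) :
    ∫⁻ z, outputDensity (prodForm B₁ B₂) (π.map fun a => (f₁ a, f₂ a)) (y, z) ∂γ₂
      = outputDensity B₁ (π.map f₁) y := by
  have := h₂.isProbabilityMeasure
  simp only [outputDensity_map (h₁.prod h₂) (hf₁.prodMk hf₂), outputDensity_map h₁ hf₁]
  rw [lintegral_lintegral_swap]
  · refine lintegral_congr fun a => ?_
    simp only [logLikelihood_prodForm, ofReal_exp_add]
    have hm : Measurable fun z => ENNReal.ofReal (Real.exp (logLikelihood B₂ (f₂ a) z)) :=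
      h₂.measurable_likelihood.comp measurable_prodMk_left
    rw [lintegral_const_mul _ hm, h₂.lintegral_likelihood, mul_one]
  · exact ((h₁.prod h₂).measurable_likelihood.comp (((hf₁.prodMk hf₂).comp measurable_snd).prodMk
      (measurable_const.prodMk measurable_fst))).aemeasurable

/-- Submodularity of the information in the set of observations, whose noises are independent. -/
lemma gaussianInfo_submodular (h₁ : IsGaussianNoise γ₁ B₁) (h₂ : IsGaussianNoise γ₂ B₂)
    (h₃ : IsGaussianNoise γ₃ B₃) {π : Measure A} [IsProbabilityMeasure π]
    {f₁ : A → E₁} (hf₁ : Measurable f₁) {f₂ : A → E₂} (hf₂ : Measurable f₂)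
    {f₃ : A → E₃} (hf₃ : Measurable f₃) (e₁ : Integrable (fun a => B₁ (f₁ a) (f₁ a)) π)
    (e₂ : Integrable (fun a => B₂ (f₂ a) (f₂ a)) π)
    (e₃ : Integrable (fun a => B₃ (f₃ a) (f₃ a)) π) :
    gaussianInfo (γ₁.prod (γ₂.prod γ₃)) (prodForm B₁ (prodForm B₂ B₃))
        (π.map fun a => (f₁ a, (f₂ a, f₃ a))) + gaussianInfo γ₁ B₁ (π.map f₁)
      ≤ gaussianInfo (γ₁.prod γ₂) (prodForm B₁ B₂) (π.map fun a => (f₁ a, f₂ a))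
        + gaussianInfo (γ₁.prod γ₃) (prodForm B₁ B₃) (π.map fun a => (f₁ a, f₃ a)) := by
  have := h₁.isProbabilityMeasure
  have := h₂.isProbabilityMeasure
  have := h₃.isProbabilityMeasure
  have h₁₂ := h₁.prod h₂
  have h₁₃ := h₁.prod h₃
  have h := h₁.prod (h₂.prod h₃)
  have m₁₂ := hf₁.prodMk hf₂
  have m₁₃ := hf₁.prodMk hf₃
  have m := hf₁.prodMk (hf₂.prodMk hf₃)
  have p₁ : IsProbabilityMeasure (π.map f₁) := Measure.isProbabilityMeasure_map hf₁.aemeasurable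
  have p₁₂ : IsProbabilityMeasure (π.map fun a => (f₁ a, f₂ a)) :=
    Measure.isProbabilityMeasure_map m₁₂.aemeasurable
  have p₁₃ : IsProbabilityMeasure (π.map fun a => (f₁ a, f₃ a)) :=
    Measure.isProbabilityMeasure_map m₁₃.aemeasurable
  have p : IsProbabilityMeasure (π.map fun a => (f₁ a, (f₂ a, f₃ a))) :=
    Measure.isProbabilityMeasure_map m.aemeasurable
  have t₁ : Measurable fun w : E₁ × (E₂ × E₃) => w.1 := measurable_fst
  have t₁₂ : Measurable fun w : E₁ × (E₂ × E₃) => (w.1, w.2.1) :=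
    measurable_fst.prodMk (measurable_fst.comp measurable_snd)
  have t₁₃ : Measurable fun w : E₁ × (E₂ × E₃) => (w.1, w.2.2) :=
    measurable_fst.prodMk (measurable_snd.comp measurable_snd)
  have g₁ : (γ₁.prod (γ₂.prod γ₃)).map (fun w => w.1) = γ₁ := by
    rw [Measure.map_fst_prod]; simp
  have g₁₂ : (γ₁.prod (γ₂.prod γ₃)).map (fun w => (w.1, w.2.1)) = γ₁.prod γ₂ := by
    have := Measure.map_prod_map γ₁ (γ₂.prod γ₃) measurable_id measurable_fst
    rw [Measure.map_id, Measure.map_fst_prod, measure_univ, one_smul] at this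
    exact this.symm
  have g₁₃ : (γ₁.prod (γ₂.prod γ₃)).map (fun w => (w.1, w.2.2)) = γ₁.prod γ₃ := by
    have := Measure.map_prod_map γ₁ (γ₂.prod γ₃) measurable_id measurable_snd
    rw [Measure.map_id, Measure.map_snd_prod, measure_univ, one_smul] at this
    exact this.symm
  have i₁ := integrable_gaussianInfo h₁ t₁ g₁ hf₁ e₁
  have i₁₂ := integrable_gaussianInfo h₁₂ t₁₂ g₁₂ m₁₂ (e₁.add e₂)
  have i₁₃ := integrable_gaussianInfo h₁₃ t₁₃ g₁₃ m₁₃ (e₁.add e₃)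
  have i := integrable_gaussianInfo h measurable_id Measure.map_id m (e₁.add (e₂.add e₃))
  rw [gaussianInfo_map h₁ t₁ g₁ hf₁, gaussianInfo_map h₁₂ t₁₂ g₁₂ m₁₂,
    gaussianInfo_map h₁₃ t₁₃ g₁₃ m₁₃, gaussianInfo_map h measurable_id Measure.map_id m,
    ← integral_add i i₁]
  refine integral_le_add_of_lintegral_exp_neg_le_one i₁₂ i₁₃ (i.add i₁) ?_
  set Λ₁ := outputDensity B₁ (π.map f₁) with hΛ₁
  set Λ₁₂ := outputDensity (prodForm B₁ B₂) (π.map fun a => (f₁ a, f₂ a)) with hΛ₁₂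
  set Λ₁₃ := outputDensity (prodForm B₁ B₃) (π.map fun a => (f₁ a, f₃ a)) with hΛ₁₃
  set Λ := outputDensity (prodForm B₁ (prodForm B₂ B₃)) (π.map fun a => (f₁ a, (f₂ a, f₃ a)))
    with hΛ
  have q₁ : Measurable Λ₁ := h₁.measurable_outputDensity _
  have q₁₂ : Measurable Λ₁₂ := h₁₂.measurable_outputDensity _
  have q₁₃ : Measurable Λ₁₃ := h₁₃.measurable_outputDensity _
  have q : Measurable Λ := h.measurable_outputDensity _
  -- The exponential of minus the defect. The log-likelihoods cancel, `(L₁ + L₂) + (L₁ + L₃) = (L₁ +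
  -- L₂ + L₃) + L₁`, and only the output densities remain.
  set G : E₁ × (E₂ × E₃) → ℝ≥0∞ := fun y =>
    Λ₁₂ (y.1, y.2.1) * Λ₁₃ (y.1, y.2.2) * ((Λ y)⁻¹ * (Λ₁ y.1)⁻¹) with hG
  have hGm : Measurable G := ((q₁₂.comp t₁₂).mul (q₁₃.comp t₁₃)).mul (q.inv.mul (q₁.comp t₁).inv)
  have key : ∀ z : A × (E₁ × (E₂ × E₃)), ENNReal.ofReal (Real.exp (-(
      (logLikelihood (prodForm B₁ B₂) (f₁ z.1, f₂ z.1) ((f₁ z.1, f₂ z.1) + (z.2.1, z.2.2.1))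
        - logOutput (prodForm B₁ B₂) (π.map fun a => (f₁ a, f₂ a))
          ((f₁ z.1, f₂ z.1) + (z.2.1, z.2.2.1))
      + (logLikelihood (prodForm B₁ B₃) (f₁ z.1, f₃ z.1) ((f₁ z.1, f₃ z.1) + (z.2.1, z.2.2.2))
        - logOutput (prodForm B₁ B₃) (π.map fun a => (f₁ a, f₃ a))
          ((f₁ z.1, f₃ z.1) + (z.2.1, z.2.2.2))))
      - (logLikelihood (prodForm B₁ (prodForm B₂ B₃)) (f₁ z.1, f₂ z.1, f₃ z.1)
          ((f₁ z.1, f₂ z.1, f₃ z.1) + id z.2)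
        - logOutput (prodForm B₁ (prodForm B₂ B₃)) (π.map fun a => (f₁ a, f₂ a, f₃ a))
          ((f₁ z.1, f₂ z.1, f₃ z.1) + id z.2)
      + (logLikelihood B₁ (f₁ z.1) (f₁ z.1 + z.2.1)
        - logOutput B₁ (π.map f₁) (f₁ z.1 + z.2.1))))))
      = G ((f₁ z.1, f₂ z.1, f₃ z.1) + z.2) := fun z => by
    simp only [hG, hΛ₁, hΛ₁₂, hΛ₁₃, hΛ, ← h₁₂.ofReal_exp_logOutput, ← h₁₃.ofReal_exp_logOutput,
      ← h.ofReal_exp_neg_logOutput, ← h₁.ofReal_exp_neg_logOutput, ← ofReal_exp_add]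
    congr 2
    simp only [logLikelihood_prodForm, Prod.fst_add, Prod.snd_add, Prod.mk_add_mk, id]
    simp only [← Prod.mk_add_mk]
    ring
  refine le_of_eq ((lintegral_congr key).trans ?_)
  rw [h.lintegral_comp_add m hGm]
  -- The output law contributes the factor `Λ`, leaving `Λ₁₂ Λ₁₃ / Λ₁`. Integrating out the second
  -- and third observations gives `Λ₁ Λ₁ / Λ₁ = Λ₁`, of mass `1`.
  have k2 : ∀ y, Λ y * G y = Λ₁₂ (y.1, y.2.1) * Λ₁₃ (y.1, y.2.2) * (Λ₁ y.1)⁻¹ := fun y => by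
    have c1 : Λ y * (Λ y)⁻¹ = 1 :=
      ENNReal.mul_inv_cancel (h.outputDensity_ne_zero _ _) (h.outputDensity_ne_top _ _)
    calc Λ y * G y = (Λ y * (Λ y)⁻¹) * (Λ₁₂ (y.1, y.2.1) * Λ₁₃ (y.1, y.2.2) * (Λ₁ y.1)⁻¹) := by
          simp only [hG]; ring
      _ = _ := by rw [c1, one_mul]
  have q2 : Measurable fun y : E₁ × (E₂ × E₃) =>
      Λ₁₂ (y.1, y.2.1) * Λ₁₃ (y.1, y.2.2) * (Λ₁ y.1)⁻¹ :=
    ((q₁₂.comp t₁₂).mul (q₁₃.comp t₁₃)).mul (q₁.comp t₁).inv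
  refine (lintegral_congr k2).trans ?_
  rw [lintegral_prod _ q2.aemeasurable, ← h₁.lintegral_outputDensity (π.map f₁)]
  refine lintegral_congr fun y => ?_
  have r₁₂ : Measurable fun z => Λ₁₂ (y, z) := q₁₂.comp measurable_prodMk_left
  have r₁₃ : Measurable fun z => Λ₁₃ (y, z) := q₁₃.comp measurable_prodMk_left
  have r : Measurable fun z : E₂ × E₃ => Λ₁₂ (y, z.1) * Λ₁₃ (y, z.2) :=
    (r₁₂.comp measurable_fst).mul (r₁₃.comp measurable_snd)
  simp only
  rw [lintegral_mul_const _ r, lintegral_prod_mul r₁₂.aemeasurable r₁₃.aemeasurable,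
    h₁.lintegral_outputDensity_snd h₂ hf₁ hf₂, h₁.lintegral_outputDensity_snd h₃ hf₁ hf₃,
    mul_assoc, ENNReal.mul_inv_cancel (h₁.outputDensity_ne_zero _ _) (h₁.outputDensity_ne_top _ _),
    mul_one]

variable [AddCommGroup E] [MeasurableSpace E] {γ : Measure E} {B : E → E → ℝ}

/-- Chain rule: subtracting the known signal `s` from the observation absorbs the cross term `-B s
t` of the square. -/
lemma logLikelihood_add (h : IsGaussianNoise γ B) (s t y : E) :
    logLikelihood B (s + t) y = logLikelihood B s y + logLikelihood B t (y + -s) := by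
  simp only [logLikelihood, h.add_left, h.add_right, h.neg_right, h.symm t s]
  ring

/-- By the chain rule, the integrand is the joint density of the first signal and the observation of
the sum, the second signal being averaged out. -/
lemma lintegral_outputDensity_neg_add [MeasurableAdd₂ E] [MeasurableNeg E] (h : IsGaussianNoise γ B) (σ₁ σ₂ : Measure E)
    [IsProbabilityMeasure σ₁] [IsProbabilityMeasure σ₂] (y : E) :
    ∫⁻ s, ENNReal.ofReal (Real.exp (logLikelihood B s y)) * outputDensity B σ₂ (y + -s) ∂σ₁
      = outputDensity B ((σ₁.prod σ₂).map fun p => p.1 + p.2) y := by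
  rw [outputDensity_map h measurable_add, lintegral_prod]
  · refine lintegral_congr fun s => ?_
    have hm : Measurable fun t => ENNReal.ofReal (Real.exp (logLikelihood B t (y + -s))) :=
      h.measurable_likelihood.comp measurable_prodMk_right
    simp only [h.logLikelihood_add, ofReal_exp_add]
    rw [lintegral_const_mul _ hm]
    rfl
  · exact (h.measurable_likelihood.comp (measurable_add.prodMk measurable_const)).aemeasurable

/-- The information on a sum of independent signals is at most the sum of the informations on
each of them when the others are known. -/
lemma gaussianInfo_add_le [MeasurableAdd₂ E] [MeasurableNeg E] (h : IsGaussianNoise γ B) {σ₁ σ₂ : Measure E}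
    [IsProbabilityMeasure σ₁] [IsProbabilityMeasure σ₂]
    (hσ₁ : Integrable (fun c => B c c) σ₁) (hσ₂ : Integrable (fun c => B c c) σ₂) :
    gaussianInfo γ B ((σ₁.prod σ₂).map fun p => p.1 + p.2)
      ≤ gaussianInfo γ B σ₁ + gaussianInfo γ B σ₂ := by
  have := h.isProbabilityMeasure
  have e₁ : (σ₁.prod σ₂).map Prod.fst = σ₁ := by rw [Measure.map_fst_prod]; simp
  have e₂ : (σ₁.prod σ₂).map Prod.snd = σ₂ := by rw [Measure.map_snd_prod]; simp
  have madd : Measurable fun p : E × E => p.1 + p.2 := measurable_add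
  have p₁₂ : IsProbabilityMeasure ((σ₁.prod σ₂).map fun p => p.1 + p.2) :=
    Measure.isProbabilityMeasure_map madd.aemeasurable
  have i₁ := integrable_gaussianInfo h measurable_id Measure.map_id (π := σ₁.prod σ₂)
    measurable_fst (hσ₁.comp_fst σ₂)
  have i₂ := integrable_gaussianInfo h measurable_id Measure.map_id (π := σ₁.prod σ₂)
    measurable_snd (hσ₂.comp_snd σ₁)
  have hen : Integrable (fun p : E × E => B (p.1 + p.2) (p.1 + p.2)) (σ₁.prod σ₂) := by
    refine (((hσ₁.comp_fst σ₂).const_mul 2).add ((hσ₂.comp_snd σ₁).const_mul 2)).mono'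
      (h.measurable_diag.comp madd).aestronglyMeasurable (Eventually.of_forall fun p => ?_)
    rw [Real.norm_of_nonneg (h.nonneg _)]
    exact h.add_self_le _ _
  have i := integrable_gaussianInfo h measurable_id Measure.map_id (π := σ₁.prod σ₂) madd hen
  have k₁ := gaussianInfo_map h measurable_id Measure.map_id (π := σ₁.prod σ₂) measurable_fst
  have k₂ := gaussianInfo_map h measurable_id Measure.map_id (π := σ₁.prod σ₂) measurable_snd
  rw [e₁] at k₁ i₁
  rw [e₂] at k₂ i₂
  rw [k₁, k₂, gaussianInfo_map h measurable_id Measure.map_id madd]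
  refine integral_le_add_of_lintegral_exp_neg_le_one i₁ i₂ i ?_
  set σ := (σ₁.prod σ₂).map fun p => p.1 + p.2 with hσ
  set L : E → E → ℝ≥0∞ := fun s y => ENNReal.ofReal (Real.exp (logLikelihood B s y)) with hL
  set Λ := outputDensity B σ with hΛ
  have q : Measurable Λ := h.measurable_outputDensity _
  have q₁ := h.measurable_outputDensity σ₁
  have q₂ := h.measurable_outputDensity σ₂
  -- The defect is written in terms of the two signals and the observation `y` of their sum:
  -- removing one signal from `y` gives the interference-free observation of the other.
  set G : (E × E) × E → ℝ≥0∞ := fun p =>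
    ENNReal.ofReal (Real.exp (-(logLikelihood B p.1.1 (p.2 + -p.1.2)
      - logOutput B σ₁ (p.2 + -p.1.2) + (logLikelihood B p.1.2 (p.2 + -p.1.1)
      - logOutput B σ₂ (p.2 + -p.1.1)) - (logLikelihood B (p.1.1 + p.1.2) p.2
      - logOutput B σ p.2)))) with hG
  have n₁ : Measurable fun p : (E × E) × E => p.2 + -p.1.1 := by fun_prop
  have n₂ : Measurable fun p : (E × E) × E => p.2 + -p.1.2 := by fun_prop
  have hGm : Measurable G := by
    refine (Real.measurable_exp.comp (Measurable.neg ?_)).ennreal_ofReal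
    refine ((((h.measurable_logLikelihood.comp
      ((measurable_fst.comp measurable_fst).prodMk n₂))).sub
      ((h.measurable_logOutput σ₁).comp n₂)).add
      ((h.measurable_logLikelihood.comp
      ((measurable_snd.comp measurable_fst).prodMk n₁)).sub
      ((h.measurable_logOutput σ₂).comp n₁))).sub
      ((h.measurable_logLikelihood.comp
      ((madd.comp measurable_fst).prodMk measurable_snd)).sub
      ((h.measurable_logOutput σ).comp measurable_snd))
  have h1 := h.lintegral_prod_add madd (π := σ₁.prod σ₂) hGm
  -- The chain rule used in both orders separates the two signals. Each factor integrates to the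
  -- output density `Λ y` of the sum, so the total is `∫ Λ = 1`.
  have h2 : ∀ p : (E × E) × E, L (p.1.1 + p.1.2) p.2 * G p
      = (Λ p.2)⁻¹ * ((L p.1.1 p.2 * outputDensity B σ₂ (p.2 + -p.1.1))
        * (L p.1.2 p.2 * outputDensity B σ₁ (p.2 + -p.1.2))) := fun p => by
    simp only [hL, hG, hΛ, ← h.ofReal_exp_logOutput σ₁, ← h.ofReal_exp_logOutput σ₂,
      ← h.ofReal_exp_neg_logOutput σ, ← ofReal_exp_add]
    congr 2
    have a1 := h.logLikelihood_add p.1.1 p.1.2 p.2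
    have a2 := h.logLikelihood_add p.1.2 p.1.1 p.2
    rw [add_comm p.1.2 p.1.1] at a2
    linarith
  have h3 : ∀ p : (E × E) × E, ENNReal.ofReal (Real.exp (-(
      (logLikelihood B p.1.1 (p.1.1 + id p.2) - logOutput B σ₁ (p.1.1 + id p.2)
      + (logLikelihood B p.1.2 (p.1.2 + id p.2) - logOutput B σ₂ (p.1.2 + id p.2)))
      - (logLikelihood B (p.1.1 + p.1.2) (p.1.1 + p.1.2 + id p.2)
        - logOutput B σ (p.1.1 + p.1.2 + id p.2))))) = G (p.1, p.1.1 + p.1.2 + p.2) := fun p => by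
    have a1 : p.1.1 + p.1.2 + p.2 + -p.1.1 = p.1.2 + p.2 := by abel
    have a2 : p.1.1 + p.1.2 + p.2 + -p.1.2 = p.1.1 + p.2 := by abel
    simp only [hG, a1, a2, id]
  refine le_of_eq ((lintegral_congr h3).trans (h1.trans ((lintegral_congr h2).trans ?_)))
  have w₁ : Measurable fun p : E × E => L p.1 p.2 * outputDensity B σ₂ (p.2 + -p.1) :=
    h.measurable_likelihood.mul (q₂.comp (by fun_prop))
  have w₂ : Measurable fun p : E × E => L p.1 p.2 * outputDensity B σ₁ (p.2 + -p.1) :=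
    h.measurable_likelihood.mul (q₁.comp (by fun_prop))
  have w₁' : Measurable fun p : (E × E) × E =>
      L p.1.1 p.2 * outputDensity B σ₂ (p.2 + -p.1.1) :=
    w₁.comp ((measurable_fst.comp measurable_fst).prodMk measurable_snd)
  have w₂' : Measurable fun p : (E × E) × E =>
      L p.1.2 p.2 * outputDensity B σ₁ (p.2 + -p.1.2) :=
    w₂.comp ((measurable_snd.comp measurable_fst).prodMk measurable_snd)
  have w : Measurable fun p : (E × E) × E =>
      (Λ p.2)⁻¹ * ((L p.1.1 p.2 * outputDensity B σ₂ (p.2 + -p.1.1))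
        * (L p.1.2 p.2 * outputDensity B σ₁ (p.2 + -p.1.2))) :=
    (q.comp measurable_snd).inv.mul (w₁'.mul w₂')
  rw [lintegral_prod_symm _ w.aemeasurable, ← h.lintegral_outputDensity σ]
  refine lintegral_congr fun y => ?_
  have v₁ : Measurable fun s => L s y * outputDensity B σ₂ (y + -s) :=
    w₁.comp measurable_prodMk_right
  have v₂ : Measurable fun s => L s y * outputDensity B σ₁ (y + -s) :=
    w₂.comp measurable_prodMk_right
  have v : Measurable fun p : E × E => (L p.1 y * outputDensity B σ₂ (y + -p.1))
      * (L p.2 y * outputDensity B σ₁ (y + -p.2)) :=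
    (v₁.comp measurable_fst).mul (v₂.comp measurable_snd)
  have hcomm : (σ₂.prod σ₁).map (fun p => p.1 + p.2) = σ := by
    rw [hσ, ← Measure.prod_swap, Measure.map_map madd measurable_swap]
    congr 1
    ext p
    exact add_comm _ _
  simp only
  rw [lintegral_const_mul _ v, lintegral_prod_mul v₁.aemeasurable v₂.aemeasurable,
    h.lintegral_outputDensity_neg_add σ₁ σ₂, h.lintegral_outputDensity_neg_add σ₂ σ₁, hcomm,
    ← mul_assoc, ENNReal.inv_mul_cancel (h.outputDensity_ne_zero _ _) (h.outputDensity_ne_top _ _),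
    one_mul]

end IsGaussianNoise
end Channel

/-! ### Real and complex Gaussian laws. -/

/-- The Cameron-Martin form of the complex Gaussian law of variance `v`. -/
noncomputable def complexForm (v : ℝ≥0) (x y : ℂ) : ℝ := 2 * (x.re * y.re + x.im * y.im) / v

lemma isGaussianNoise_gaussianReal {v : ℝ≥0} (hv : 0 < v) :
    IsGaussianNoise (gaussianReal 0 v) fun x y => x * y / v := by
  refine ⟨inferInstance, by fun_prop, fun x y => by ring, fun x y z => by ring, fun x => ?_, ?_,
    fun c => ?_⟩
  · exact div_nonneg (mul_self_nonneg x) v.2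
  · have h := (memLp_id_gaussianReal (μ := 0) (v := v) 2).integrable_sq
    simp only [id] at h
    simpa only [← sq] using h.div_const (v : ℝ)
  · rw [gaussianReal_map_const_add, gaussianReal_of_var_ne_zero _ hv.ne',
      gaussianReal_of_var_ne_zero _ hv.ne',
      ← withDensity_mul _ (measurable_gaussianPDF _ _) (by fun_prop)]
    congr 1
    ext y
    rw [Pi.mul_apply, gaussianPDF, gaussianPDF, ← ENNReal.ofReal_mul (gaussianPDFReal_nonneg _ _ _)]
    congr 1
    simp only [gaussianPDFReal]
    rw [mul_assoc (√(2 * Real.pi * v))⁻¹, ← Real.exp_add]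
    congr 2
    have : (v : ℝ) ≠ 0 := by exact_mod_cast hv.ne'
    field_simp
    ring

/-- Transport of a Gaussian noise along an additive measurable bijection. -/
lemma IsGaussianNoise.map {E F : Type*} [AddCommGroup E] [MeasurableSpace E] [AddCommGroup F]
    [MeasurableSpace F] [MeasurableAdd₂ E] [MeasurableAdd₂ F] {γ : Measure E} {B : E → E → ℝ}
    (h : IsGaussianNoise γ B)
    {e : E → F} {s : F → E} (he : Measurable e) (hs : Measurable s)
    (hadd : ∀ x y, s (x + y) = s x + s y) (hse : ∀ x, s (e x) = x) (hes : ∀ y, e (s y) = y) :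
    IsGaussianNoise (γ.map e) fun x y => B (s x) (s y) := by
  have := h.isProbabilityMeasure
  have hm : Measurable fun p : F × F => B (s p.1) (s p.2) :=
    h.measurable.comp ((hs.comp measurable_fst).prodMk (hs.comp measurable_snd))
  refine ⟨Measure.isProbabilityMeasure_map he.aemeasurable, hm, fun x y => h.symm _ _,
    fun x y z => by rw [hadd, h.add_left], fun x => h.nonneg _, ?_, fun c => ?_⟩
  · have hd : Measurable fun w => B (s w) (s w) := h.measurable_diag.comp hs
    rw [integrable_map_measure hd.aestronglyMeasurable he.aemeasurable]
    simpa only [Function.comp_def, hse] using h.integrable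
  · have hL : Measurable fun y => ENNReal.ofReal (Real.exp (B (s c) (s y) - B (s c) (s c) / 2)) :=
      (h.measurable_likelihood.comp measurable_prodMk_left).comp hs
    refine Measure.ext_of_lintegral _ fun G hG => ?_
    rw [lintegral_map hG (measurable_const_add c), lintegral_map (by fun_prop) he,
      lintegral_withDensity_eq_lintegral_mul _ hL hG, lintegral_map (hL.mul hG) he]
    have h1 : ∀ w, c + e w = e (s c + w) := fun w => by
      rw [← hes (c + e w), hadd, hse]
    simp only [h1, Pi.mul_apply, hse]
    exact h.lintegral_add (s c) (hG.comp he)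

lemma isProbabilityMeasure_complexGaussian (v : ℝ≥0) :
    IsProbabilityMeasure (complexGaussian v) :=
  Measure.isProbabilityMeasure_map (by fun_prop)

instance (v : ℝ≥0) : IsProbabilityMeasure (complexGaussian v) :=
  isProbabilityMeasure_complexGaussian v

/-- Two independent real noises of variance `v / 2`, carried to `ℂ`; this variance accounts for the
factor `2` in `complexForm`. -/
lemma isGaussianNoise_complexGaussian {v : ℝ≥0} (hv : 0 < v) :
    IsGaussianNoise (complexGaussian v) (complexForm v) := by
  have h := isGaussianNoise_gaussianReal (half_pos hv)
  have h2 := (h.prod h).map (e := fun p : ℝ × ℝ => (p.1 : ℂ) + (p.2 : ℂ) * Complex.I)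
    (s := fun z : ℂ => (z.re, z.im)) (by fun_prop)
    (Complex.measurable_re.prodMk Complex.measurable_im) (fun x y => rfl)
    (fun x => by simp) (fun y => Complex.re_add_im y)
  have h3 : complexForm v = fun x y : ℂ => prodForm (fun x y : ℝ => x * y / ((v / 2 : ℝ≥0) : ℝ))
      (fun x y : ℝ => x * y / ((v / 2 : ℝ≥0) : ℝ)) (x.re, x.im) (y.re, y.im) := by
    ext x y
    simp only [complexForm, prodForm]
    push_cast
    field_simp
  rw [h3]
  exact h2

/-- Independent copies of a Gaussian noise form a Gaussian noise. -/
lemma IsGaussianNoise.pi {ι E : Type*} [Fintype ι] [AddCommGroup E] [MeasurableSpace E]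
    [MeasurableAdd₂ E] {γ : Measure E} {B : E → E → ℝ} (h : IsGaussianNoise γ B) :
    IsGaussianNoise (Measure.pi fun _ : ι => γ) fun x y => ∑ i, B (x i) (y i) := by
  have := h.isProbabilityMeasure
  refine ⟨inferInstance, ?_, fun x y => Finset.sum_congr rfl fun i _ => h.symm _ _,
    fun x y z => ?_, fun x => Finset.sum_nonneg fun i _ => h.nonneg _, ?_, fun c => ?_⟩
  · refine Finset.measurable_sum _ fun i _ => ?_
    have hi : Measurable fun p : (ι → E) × (ι → E) => (p.1 i, p.2 i) := by fun_prop
    exact h.measurable.comp hi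
  · simp only [Pi.add_apply, h.add_left, Finset.sum_add_distrib]
  · exact integrable_finsetSum _ fun i _ =>
      integrable_comp_eval (μ := fun _ : ι => γ) (i := i) h.integrable
  · have hD : ∀ i, Measurable fun y : E =>
        ENNReal.ofReal (Real.exp (B (c i) y - B (c i) (c i) / 2)) := fun i =>
      h.measurable_likelihood.comp measurable_prodMk_left
    have hfin : ∀ i, IsProbabilityMeasure (γ.withDensity fun y : E =>
        ENNReal.ofReal (Real.exp (B (c i) y - B (c i) (c i) / 2))) := fun i => by
      rw [← h.map_add]
      exact Measure.isProbabilityMeasure_map (measurable_const_add _).aemeasurable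
    have h1 : (Measure.pi fun _ : ι => γ).map (fun w => c + w)
        = Measure.pi fun i => γ.map fun w => c i + w :=
      have : ∀ i, SigmaFinite (γ.map fun w => c i + w) := fun i => by
        rw [h.map_add]
        infer_instance
      Measure.pi_map_pi (f := fun i w => c i + w) fun i => (measurable_const_add _).aemeasurable
    rw [h1]
    simp only [h.map_add]
    -- It suffices to compare on boxes, where the density times the indicator is a product of
    -- functions of one coordinate each.
    refine Measure.pi_eq fun s hs => ?_
    rw [withDensity_apply _ (MeasurableSet.univ_pi hs), ← lintegral_indicator (MeasurableSet.univ_pi hs)]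
    have h2 : ∀ w : ι → E, (Set.univ.pi s).indicator (fun y => ENNReal.ofReal (Real.exp
          (∑ i, B (c i) (y i) - (∑ i, B (c i) (c i)) / 2))) w
        = ∏ i, (s i).indicator (fun y =>
          ENNReal.ofReal (Real.exp (B (c i) y - B (c i) (c i) / 2))) (w i) := fun w => by
      by_cases hw : w ∈ Set.univ.pi s
      · rw [Set.indicator_of_mem hw, Finset.sum_div, ← Finset.sum_sub_distrib, Real.exp_sum,
          ENNReal.ofReal_prod_of_nonneg fun i _ => (Real.exp_pos _).le]
        refine Finset.prod_congr rfl fun i _ => ?_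
        rw [Set.indicator_of_mem (hw i (Set.mem_univ i))]
      · rw [Set.indicator_of_notMem hw]
        simp only [Set.mem_pi, Set.mem_univ, true_implies, not_forall] at hw
        obtain ⟨i, hi⟩ := hw
        exact (Finset.prod_eq_zero (Finset.mem_univ i) (Set.indicator_of_notMem hi _)).symm
    simp only [h2]
    rw [lintegral_prod_eq_prod_lintegral_of_indepFun Finset.univ
      (fun i (w : ι → E) => (s i).indicator (fun y =>
          ENNReal.ofReal (Real.exp (B (c i) y - B (c i) (c i) / 2))) (w i))
      (iIndepFun_pi fun i => ((hD i).indicator (hs i)).aemeasurable)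
      (fun i => ((hD i).indicator (hs i)).comp (measurable_pi_apply i))]
    refine Finset.prod_congr rfl fun i _ => ?_
    rw [withDensity_apply _ (hs i), ← lintegral_indicator (hs i)]
    exact (measurePreserving_eval (fun _ : ι => γ) i).lintegral_comp ((hD i).indicator (hs i))

/-- Only `‖t‖` enters, which is circular symmetry. Stability under multiplication, conjugation and
independent sums is read off from this formula. -/
lemma charFun_complexGaussian (v : ℝ≥0) (t : ℂ) :
    charFun (complexGaussian v) t = Complex.exp (-(v * ‖t‖ ^ 2 / 4 : ℝ)) := by
  rw [charFun_apply, complexGaussian, integral_map (by fun_prop) (by fun_prop)]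
  have h1 : ∀ p : ℝ × ℝ, Complex.exp (((inner ℝ ((p.1 : ℂ) + (p.2 : ℂ) * Complex.I) t : ℝ) : ℂ)
      * Complex.I) = Complex.exp (((inner ℝ p.1 t.re : ℝ) : ℂ) * Complex.I)
        * Complex.exp (((inner ℝ p.2 t.im : ℝ) : ℂ) * Complex.I) := fun p => by
    rw [← Complex.exp_add, ← add_mul, ← Complex.ofReal_add]
    congr 3
    simp [Complex.inner]
  simp only [h1]
  rw [integral_prod_mul (fun x : ℝ => Complex.exp (((inner ℝ x t.re : ℝ) : ℂ) * Complex.I))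
    (fun x : ℝ => Complex.exp (((inner ℝ x t.im : ℝ) : ℂ) * Complex.I)), ← charFun_apply,
    ← charFun_apply, charFun_gaussianReal, charFun_gaussianReal, ← Complex.exp_add]
  congr 1
  rw [Complex.sq_norm, Complex.normSq_apply]
  push_cast
  ring

lemma complexGaussian_map_mul (v : ℝ≥0) (a : ℂ) :
    (complexGaussian v).map (fun w => a * w) = complexGaussian (‖a‖₊ ^ 2 * v) := by
  have hm : Measurable fun w : ℂ => a * w := measurable_const_mul a
  have := Measure.isProbabilityMeasure_map (μ := complexGaussian v) hm.aemeasurable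
  refine Measure.ext_of_charFun ?_
  ext t
  rw [charFun_apply, integral_map hm.aemeasurable (by fun_prop)]
  have h1 : ∀ w : ℂ, (inner ℝ (a * w) t : ℝ) = inner ℝ w (starRingEnd ℂ a * t) := fun w => by
    simp only [Complex.inner, map_mul]
    ring_nf
  simp only [h1]
  rw [← charFun_apply, charFun_complexGaussian, charFun_complexGaussian]
  congr 3
  simp
  ring

lemma complexGaussian_map_conj (v : ℝ≥0) :
    (complexGaussian v).map (starRingEnd ℂ) = complexGaussian v := by
  have hm : Measurable (starRingEnd ℂ) := Complex.continuous_conj.measurable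
  have := Measure.isProbabilityMeasure_map (μ := complexGaussian v) hm.aemeasurable
  refine Measure.ext_of_charFun ?_
  ext t
  rw [charFun_apply, integral_map hm.aemeasurable (by fun_prop)]
  have h1 : ∀ w : ℂ, (inner ℝ (starRingEnd ℂ w) t : ℝ) = inner ℝ w (starRingEnd ℂ t) := fun w => by
    simp [Complex.inner]
  simp only [h1]
  rw [← charFun_apply, charFun_complexGaussian, charFun_complexGaussian]
  simp

/-- A linear combination of independent complex Gaussian variables. -/
lemma complexGaussian_map_sum {ι : Type*} [Fintype ι] (v : ℝ≥0) (a : ι → ℂ) :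
    (Measure.pi fun _ : ι => complexGaussian v).map (fun w => ∑ i, a i * w i)
      = complexGaussian ((∑ i, ‖a i‖₊ ^ 2) * v) := by
  have hm : Measurable fun w : ι → ℂ => ∑ i, a i * w i := by fun_prop
  have := Measure.isProbabilityMeasure_map (μ := Measure.pi fun _ : ι => complexGaussian v)
    hm.aemeasurable
  refine Measure.ext_of_charFun ?_
  ext t
  rw [charFun_apply, integral_map hm.aemeasurable (by fun_prop)]
  have h1 : ∀ w : ι → ℂ, Complex.exp (((inner ℝ (∑ i, a i * w i) t : ℝ) : ℂ) * Complex.I)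
      = ∏ i, Complex.exp (((inner ℝ (a i * w i) t : ℝ) : ℂ) * Complex.I) := fun w => by
    rw [sum_inner, Complex.ofReal_sum, Finset.sum_mul, Complex.exp_sum]
  simp only [h1]
  rw [integral_fintype_prod_eq_prod
    (fun i (w : ℂ) => Complex.exp (((inner ℝ (a i * w) t : ℝ) : ℂ) * Complex.I))]
  have h2 : ∀ i, ∫ w, Complex.exp (((inner ℝ (a i * w) t : ℝ) : ℂ) * Complex.I)
      ∂complexGaussian v = Complex.exp (-((‖a i‖₊ ^ 2 * v : ℝ≥0) * ‖t‖ ^ 2 / 4 : ℝ)) := fun i => by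
    rw [← charFun_complexGaussian, ← complexGaussian_map_mul, charFun_apply,
      integral_map (by fun_prop) (by fun_prop)]
  simp only [h2]
  rw [← Complex.exp_sum, charFun_complexGaussian]
  congr 1
  push_cast
  simp only [Finset.sum_mul, Finset.sum_div, Finset.sum_neg_distrib]

lemma isGaussian_complexGaussian (v : ℝ≥0) : IsGaussian (complexGaussian v) := by
  have : complexGaussian v = ((gaussianReal 0 (v / 2)).prod (gaussianReal 0 (v / 2))).map
      (Complex.equivRealProdCLM.symm : ℝ × ℝ →L[ℝ] ℂ) := by
    rw [complexGaussian]
    congr 1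
    ext p
    simp [Complex.equivRealProdCLM_symm_apply]
  rw [this]
  infer_instance

/-- The law is symmetric, so its mean is its own opposite. Rotation invariance of a pair of copies
requires the mean to vanish. -/
lemma integral_id_complexGaussian (v : ℝ≥0) : ∫ w, id w ∂complexGaussian v = 0 := by
  have h : (complexGaussian v).map (fun w => -1 * w) = complexGaussian v := by
    rw [complexGaussian_map_mul]; simp
  have h2 : ∫ w, id w ∂complexGaussian v = ∫ w, id (-1 * w) ∂complexGaussian v := by
    conv_lhs => rw [← h]
    exact integral_map (by fun_prop) (by fun_prop)
  simp only [id, neg_mul, one_mul] at h2 ⊢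
  rw [integral_neg] at h2
  exact CharZero.eq_neg_self_iff.mp h2

/-- A pair of independent complex Gaussian variables is invariant under plane rotations. -/
lemma complexGaussian_prod_map_rotation (v : ℝ≥0) (θ : ℝ) :
    ((complexGaussian v).prod (complexGaussian v)).map
      (fun p => ((Real.cos θ : ℂ) * p.1 + (Real.sin θ : ℂ) * p.2,
        -(Real.sin θ : ℂ) * p.1 + (Real.cos θ : ℂ) * p.2))
      = (complexGaussian v).prod (complexGaussian v) := by
  have := isGaussian_complexGaussian v
  conv_rhs => rw [← IsGaussian.map_rotation_eq_self (integral_id_complexGaussian v) θ]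
  congr 1
  ext p <;> simp [ContinuousLinearMap.rotation_apply]

/-! ### From decreasing increments to supporting lines. -/

section Concave

variable {f : ℝ → ℝ}

/-- Decreasing increments: `f (x + h + k) - f (x + k) ≤ f (x + h) - f x`. -/
def HasDecreasingIncrements (f : ℝ → ℝ) : Prop :=
  ∀ x h k : ℝ, 0 ≤ x → 0 < h → 0 < k → f (x + (h + k)) + f x ≤ f (x + h) + f (x + k)

/-- Increments over successive steps of length `h` form an antitone sequence, so the mean of the
first `k` is at least the mean of the first `n`. -/
lemma HasDecreasingIncrements.mul_le (hf : HasDecreasingIncrements f) {x h : ℝ} (hx : 0 ≤ x)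
    (hh : 0 < h) {k n : ℕ} (hkn : k ≤ n) :
    k * (f (x + n * h) - f x) ≤ n * (f (x + k * h) - f x) := by
  set D : ℕ → ℝ := fun m => f (x + (m + 1 : ℕ) * h) - f (x + m * h) with hD
  have hanti : Antitone D := antitone_nat_of_succ_le fun m => by
    have := hf (x + m * h) h h (by positivity) hh hh
    simp only [hD]
    push_cast
    rw [show x + (m + 1 + 1) * h = x + m * h + (h + h) by ring,
      show x + (m + 1) * h = x + m * h + h by ring]
    linarith
  have hsum : ∀ m : ℕ, f (x + m * h) - f x = ∑ j ∈ Finset.range m, D j := fun m => by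
    rw [Finset.sum_range_sub (fun m : ℕ => f (x + m * h))]
    simp
  have hk : ∀ n, k ≤ n → k * D n ≤ f (x + k * h) - f x := fun n hn => by
    rw [hsum]
    calc (k : ℝ) * D n = ∑ _j ∈ Finset.range k, D n := by simp
      _ ≤ _ := Finset.sum_le_sum fun j hj =>
        hanti ((Finset.mem_range.1 hj).le.trans hn)
  induction n, hkn using Nat.le_induction with
  | base => exact le_rfl
  | succ n hn ih =>
    have := hk n hn
    have h2 : f (x + (n + 1 : ℕ) * h) - f x = D n + (f (x + n * h) - f x) := by
      simp only [hD]; ring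
    rw [h2]
    push_cast
    linarith

/-- A drop from `x` to `y` would recur at each further step of length `y - x`, with at least the
same size, and make `f` negative after enough steps. -/
lemma HasDecreasingIncrements.monotoneOn (hf : HasDecreasingIncrements f)
    (h0 : ∀ x, 0 ≤ x → 0 ≤ f x) {x y : ℝ} (hx : 0 ≤ x) (hxy : x ≤ y) : f x ≤ f y := by
  rcases hxy.eq_or_lt with rfl | hlt
  · exact le_rfl
  by_contra! hcon
  obtain ⟨n, hn⟩ := exists_nat_gt (f x / (f x - f y))
  have hn1 : 1 ≤ n := by
    rcases Nat.eq_zero_or_pos n with rfl | h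
    · have : 0 ≤ f x / (f x - f y) := div_nonneg (h0 x hx) (by linarith)
      simp at hn
      linarith
    · exact h
  have h1 := hf.mul_le hx (sub_pos.2 hlt) hn1
  rw [div_lt_iff₀ (by linarith)] at hn
  have h2 := h0 (x + n * (y - x)) (by have := sub_pos.2 hlt; positivity)
  simp only [Nat.cast_one, one_mul, add_sub_cancel] at h1
  linarith

/-- Decreasing increments give the inequality at rational `t`; passing to real `t` requires some
regularity, supplied here by monotonicity. -/
lemma HasDecreasingIncrements.lineMap_le (hf : HasDecreasingIncrements f)
    (h0 : ∀ x, 0 ≤ x → 0 ≤ f x) {x y t : ℝ} (hx : 0 ≤ x) (hxy : x < y) (ht0 : 0 ≤ t)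
    (ht1 : t ≤ 1) : f x + t * (f y - f x) ≤ f (x + t * (y - x)) := by
  by_contra! hcon
  have hmono := hf.monotoneOn h0 hx hxy.le
  set d := f x + t * (f y - f x) - f (x + t * (y - x)) with hd
  have hdpos : 0 < d := sub_pos.2 hcon
  -- Replacing `t` by `⌊t n⌋ / n` from below costs at most `(f y - f x) / n`, which this `n` makes
  -- smaller than the supposed defect `d`.
  obtain ⟨n, hn⟩ := exists_nat_gt ((f y - f x) / d)
  have hnpos : 0 < (n : ℝ) := lt_of_le_of_lt (div_nonneg (by linarith) hdpos.le) hn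
  rw [div_lt_iff₀ hdpos] at hn
  set k := ⌊t * n⌋₊ with hk
  have hk1 : (k : ℝ) ≤ t * n := Nat.floor_le (by positivity)
  have hk2 : t * n < k + 1 := Nat.lt_floor_add_one _
  have hkn : k ≤ n := by
    have : (k : ℝ) ≤ n := hk1.trans (mul_le_of_le_one_left hnpos.le ht1)
    exact_mod_cast this
  have hyx : 0 < y - x := sub_pos.2 hxy
  have h1 := hf.mul_le hx (div_pos hyx hnpos) hkn
  rw [mul_div_cancel₀ _ hnpos.ne', add_sub_cancel] at h1
  have h2 : f (x + k * ((y - x) / n)) ≤ f (x + t * (y - x)) := by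
    refine hf.monotoneOn h0 (by positivity) ?_
    have : k * ((y - x) / n) ≤ t * (y - x) := by
      rw [mul_div_assoc', div_le_iff₀ hnpos]
      nlinarith
    linarith
  have h3 : (t * n - 1) * (f y - f x) ≤ k * (f y - f x) :=
    mul_le_mul_of_nonneg_right (by linarith) (by linarith)
  have h4 : n * (f (x + k * ((y - x) / n)) - f x) ≤ n * (f (x + t * (y - x)) - f x) :=
    mul_le_mul_of_nonneg_left (by linarith) hnpos.le
  have h5 : n * d = t * n * (f y - f x) - n * (f (x + t * (y - x)) - f x) := by
    rw [hd]; ring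
  linarith

/-- A nonnegative function with decreasing increments has supporting lines. -/
lemma HasDecreasingIncrements.exists_supporting_line (hf : HasDecreasingIncrements f)
    (h0 : ∀ x, 0 ≤ x → 0 ≤ f x) {c : ℝ} (hc : 0 < c) :
    ∃ s, ∀ r, 0 ≤ r → f r ≤ f c + s * (r - c) := by
  have key : ∀ x y, 0 ≤ x → x < c → c < y →
      (f y - f c) / (y - c) ≤ (f c - f x) / (c - x) := fun x y hx hxc hcy => by
    have hyx : 0 < y - x := by linarith
    have h1 := hf.lineMap_le h0 (t := (c - x) / (y - x)) hx (hxc.trans hcy)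
      (div_nonneg (by linarith) hyx.le) ((div_le_one hyx).2 (by linarith))
    rw [div_mul_cancel₀ _ hyx.ne', add_sub_cancel, div_mul_eq_mul_div, ← le_sub_iff_add_le',
      div_le_iff₀ hyx] at h1
    rw [div_le_div_iff₀ (by linarith) (by linarith)]
    linarith
  -- The slope is the supremum of the chord slopes to the right of `c`. The chord from `0` bounds
  -- them, which is where `c > 0` enters.
  set S : Set ℝ := (fun y => (f y - f c) / (y - c)) '' Set.Ioi c with hS
  have hne : S.Nonempty := Set.nonempty_Ioi.image _
  have hb : BddAbove S := ⟨(f c - f 0) / (c - 0), by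
    rintro _ ⟨y, hy, rfl⟩
    exact key 0 y le_rfl hc hy⟩
  refine ⟨sSup S, fun r hr => ?_⟩
  rcases lt_trichotomy r c with h | rfl | h
  · have h1 : sSup S ≤ (f c - f r) / (c - r) := csSup_le hne (by
      rintro _ ⟨y, hy, rfl⟩
      exact key r y hr h hy)
    rw [le_div_iff₀ (by linarith)] at h1
    linarith
  · simp
  · have h1 : (f r - f c) / (r - c) ≤ sSup S := le_csSup hb ⟨r, h, rfl⟩
    rw [div_le_iff₀ (by linarith)] at h1
    linarith

end Concave

/-! ### The scalar channel as a function of the signal-to-noise ratio. -/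

/-- The information, in nats, of the scalar complex Gaussian channel at signal-to-noise ratio `r`,
for inputs of law `ν`. -/
noncomputable def scalarInfo (ν : Measure ℂ) (r : ℝ) : ℝ :=
  gaussianInfo (complexGaussian 1) (complexForm 1) (ν.map fun u => (Real.sqrt r : ℂ) * u)

/-- The observation of the signal `f u` reduces, through the sufficient statistic `t`, to the scalar
channel at signal-to-noise ratio `r`. -/
structure IsScalarStatistic {E : Type*} [AddCommGroup E] [MeasurableSpace E] (γ : Measure E)
    (B : E → E → ℝ) (f : ℂ → E) (t : E → ℂ) (r : ℝ) : Prop where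
  measurable_signal : Measurable f
  measurable : Measurable t
  map_eq : γ.map t = complexGaussian 1
  add : ∀ x y, t (x + y) = t x + t y
  apply_signal : ∀ u, t (f u) = (Real.sqrt r : ℂ) * u
  form_eq : ∀ u y, B (f u) y = complexForm 1 ((Real.sqrt r : ℂ) * u) (t y)

lemma measurable_const_mul_complex (a : ℂ) : Measurable fun u : ℂ => a * u :=
  measurable_const_mul a

lemma IsScalarStatistic.gaussianInfo_eq {E : Type*} [AddCommGroup E] [MeasurableSpace E]
    [MeasurableAdd₂ E] {γ : Measure E} {B : E → E → ℝ} {f : ℂ → E} {t : E → ℂ} {r : ℝ}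
    (ht : IsScalarStatistic γ B f t r) (h : IsGaussianNoise γ B) (ν : Measure ℂ)
    [IsProbabilityMeasure ν] : gaussianInfo γ B (ν.map f) = scalarInfo ν r :=
  gaussianInfo_map_eq_of_sufficient h (isGaussianNoise_complexGaussian one_pos) ht.measurable
    ht.map_eq ht.add ht.measurable_signal (measurable_const_mul_complex _) ht.apply_signal ht.form_eq

lemma complexGaussian_prod_map_add (v w : ℝ≥0) :
    ((complexGaussian v).prod (complexGaussian w)).map (fun p => p.1 + p.2)
      = complexGaussian (v + w) := by
  have hm : Measurable fun p : ℂ × ℂ => p.1 + p.2 := measurable_add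
  have := Measure.isProbabilityMeasure_map (μ := (complexGaussian v).prod (complexGaussian w))
    hm.aemeasurable
  refine Measure.ext_of_charFun ?_
  ext t
  have h1 : charFun (complexGaussian v ∗ complexGaussian w) t
      = charFun (complexGaussian (v + w)) t := by
    rw [charFun_conv, charFun_complexGaussian, charFun_complexGaussian, charFun_complexGaussian,
      ← Complex.exp_add]
    congr 1
    push_cast
    ring
  exact h1

lemma isScalarStatistic_id (r : ℝ) :
    IsScalarStatistic (complexGaussian 1) (complexForm 1) (fun u => (Real.sqrt r : ℂ) * u)
      (fun y => y) r :=
  ⟨measurable_const_mul_complex _, measurable_id, Measure.map_id, fun _ _ => rfl, fun _ => rfl,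
    fun _ _ => rfl⟩

/-- Maximal ratio combining: the signal-to-noise ratios of independent observations add up. -/
lemma IsScalarStatistic.prod {E F : Type*} [AddCommGroup E] [MeasurableSpace E] [AddCommGroup F]
    [MeasurableSpace F] {γ : Measure E} {B : E → E → ℝ} {f : ℂ → E} {t : E → ℂ} {r : ℝ}
    {γ' : Measure F} {B' : F → F → ℝ} {f' : ℂ → F} {t' : F → ℂ} {r' : ℝ} [SFinite γ] [SFinite γ']
    (h : IsScalarStatistic γ B f t r) (h' : IsScalarStatistic γ' B' f' t' r') (hr : 0 ≤ r)
    (hr' : 0 < r') :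
    IsScalarStatistic (γ.prod γ') (prodForm B B') (fun u => (f u, f' u))
      (fun y => ((Real.sqrt r / Real.sqrt (r + r') : ℝ) : ℂ) * t y.1
        + ((Real.sqrt r' / Real.sqrt (r + r') : ℝ) : ℂ) * t' y.2) (r + r') := by
  have hs : 0 < r + r' := by linarith
  have hq : Real.sqrt (r + r') ≠ 0 := (Real.sqrt_pos.2 hs).ne'
  -- The squares of the two combining weights sum to `1`, so the combined noise keeps variance `1`,
  -- and the combined gain is `√(r + r')`.
  have hsq : Real.sqrt r * Real.sqrt r + Real.sqrt r' * Real.sqrt r'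
      = Real.sqrt (r + r') * Real.sqrt (r + r') := by
    rw [Real.mul_self_sqrt hr, Real.mul_self_sqrt hr'.le, Real.mul_self_sqrt hs.le]
  have hm := h.measurable
  have hm' := h'.measurable
  refine ⟨h.measurable_signal.prodMk h'.measurable_signal, by fun_prop, ?_, fun x y => ?_,
    fun u => ?_, fun u y => ?_⟩
  · set α : ℂ := ((Real.sqrt r / Real.sqrt (r + r') : ℝ) : ℂ) with hα
    set β : ℂ := ((Real.sqrt r' / Real.sqrt (r + r') : ℝ) : ℂ) with hβ
    have e1 : (fun y : E × F => α * t y.1 + β * t' y.2)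
        = (fun p : ℂ × ℂ => p.1 + p.2) ∘ Prod.map (fun z : ℂ => α * z) (fun z : ℂ => β * z)
          ∘ Prod.map t t' := rfl
    have ma := measurable_const_mul_complex α
    have mb := measurable_const_mul_complex β
    rw [e1, ← Measure.map_map measurable_add ((ma.prodMap mb).comp (hm.prodMap hm')),
      ← Measure.map_map (ma.prodMap mb) (hm.prodMap hm'), ← Measure.map_prod_map _ _ hm hm',
      h.map_eq, h'.map_eq, ← Measure.map_prod_map _ _ ma mb, complexGaussian_map_mul,
      complexGaussian_map_mul, complexGaussian_prod_map_add]
    congr 1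
    ext
    push_cast
    rw [hα, hβ, Complex.norm_real, Complex.norm_real, Real.norm_eq_abs, Real.norm_eq_abs, sq_abs,
      sq_abs]
    field_simp
    linarith
  · simp only [Prod.fst_add, Prod.snd_add, h.add, h'.add]
    ring
  · rw [h.apply_signal, h'.apply_signal]
    have : ((Real.sqrt r / Real.sqrt (r + r') : ℝ) : ℂ) * Real.sqrt r
        + ((Real.sqrt r' / Real.sqrt (r + r') : ℝ) : ℂ) * Real.sqrt r' = Real.sqrt (r + r') := by
      norm_cast
      field_simp
      linarith
    linear_combination u * this
  · simp only [prodForm, h.form_eq, h'.form_eq, complexForm]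
    simp
    field_simp
    ring

lemma complexForm_self (v : ℝ≥0) (z : ℂ) : complexForm v z z = 2 * ‖z‖ ^ 2 / v := by
  rw [complexForm, Complex.sq_norm, Complex.normSq_apply]

lemma integrable_complexForm (v : ℝ≥0) {A : Type*} [MeasurableSpace A] {π : Measure A} {f : A → ℂ}
    (hf : Integrable (fun u => ‖f u‖ ^ 2) π) :
    Integrable (fun u => complexForm v (f u) (f u)) π := by
  simp only [complexForm_self]
  exact (hf.const_mul 2).div_const _

lemma integrable_norm_const_mul_sq {ν : Measure ℂ} (hν : Integrable (fun u : ℂ => ‖u‖ ^ 2) ν)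
    (a : ℂ) : Integrable (fun u : ℂ => ‖a * u‖ ^ 2) ν := by
  simp only [norm_mul, mul_pow]
  exact hν.const_mul _

lemma scalarInfo_nonneg {ν : Measure ℂ} [IsProbabilityMeasure ν]
    (hν : Integrable (fun u : ℂ => ‖u‖ ^ 2) ν) (r : ℝ) : 0 ≤ scalarInfo ν r := by
  have hm := measurable_const_mul_complex (Real.sqrt r : ℂ)
  have h := isGaussianNoise_complexGaussian one_pos
  have := Measure.isProbabilityMeasure_map (μ := ν) hm.aemeasurable
  refine h.gaussianInfo_nonneg ?_
  rw [integrable_map_measure h.measurable_diag.aestronglyMeasurable hm.aemeasurable]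
  exact integrable_complexForm 1 (integrable_norm_const_mul_sq hν _)

/-- The information of the scalar channel is concave in the signal-to-noise ratio. -/
lemma hasDecreasingIncrements_scalarInfo {ν : Measure ℂ} [IsProbabilityMeasure ν]
    (hν : Integrable (fun u : ℂ => ‖u‖ ^ 2) ν) : HasDecreasingIncrements (scalarInfo ν) := by
  intro x h k hx hh hk
  have hN := isGaussianNoise_complexGaussian one_pos
  have s1 := isScalarStatistic_id x
  have s2 := isScalarStatistic_id h
  have s3 := isScalarStatistic_id k
  -- The same symbol is observed in three independent noises at ratios `x`, `h`, `k`. Maximal ratio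
  -- combining turns the four scalar informations into those of sets of observations, and the claim
  -- into submodularity.
  rw [← ((s1.prod (s2.prod s3 hh.le hk) hx (by linarith)).gaussianInfo_eq
    (hN.prod (hN.prod hN)) ν), ← s1.gaussianInfo_eq hN ν,
    ← (s1.prod s2 hx hh).gaussianInfo_eq (hN.prod hN) ν,
    ← (s1.prod s3 hx hk).gaussianInfo_eq (hN.prod hN) ν]
  exact hN.gaussianInfo_submodular hN hN (measurable_const_mul_complex _)
    (measurable_const_mul_complex _) (measurable_const_mul_complex _)
    (integrable_complexForm 1 (integrable_norm_const_mul_sq hν _))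
    (integrable_complexForm 1 (integrable_norm_const_mul_sq hν _))
    (integrable_complexForm 1 (integrable_norm_const_mul_sq hν _))

/-- A mutual information over an additive Gaussian noise is a channel information. -/
lemma mutualInfoBits_eq_gaussianInfo {A A' E : Type*} [MeasurableSpace A] [MeasurableSpace A']
    [AddCommGroup E] [MeasurableSpace E] [MeasurableAdd₂ E] {γ : Measure E} {B : E → E → ℝ}
    (h : IsGaussianNoise γ B) {π : Measure A} [IsProbabilityMeasure π] {X : A → A'}
    (hX : Measurable X) {f : A' → E} (hf : Measurable f)
    (hπ : Integrable (fun a => B (f (X a)) (f (X a))) π) :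
    mutualInfoBits (π.prod γ) (fun p => X p.1) (fun p => f (X p.1) + p.2)
      = ENNReal.ofReal (gaussianInfo γ B (π.map fun a => f (X a)))
        / ENNReal.ofReal (Real.log 2) := by
  have := h.isProbabilityMeasure
  have := Measure.isProbabilityMeasure_map (μ := π) hX.aemeasurable
  have hπ' : Integrable (fun a => B (f a) (f a)) (π.map X) := by
    have hd : Measurable fun a => B (f a) (f a) := h.measurable_diag.comp hf
    rw [integrable_map_measure hd.aestronglyMeasurable hX.aemeasurable]
    exact hπ
  have key := h.klDiv_joint hf hπ'
  have h1 : (π.map X).prod γ = (π.prod γ).map (Prod.map X id) := by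
    rw [← Measure.map_prod_map _ _ hX measurable_id, Measure.map_id]
  have hXi : Measurable (Prod.map X (id : E → E)) := hX.prodMap measurable_id
  have m1 : Measurable fun p : A' × E => f p.1 + p.2 := (hf.comp measurable_fst).add measurable_snd
  rw [h1, Measure.map_map (measurable_fst.prodMk m1) hXi, Measure.map_map measurable_fst hXi,
    Measure.map_map m1 hXi, Measure.map_map hf hX] at key
  rw [mutualInfoBits]
  congr 1

lemma scalarRate_eq {ν : Measure ℂ} [IsProbabilityMeasure ν]
    (hν : Integrable (fun u : ℂ => ‖u‖ ^ 2) ν) (ρ : ℝ≥0) :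
    scalarRate ν ρ = ENNReal.ofReal (scalarInfo ν ρ) / ENNReal.ofReal (Real.log 2) :=
  mutualInfoBits_eq_gaussianInfo (isGaussianNoise_complexGaussian one_pos) measurable_id
    (f := fun u => (Real.sqrt ρ : ℂ) * u) (measurable_const_mul_complex _)
    (integrable_complexForm 1 (integrable_norm_const_mul_sq hν _))

/-! ### The upper half of the ergodic theorem for bounded functions. -/

section Ergodic

variable {α : Type*} [MeasurableSpace α]

/-- The running maximum of the Birkhoff sums of `g`, starting from `0`. -/
def maxBirkhoffSum (T : α → α) (g : α → ℝ) : ℕ → α → ℝ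
  | 0, _ => 0
  | n + 1, x => max 0 (g x + maxBirkhoffSum T g n (T x))

variable {T : α → α} {g : α → ℝ}

omit [MeasurableSpace α] in
lemma maxBirkhoffSum_nonneg (n : ℕ) (x : α) : 0 ≤ maxBirkhoffSum T g n x := by
  cases n
  · exact le_rfl
  · exact le_max_left _ _

omit [MeasurableSpace α] in
lemma maxBirkhoffSum_le_succ (n : ℕ) (x : α) :
    maxBirkhoffSum T g n x ≤ maxBirkhoffSum T g (n + 1) x := by
  induction n generalizing x with
  | zero => exact le_max_left _ _
  | succ n ih => exact max_le_max le_rfl (by linarith [ih (T x)])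

omit [MeasurableSpace α] in
lemma birkhoffSum_le_maxBirkhoffSum (n : ℕ) (x : α) :
    birkhoffSum T g n x ≤ maxBirkhoffSum T g n x := by
  induction n generalizing x with
  | zero => simp [maxBirkhoffSum]
  | succ n ih =>
    rw [birkhoffSum_succ']
    exact (by linarith [ih (T x)] : _ ≤ g x + maxBirkhoffSum T g n (T x)).trans (le_max_right _ _)

omit [MeasurableSpace α] in
lemma maxBirkhoffSum_le {C : ℝ} (hC : ∀ x, |g x| ≤ C) (n : ℕ) (x : α) :
    maxBirkhoffSum T g n x ≤ n * C := by
  have hC0 : 0 ≤ C := (abs_nonneg _).trans (hC x)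
  induction n generalizing x with
  | zero => simp [maxBirkhoffSum]
  | succ n ih =>
    refine max_le (by positivity) ?_
    push_cast
    linarith [ih (T x), (abs_le.1 (hC x)).2]

lemma measurable_maxBirkhoffSum (hT : Measurable T) (hg : Measurable g) (n : ℕ) :
    Measurable (maxBirkhoffSum T g n) := by
  induction n with
  | zero => exact measurable_const
  | succ n ih => exact measurable_const.max (hg.add (ih.comp hT))

/-- The maximal ergodic theorem for an ergodic map: the Birkhoff sums of a bounded function of
negative mean are almost surely bounded above. -/
lemma ae_bddAbove_birkhoffSum {μ : Measure α} [IsProbabilityMeasure μ] (h : Ergodic T μ)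
    (hg : Measurable g) {C : ℝ} (hC : ∀ x, |g x| ≤ C) (hneg : ∫ x, g x ∂μ < 0) :
    ∀ᵐ x ∂μ, ∃ K : ℝ, ∀ n, birkhoffSum T g n x ≤ K := by
  set M := maxBirkhoffSum T g with hM
  have hT := h.measurable
  have hmono : ∀ x, Monotone fun n => M n x := fun x =>
    monotone_nat_of_le_succ fun n => maxBirkhoffSum_le_succ n x
  have hMm : ∀ n, Measurable (M n) := measurable_maxBirkhoffSum hT hg
  have hMi : ∀ n, Integrable (M n) μ := fun n =>
    Integrable.of_bound (hMm n).aestronglyMeasurable (n * C) (Eventually.of_forall fun x => by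
      rw [Real.norm_of_nonneg (maxBirkhoffSum_nonneg n x)]
      exact maxBirkhoffSum_le hC n x)
  have hgi : Integrable g μ :=
    Integrable.of_bound hg.aestronglyMeasurable C (Eventually.of_forall hC)
  -- The points with unbounded maxima. This set is invariant because passing from `x` to `T x`
  -- changes the maxima by a bounded amount, apart from the truncation at `0`; ergodicity leaves
  -- null or full measure.
  set A : Set α := {x | ∀ K : ℕ, ∃ n, (K : ℝ) < M n x} with hA
  have hAm : MeasurableSet A := by
    have : A = ⋂ K : ℕ, ⋃ n, {x | (K : ℝ) < M n x} := by
      ext x; simp [hA]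
    rw [this]
    exact MeasurableSet.iInter fun K => MeasurableSet.iUnion fun n =>
      measurableSet_lt measurable_const (hMm n)
  have hinv : T ⁻¹' A = A := by
    ext x
    simp only [Set.mem_preimage, hA, Set.mem_ofPred_eq]
    constructor
    · intro hx K
      obtain ⟨K', hK'⟩ := exists_nat_ge (K + C)
      obtain ⟨n, hn⟩ := hx K'
      refine ⟨n + 1, lt_of_lt_of_le ?_ (le_max_right _ _)⟩
      have := (abs_le.1 (hC x)).1
      simp only [hM] at hn
      linarith
    · intro hx K
      obtain ⟨K', hK'⟩ := exists_nat_ge (K + C)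
      obtain ⟨n, hn⟩ := hx K'
      have hC0 : 0 ≤ C := (abs_nonneg _).trans (hC x)
      have hKpos : (0 : ℝ) ≤ K := Nat.cast_nonneg K
      cases n with
      | zero =>
        simp only [hM, maxBirkhoffSum] at hn
        linarith
      | succ n =>
        refine ⟨n, ?_⟩
        have := (abs_le.1 (hC x)).2
        rcases lt_max_iff.1 hn with h1 | h1
        · linarith
        · simp only [hM]
          linarith
  rcases h.toPreErgodic.prob_eq_zero_or_one hAm hinv with h0 | h1
  · have : ∀ᵐ x ∂μ, x ∉ A := measure_eq_zero_iff_ae_notMem.1 h0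
    filter_upwards [this] with x hx
    simp only [hA, Set.mem_ofPred_eq, not_forall, not_exists, not_lt] at hx
    obtain ⟨K, hK⟩ := hx
    exact ⟨K, fun n => (birkhoffSum_le_maxBirkhoffSum n x).trans (hK n)⟩
  · exfalso
    have hae : ∀ᵐ x ∂μ, x ∈ A := (prob_compl_eq_zero_iff hAm).2 h1
    have hTae : ∀ᵐ x ∂μ, T x ∈ A := by
      filter_upwards [hae] with x hx
      rw [← hinv] at hx
      exact hx
    -- If `A` had full measure, the truncation would become inactive once `M n (T x) ≥ C`, and the
    -- difference would then equal `g x`.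
    have hlim : Tendsto (fun n => ∫ x, (M (n + 1) x - M n (T x)) ∂μ) atTop
        (nhds (∫ x, g x ∂μ)) := by
      refine tendsto_integral_of_dominated_convergence (fun _ => C)
        (fun n => ((hMm (n + 1)).sub ((hMm n).comp hT)).aestronglyMeasurable)
        (integrable_const C) (fun n => Eventually.of_forall fun x => ?_) ?_
      · have h1 := maxBirkhoffSum_nonneg (T := T) (g := g) n (T x)
        have h2 := abs_le.1 (hC x)
        have hC0 : 0 ≤ C := (abs_nonneg _).trans (hC x)
        rw [Real.norm_eq_abs, abs_le]
        simp only [hM, maxBirkhoffSum]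
        constructor
        · have := le_max_right 0 (g x + maxBirkhoffSum T g n (T x))
          linarith
        · have : max 0 (g x + maxBirkhoffSum T g n (T x))
              ≤ C + maxBirkhoffSum T g n (T x) := max_le (by linarith) (by linarith)
          linarith
      · filter_upwards [hTae] with x hx
        refine tendsto_const_nhds.congr' ?_
        obtain ⟨K, hK⟩ := exists_nat_ge C
        obtain ⟨n, hn⟩ := hx K
        filter_upwards [eventually_ge_atTop n] with m hm
        have h1 : M n (T x) ≤ M m (T x) := hmono (T x) hm
        have h2 := (abs_le.1 (hC x)).1
        have h3 : M (m + 1) x = max 0 (g x + M m (T x)) := rfl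
        rw [h3, max_eq_right (by linarith)]
        ring
    -- `T` preserves `μ` and the maxima increase with `n`; the limit `∫ g` could then not be
    -- negative.
    have hpos : ∀ n, 0 ≤ ∫ x, (M (n + 1) x - M n (T x)) ∂μ := fun n => by
      have hc : Integrable (fun x => M n (T x)) μ :=
        h.toMeasurePreserving.integrable_comp_of_integrable (hMi n)
      have he : ∫ x, M n (T x) ∂μ = ∫ x, M n x ∂μ := by
        rw [← integral_map hT.aemeasurable (by
          rw [h.toMeasurePreserving.map_eq]; exact (hMm n).aestronglyMeasurable),
          h.toMeasurePreserving.map_eq]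
      rw [integral_sub (hMi (n + 1)) hc, he, sub_nonneg]
      exact integral_mono (hMi n) (hMi (n + 1)) fun x => maxBirkhoffSum_le_succ n x
    exact absurd (ge_of_tendsto' hlim hpos) (not_le.2 hneg)

/-- The upper bound of Birkhoff's ergodic theorem, for a bounded function. -/
lemma ae_birkhoffSum_le {μ : Measure α} [IsProbabilityMeasure μ] (h : Ergodic T μ)
    (hg : Measurable g) {C : ℝ} (hC : ∀ x, |g x| ≤ C) (hg0 : ∫ x, g x ∂μ ≤ 0) {ε : ℝ}
    (hε : 0 < ε) : ∀ᵐ x ∂μ, ∃ K : ℝ, ∀ n : ℕ, birkhoffSum T g n x ≤ K + n * ε := by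
  have hgi : Integrable g μ :=
    Integrable.of_bound hg.aestronglyMeasurable C (Eventually.of_forall hC)
  -- Subtracting `ε` makes the mean strictly negative.
  have h1 := ae_bddAbove_birkhoffSum h (g := fun x => g x - ε) (hg.sub_const ε) (C := C + ε)
    (fun x => (abs_sub _ _).trans (by rw [abs_of_pos hε]; linarith [hC x])) (by
      rw [integral_sub hgi (integrable_const _)]
      simp
      linarith)
  filter_upwards [h1] with x ⟨K, hK⟩
  refine ⟨K, fun n => ?_⟩
  have := hK n
  simp only [birkhoffSum, Finset.sum_sub_distrib, Finset.sum_const, Finset.card_range,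
    nsmul_eq_mul] at this ⊢
  linarith

end Ergodic

/-! ### The energy of sampled cardinal sines. -/

/-- Sampled cardinal sines are the Fourier coefficients of a function of modulus `1` on an interval
of length `1`, so Parseval controls the sum of their squares. -/
lemma fourierCoeffOn_exp_eq_sinc (a : ℝ) (n : ℤ) :
    fourierCoeffOn (show (-(1 / 2) : ℝ) < 1 / 2 by norm_num)
      (fun x : ℝ => Complex.exp ((2 * Real.pi * a * x : ℝ) * Complex.I)) n
      = (Real.sinc (Real.pi * (n - a)) : ℂ) := by
  rw [fourierCoeffOn_eq_integral]
  have h1 : ∀ x : ℝ, fourier (-n) (x : AddCircle ((1 / 2 : ℝ) - -(1 / 2)))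
      • Complex.exp ((2 * Real.pi * a * x : ℝ) * Complex.I)
      = Complex.exp ((2 * Real.pi * (a - n) : ℝ) * Complex.I * x) := fun x => by
    rw [fourier_coe_apply, smul_eq_mul, ← Complex.exp_add]
    congr 1
    push_cast
    ring
  simp only [h1]
  rcases eq_or_ne ((n : ℝ) - a) 0 with h0 | h0
  · have : a - n = 0 := by linarith
    simp [h0, this]
    norm_num
  · have hc : ((2 * Real.pi * (a - n) : ℝ) : ℂ) * Complex.I ≠ 0 := by
      refine mul_ne_zero ?_ Complex.I_ne_zero
      have : a - n ≠ 0 := fun h => h0 (by linarith)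
      exact_mod_cast mul_ne_zero (by positivity) this
    have hπ : Real.pi * (n - a) ≠ 0 := mul_ne_zero Real.pi_ne_zero h0
    rw [integral_exp_mul_complex hc, Real.sinc_of_ne_zero hπ]
    have e1 : ((2 * Real.pi * (a - n) : ℝ) : ℂ) * Complex.I * ((1 / 2 : ℝ) : ℂ)
        = ((-(Real.pi * (n - a)) : ℝ) : ℂ) * Complex.I := by push_cast; ring
    have e2 : ((2 * Real.pi * (a - n) : ℝ) : ℂ) * Complex.I * ((-(1 / 2) : ℝ) : ℂ)
        = ((Real.pi * (n - a) : ℝ) : ℂ) * Complex.I := by push_cast; ring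
    have e3 : ((2 * Real.pi * (a - n) : ℝ) : ℂ) = -(2 * ((Real.pi * (n - a) : ℝ) : ℂ)) := by
      push_cast; ring
    rw [e1, e2, e3]
    set θ := Real.pi * (n - a) with hθ
    have hθ' : (θ : ℂ) ≠ 0 := by exact_mod_cast hπ
    rw [Complex.exp_mul_I, Complex.exp_mul_I]
    push_cast
    rw [Complex.cos_neg, Complex.sin_neg]
    norm_num
    field_simp [Complex.I_ne_zero]
    ring

/-- Bessel's inequality for the shifted cardinal sines. -/
lemma sum_sinc_sq_le_one (a : ℝ) (s : Finset ℤ) :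
    ∑ m ∈ s, Real.sinc (Real.pi * (m - a)) ^ 2 ≤ 1 := by
  have hL : MemLp (fun x : ℝ => Complex.exp ((2 * Real.pi * a * x : ℝ) * Complex.I)) 2
      (volume.restrict (Set.Ioc (-(1 / 2)) (1 / 2))) :=
    MemLp.of_bound (by fun_prop) 1 (Eventually.of_forall fun x => by
      rw [Complex.norm_exp_ofReal_mul_I])
  have h := hasSum_sq_fourierCoeffOn (show (-(1 / 2) : ℝ) < 1 / 2 by norm_num) hL
  simp only [fourierCoeffOn_exp_eq_sinc, Complex.norm_exp_ofReal_mul_I, Complex.norm_real,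
    Real.norm_eq_abs, sq_abs] at h
  have h2 := sum_le_hasSum s (fun _ _ => sq_nonneg _) h
  norm_num at h2
  exact h2

/-! ### Matched filtering of a block. -/

/-- The Cameron-Martin form of a block of independent complex Gaussian noises of variance `v`. -/
noncomputable def blockForm {ι : Type*} [Fintype ι] (v : ℝ≥0) (x y : ι → ℂ) : ℝ :=
  ∑ i, complexForm v (x i) (y i)

lemma isGaussianNoise_pi_complexGaussian (ι : Type*) [Fintype ι] {v : ℝ≥0} (hv : 0 < v) :
    IsGaussianNoise (Measure.pi fun _ : ι => complexGaussian v) (blockForm v) :=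
  (isGaussianNoise_complexGaussian hv).pi

/-- Matched filtering: a symbol spread over a block is seen at the signal-to-noise ratio given by
the energy of its signature. -/
lemma gaussianInfo_signature {ι : Type*} [Fintype ι] {v : ℝ≥0} (hv : 0 < v) (ν : Measure ℂ)
    [IsProbabilityMeasure ν] (a : ι → ℂ) :
    gaussianInfo (Measure.pi fun _ : ι => complexGaussian v) (blockForm v)
      (ν.map fun u i => a i * u) = scalarInfo ν ((∑ i, ‖a i‖ ^ 2) / v) := by
  have hN := isGaussianNoise_pi_complexGaussian ι hv
  have hv' : (0 : ℝ) < v := hv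
  set q : ℝ := ∑ i, ‖a i‖ ^ 2 with hq
  have hq0 : 0 ≤ q := Finset.sum_nonneg fun i _ => sq_nonneg _
  -- A zero signature is set apart since the matched filter divides by `√(q v)`.
  rcases hq0.eq_or_lt with h0 | hpos
  · have ha : ∀ i, a i = 0 := fun i => by
      have := (Finset.sum_eq_zero_iff_of_nonneg fun i _ => sq_nonneg ‖a i‖).1 h0.symm i
        (Finset.mem_univ i)
      simpa using this
    have e1 : (fun (u : ℂ) (i : ι) => a i * u) = fun _ => 0 := by
      ext u i; simp [ha]
    have e2 : (fun u : ℂ => (Real.sqrt (q / v) : ℂ) * u) = fun _ => 0 := by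
      ext u; simp [← h0]
    rw [scalarInfo, e1, e2, gaussianInfo_dirac_zero hN,
      gaussianInfo_dirac_zero (isGaussianNoise_complexGaussian one_pos)]
  · have hs : Real.sqrt (q * v) ≠ 0 := (Real.sqrt_pos.2 (mul_pos hpos hv')).ne'
    have hsq : Real.sqrt (q * v) ^ 2 = q * v := Real.sq_sqrt (mul_pos hpos hv').le
    have hr : Real.sqrt (q / v) = q / Real.sqrt (q * v) := by
      rw [Real.sqrt_div hq0, Real.sqrt_mul hq0]
      have h1 := Real.mul_self_sqrt hq0
      have : Real.sqrt q ≠ 0 := (Real.sqrt_pos.2 hpos).ne'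
      field_simp
      linarith
    -- The correlation with the signature, divided by `√(q v)` so that the filtered noise has
    -- variance `1`.
    refine IsScalarStatistic.gaussianInfo_eq (t := fun y => ∑ i,
      (starRingEnd ℂ (a i) / (Real.sqrt (q * v) : ℂ)) * y i) ⟨by fun_prop, by fun_prop, ?_, ?_, ?_, ?_⟩
      hN ν
    · rw [complexGaussian_map_sum]
      congr 1
      ext
      push_cast
      simp only [norm_div, RCLike.norm_conj, Complex.norm_real, Real.norm_eq_abs, div_pow, sq_abs]
      rw [← Finset.sum_div, ← hq, hsq]
      field_simp
    · intro x y
      simp only [Pi.add_apply, mul_add, Finset.sum_add_distrib]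
    · intro u
      have h1 : ∀ i, (starRingEnd ℂ (a i) / (Real.sqrt (q * v) : ℂ)) * (a i * u)
          = ((‖a i‖ ^ 2 : ℝ) : ℂ) * (u / (Real.sqrt (q * v) : ℂ)) := fun i => by
        rw [Complex.sq_norm, Complex.normSq_eq_conj_mul_self]
        ring
      simp only [h1]
      rw [← Finset.sum_mul, ← Complex.ofReal_sum, ← hq, hr]
      push_cast
      ring
    · intro u y
      have h1 : ∀ i, complexForm v (a i * u) (y i) = q / (q * v)
          * (2 * (starRingEnd ℂ u * (starRingEnd ℂ (a i) * y i)).re) := fun i => by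
        rw [complexForm]
        simp only [Complex.mul_re, Complex.mul_im, Complex.conj_re, Complex.conj_im]
        field_simp
        ring
      have h2 : complexForm 1 ((Real.sqrt (q / v) : ℂ) * u)
          (∑ i, (starRingEnd ℂ (a i) / (Real.sqrt (q * v) : ℂ)) * y i)
          = q / (q * v) * (2 * (starRingEnd ℂ u * ∑ i, starRingEnd ℂ (a i) * y i).re) := by
        have h3 : ∑ i, (starRingEnd ℂ (a i) / (Real.sqrt (q * v) : ℂ)) * y i
            = ((1 / Real.sqrt (q * v) : ℝ) : ℂ) * ∑ i, starRingEnd ℂ (a i) * y i := by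
          rw [Finset.mul_sum]
          refine Finset.sum_congr rfl fun i _ => ?_
          push_cast
          ring
        have h4 : q / (q * v) = q / Real.sqrt (q * v) * (1 / Real.sqrt (q * v)) := by
          rw [div_mul_div_comm, ← sq, hsq, mul_one]
        rw [h3, hr, complexForm, h4]
        simp only [Complex.re_ofReal_mul, Complex.im_ofReal_mul]
        rw [Complex.mul_re, Complex.conj_re, Complex.conj_im, NNReal.coe_one]
        ring
      rw [blockForm, h2, Finset.mul_sum, Complex.re_sum, Finset.mul_sum, Finset.mul_sum]
      exact Finset.sum_congr rfl fun i _ => h1 i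

lemma integrable_blockForm_map {ι A : Type*} [Fintype ι] [MeasurableSpace A] {v : ℝ≥0}
    {π : Measure A} {f : A → ι → ℂ} (hf : ∀ i, Integrable (fun u => ‖f u i‖ ^ 2) π) :
    Integrable (fun u => blockForm v (f u) (f u)) π :=
  integrable_finsetSum _ fun i _ => integrable_complexForm v (hf i)

lemma integrable_norm_sum_mul_sq {ι : Type*} [Fintype ι] {ν : Measure ℂ} [IsProbabilityMeasure ν]
    (hν : Integrable (fun u : ℂ => ‖u‖ ^ 2) ν) (a : ι → ℂ) :
    Integrable (fun u : ι → ℂ => ‖∑ i, a i * u i‖ ^ 2) (Measure.pi fun _ : ι => ν) := by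
  have h1 : MemLp (fun u : ι → ℂ => ∑ i, a i * u i) 2 (Measure.pi fun _ : ι => ν) := by
    refine memLp_finsetSum _ fun i _ => MemLp.const_mul ?_ (a i)
    rw [memLp_two_iff_integrable_sq_norm (measurable_pi_apply i).aestronglyMeasurable]
    exact integrable_comp_eval (μ := fun _ : ι => ν) (i := i) hν
  exact (memLp_two_iff_integrable_sq_norm h1.1).1 h1

/-- The matched-filter bound: the information on a block of independent symbols is at most the
sum of the informations on the symbols, each observed without interference. -/
lemma gaussianInfo_le_sum_scalarInfo {ι : Type*} [Fintype ι] {v : ℝ≥0} (hv : 0 < v)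
    {ν : Measure ℂ} [IsProbabilityMeasure ν] (hν : Integrable (fun u : ℂ => ‖u‖ ^ 2) ν) (m : ℕ)
    (a : Fin m → ι → ℂ) :
    gaussianInfo (Measure.pi fun _ : ι => complexGaussian v) (blockForm v)
      ((Measure.pi fun _ : Fin m => ν).map fun u k => ∑ i, a i k * u i)
      ≤ ∑ i, scalarInfo ν ((∑ k, ‖a i k‖ ^ 2) / v) := by
  have hN := isGaussianNoise_pi_complexGaussian ι hv
  induction m with
  | zero =>
    simp only [Finset.univ_eq_empty, Finset.sum_empty]
    exact (gaussianInfo_dirac_zero hN _).le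
  | succ m ih =>
    set F : ℂ → ι → ℂ := fun u k => a 0 k * u with hF
    set G : (Fin m → ℂ) → ι → ℂ := fun u k => ∑ i : Fin m, a i.succ k * u i with hG
    have hFm : Measurable F := by fun_prop
    have hGm : Measurable G := by fun_prop
    have hmp := measurePreserving_piFinSuccAbove (fun _ : Fin (m + 1) => ν) 0
    -- The first symbol is peeled off: the signal is the sum of its contribution and of an
    -- independent remainder, to which subadditivity applies.
    have e1 : (fun (u : Fin (m + 1) → ℂ) (k : ι) => ∑ i, a i k * u i)
        = (fun p : (ι → ℂ) × (ι → ℂ) => p.1 + p.2) ∘ Prod.map F G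
          ∘ MeasurableEquiv.piFinSuccAbove (fun _ : Fin (m + 1) => ℂ) 0 := by
      ext u k
      simp only [Fin.sum_univ_succ, Function.comp, hF, hG, Prod.map, Pi.add_apply]
      rfl
    have e2 : (Measure.pi fun _ : Fin (m + 1) => ν).map
        (fun (u : Fin (m + 1) → ℂ) (k : ι) => ∑ i, a i k * u i)
        = ((ν.map F).prod ((Measure.pi fun _ : Fin m => ν).map G)).map fun p => p.1 + p.2 := by
      rw [e1, ← Measure.map_map measurable_add ((hFm.prodMap hGm).comp hmp.measurable),
        ← Measure.map_map (hFm.prodMap hGm) hmp.measurable, hmp.map_eq,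
        Measure.map_prod_map _ _ hFm hGm]
    have p1 := Measure.isProbabilityMeasure_map (μ := ν) hFm.aemeasurable
    have p2 := Measure.isProbabilityMeasure_map (μ := Measure.pi fun _ : Fin m => ν)
      hGm.aemeasurable
    have i1 : Integrable (fun c => blockForm v c c) (ν.map F) := by
      rw [integrable_map_measure hN.measurable_diag.aestronglyMeasurable hFm.aemeasurable]
      exact integrable_blockForm_map fun k => integrable_norm_const_mul_sq hν _
    have i2 : Integrable (fun c => blockForm v c c) ((Measure.pi fun _ : Fin m => ν).map G) := by
      rw [integrable_map_measure hN.measurable_diag.aestronglyMeasurable hGm.aemeasurable]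
      exact integrable_blockForm_map fun k => integrable_norm_sum_mul_sq hν _
    rw [e2, Fin.sum_univ_succ]
    refine (hN.gaussianInfo_add_le i1 i2).trans (add_le_add ?_ (ih fun i => a i.succ))
    exact (gaussianInfo_signature hv ν (a 0)).le

/-! ### The impulse response and the energy of its columns. -/

lemma sinc_pi_mul_int {m : ℤ} (hm : m ≠ 0) : Real.sinc (Real.pi * m) = 0 := by
  rw [Real.sinc_of_ne_zero (mul_ne_zero Real.pi_ne_zero (by exact_mod_cast hm)), mul_comm,
    Real.sin_int_mul_pi, zero_div]

/-- The received samples of the common signal are those of a time-varying channel. -/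
lemma sameSignalSample_eq_sum {T : ℝ} (hT : 0 < T) (τ γ : ℝ) (φ : ℕ → ℝ) {n : ℕ} (x : Fin n → ℂ)
    (k : ℕ) : sameSignalSample T τ γ φ x k
      = ∑ i : Fin n, impulseResponse T τ γ φ k ((k : ℤ) - (i : ℤ)) * x i := by
  rw [sameSignalSample, waveform, waveform, Finset.mul_sum, ← Finset.sum_add_distrib]
  refine Finset.sum_congr rfl fun i _ => ?_
  -- Nyquist's property: the direct path, sampled at symbol times, has no intersymbol interference.
  have e1 : shapingPulse T (k * T - i * T) = if ((k : ℤ) - (i : ℤ)) = 0 then 1 else 0 := by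
    have : ((k : ℝ) * T - i * T) / T = ((k - i : ℤ) : ℝ) := by
      push_cast; field_simp
    rw [shapingPulse, this]
    split_ifs with h
    · simp [h]
    · exact sinc_pi_mul_int h
  have e2 : shapingPulse T (k * T - τ - i * T)
      = Real.sinc (Real.pi * (((k - i : ℤ) : ℝ) - τ / T)) := by
    rw [shapingPulse]
    congr 2
    push_cast
    field_simp
    ring
  rw [e1, e2, impulseResponse]
  split_ifs <;> push_cast <;> ring

/-- The phase factor has modulus one and disappears for `m ≠ 0`; for `m = 0` it interferes with the
direct path, which produces the cosine. -/
lemma norm_impulseResponse_sq (T τ γ : ℝ) (φ : ℕ → ℝ) (k : ℕ) (m : ℤ) :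
    ‖impulseResponse T τ γ φ k m‖ ^ 2 = γ ^ 2 * Real.sinc (Real.pi * (m - τ / T)) ^ 2
      + if m = 0 then 1 + 2 * γ * Real.sinc (Real.pi * (τ / T)) * Real.cos (φ k) else 0 := by
  rw [impulseResponse, Complex.sq_norm, Complex.normSq_apply, mul_assoc, mul_comm (Complex.exp _),
    ← mul_assoc, ← Complex.ofReal_mul]
  simp only [Complex.add_re, Complex.add_im, Complex.re_ofReal_mul, Complex.im_ofReal_mul,
    Complex.exp_ofReal_mul_I_re, Complex.exp_ofReal_mul_I_im]
  have h := Real.sin_sq_add_cos_sq (φ k)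
  split_ifs with hm
  · have : Real.sinc (Real.pi * ((m : ℝ) - τ / T)) = Real.sinc (Real.pi * (τ / T)) := by
      rw [hm, ← Real.sinc_neg]
      congr 1
      push_cast
      ring
    rw [this]
    simp
    linear_combination (γ * Real.sinc (Real.pi * (τ / T))) ^ 2 * h
  · simp
    linear_combination (γ * Real.sinc (Real.pi * (m - τ / T))) ^ 2 * h

/-- The energy of the signature of one symbol. -/
lemma sum_norm_impulseResponse_sq_le (T τ γ : ℝ) (φ : ℕ → ℝ) {n : ℕ} (i : Fin n) :
    ∑ k : Fin n, ‖impulseResponse T τ γ φ k ((k : ℤ) - (i : ℤ))‖ ^ 2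
      ≤ 1 + γ ^ 2 + 2 * γ * Real.sinc (Real.pi * (τ / T)) * Real.cos (φ i) := by
  simp only [norm_impulseResponse_sq, Finset.sum_add_distrib, ← Finset.mul_sum]
  -- Along a column the phase varies with `k`, but only the diagonal entry feels it, so the phase at
  -- the symbol's own time remains.
  have h1 : ∑ k : Fin n, (if ((k : ℕ) : ℤ) - ((i : ℕ) : ℤ) = 0 then
      1 + 2 * γ * Real.sinc (Real.pi * (τ / T)) * Real.cos (φ k) else 0)
      = 1 + 2 * γ * Real.sinc (Real.pi * (τ / T)) * Real.cos (φ i) := by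
    have : ∀ k : Fin n, (((k : ℕ) : ℤ) - ((i : ℕ) : ℤ) = 0) ↔ k = i := fun k => by
      rw [sub_eq_zero, Nat.cast_inj, Fin.val_inj]
    simp only [this, Finset.sum_ite_eq', Finset.mem_univ, if_true]
  have hinj : Function.Injective fun k : Fin n => ((k : ℕ) : ℤ) - ((i : ℕ) : ℤ) := fun k l hkl => by
    simpa [Fin.val_inj] using hkl
  have h2 : ∑ k : Fin n, Real.sinc (Real.pi * ((((k : ℕ) : ℤ) - ((i : ℕ) : ℤ) : ℤ) - τ / T)) ^ 2
      ≤ 1 := by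
    have := sum_sinc_sq_le_one (τ / T) (Finset.univ.map ⟨_, hinj⟩)
    rwa [Finset.sum_map] at this
  rw [h1]
  have := mul_le_mul_of_nonneg_left h2 (sq_nonneg γ)
  linarith

lemma HasDecreasingIncrements.comp_mul {f : ℝ → ℝ} (hf : HasDecreasingIncrements f) {p : ℝ}
    (hp : 0 ≤ p) : HasDecreasingIncrements fun r => f (p * r) := by
  intro x h k hx hh hk
  rcases hp.eq_or_lt with rfl | hp
  · simp
  · have := hf (p * x) (p * h) (p * k) (by positivity) (by positivity) (by positivity)
    simpa only [mul_add] using this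

/-! ### Bounds on the block information for fixed phases. -/

section SameSignal

variable {T : ℝ} (hT : 0 < T) (τ γ : ℝ) (P : ℝ≥0) {N : ℝ≥0} (hN : 0 < N) {ν : Measure ℂ}
  [IsProbabilityMeasure ν] (hν : Integrable (fun u : ℂ => ‖u‖ ^ 2) ν)

include hT hN hν

/-- The rate of the block with a common signal, for each realization of the phases. -/
lemma sameSignalInfo_le_sum (φ : ℕ → ℝ) (n : ℕ) :
    sameSignalInfo T τ γ P N ν φ n
      ≤ ENNReal.ofReal (∑ i ∈ Finset.range n, scalarInfo ν (P / N * (1 + γ ^ 2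
          + 2 * γ * Real.sinc (Real.pi * (τ / T)) * Real.cos (φ i))))
        / ENNReal.ofReal (Real.log 2) := by
  set a : Fin n → Fin n → ℂ := fun i k =>
    impulseResponse T τ γ φ k (((k : ℕ) : ℤ) - ((i : ℕ) : ℤ)) * (Real.sqrt P : ℂ) with ha
  have hsig : (fun (u : Fin n → ℂ) (k : Fin n) =>
      sameSignalSample T τ γ φ (fun i => (Real.sqrt P : ℂ) * u i) (k : ℕ))
      = fun u k => ∑ i, a i k * u i := by
    ext u k
    rw [sameSignalSample_eq_sum hT]
    exact Finset.sum_congr rfl fun i _ => by simp only [ha]; ring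
  have hf : Measurable fun (x : Fin n → ℂ) (k : Fin n) => sameSignalSample T τ γ φ x (k : ℕ) := by
    simp only [sameSignalSample_eq_sum hT]
    fun_prop
  have hX : Measurable fun (u : Fin n → ℂ) (k : Fin n) => (Real.sqrt P : ℂ) * u k := by fun_prop
  have hen : Integrable (fun u : Fin n → ℂ => blockForm N
      (fun k : Fin n => sameSignalSample T τ γ φ (fun i => (Real.sqrt P : ℂ) * u i) (k : ℕ))
      (fun k : Fin n => sameSignalSample T τ γ φ (fun i => (Real.sqrt P : ℂ) * u i) (k : ℕ)))
      (Measure.pi fun _ : Fin n => ν) := by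
    have := integrable_blockForm_map (v := N) (π := Measure.pi fun _ : Fin n => ν)
      (f := fun u (k : Fin n) => ∑ i, a i k * u i)
      fun k => integrable_norm_sum_mul_sq hν fun i => a i k
    have e : ∀ u : Fin n → ℂ, (fun k : Fin n => sameSignalSample T τ γ φ
        (fun i => (Real.sqrt P : ℂ) * u i) (k : ℕ)) = fun k => ∑ i, a i k * u i := congrFun hsig
    simp only [e]
    exact this
  have key := mutualInfoBits_eq_gaussianInfo (isGaussianNoise_pi_complexGaussian (Fin n) hN) hX hf hen
  have hle := gaussianInfo_le_sum_scalarInfo hN hν n a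
  rw [← hsig] at hle
  refine key.le.trans (ENNReal.div_le_div_right (ENNReal.ofReal_le_ofReal (hle.trans ?_)) _)
  rw [← Fin.sum_univ_eq_sum_range (fun i => scalarInfo ν (P / N * (1 + γ ^ 2
          + 2 * γ * Real.sinc (Real.pi * (τ / T)) * Real.cos (φ i))))]
  refine Finset.sum_le_sum fun i _ => ?_
  -- The energy is only bounded above, because the finite block truncates the signature;
  -- monotonicity of the scalar information is needed.
  refine (hasDecreasingIncrements_scalarInfo hν).monotoneOn (fun r _ => scalarInfo_nonneg hν r)
    (div_nonneg (Finset.sum_nonneg fun k _ => sq_nonneg _) N.2) ?_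
  have h1 : (∑ k, ‖a i k‖ ^ 2) / (N : ℝ) = P / N
      * ∑ k : Fin n, ‖impulseResponse T τ γ φ k (((k : ℕ) : ℤ) - ((i : ℕ) : ℤ))‖ ^ 2 := by
    have : ∀ k, ‖a i k‖ ^ 2 = P
        * ‖impulseResponse T τ γ φ k (((k : ℕ) : ℤ) - ((i : ℕ) : ℤ))‖ ^ 2 := fun k => by
      simp only [ha, norm_mul, mul_pow, Complex.norm_real, Real.norm_eq_abs, sq_abs,
        Real.sq_sqrt (NNReal.coe_nonneg P)]
      ring
    simp only [this, ← Finset.mul_sum]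
    ring
  rw [h1]
  exact mul_le_mul_of_nonneg_left (sum_norm_impulseResponse_sq_le T τ γ φ i) (by positivity)

/-- A linear bound on the rate of the block in the cosines of the phases. -/
lemma exists_sameSignalInfo_le :
    ∃ s : ℝ, ∀ (φ : ℕ → ℝ) (n : ℕ),
      0 ≤ n * scalarInfo ν (P / N * (1 + γ ^ 2)) + ∑ i ∈ Finset.range n, s * Real.cos (φ i) ∧
      sameSignalInfo T τ γ P N ν φ n
        ≤ ENNReal.ofReal (n * scalarInfo ν (P / N * (1 + γ ^ 2))
          + ∑ i ∈ Finset.range n, s * Real.cos (φ i)) / ENNReal.ofReal (Real.log 2) := by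
  have hp : (0 : ℝ) ≤ P / N := by positivity
  -- The factor `P / N` is kept inside the function so that the point of support `1 + γ²` is
  -- positive even when `P = 0`.
  obtain ⟨s, hs⟩ := ((hasDecreasingIncrements_scalarInfo hν).comp_mul hp).exists_supporting_line
    (fun r _ => scalarInfo_nonneg hν _) (c := 1 + γ ^ 2) (by positivity)
  set κ := 2 * γ * Real.sinc (Real.pi * (τ / T)) with hκ
  refine ⟨s * κ, fun φ n => ?_⟩
  -- This quantity bounds an energy, that of the last symbol in a block of length `i + 1`.
  have hr : ∀ i, 0 ≤ 1 + γ ^ 2 + κ * Real.cos (φ i) := fun i =>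
    (Finset.sum_nonneg fun k _ => sq_nonneg _).trans
      (sum_norm_impulseResponse_sq_le T τ γ φ (⟨i, i.lt_succ_self⟩ : Fin (i + 1)))
  have hsum : ∑ i ∈ Finset.range n, scalarInfo ν (P / N * (1 + γ ^ 2 + κ * Real.cos (φ i)))
      ≤ n * scalarInfo ν (P / N * (1 + γ ^ 2))
        + ∑ i ∈ Finset.range n, s * κ * Real.cos (φ i) := by
    calc _ ≤ ∑ i ∈ Finset.range n, (scalarInfo ν (P / N * (1 + γ ^ 2))
          + s * κ * Real.cos (φ i)) := Finset.sum_le_sum fun i _ => by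
            have := hs _ (hr i)
            linarith
      _ = _ := by rw [Finset.sum_add_distrib]; simp
  refine ⟨(Finset.sum_nonneg fun i _ => scalarInfo_nonneg hν _).trans hsum, ?_⟩
  exact (sameSignalInfo_le_sum hT τ γ P hN hν φ n).trans
    (ENNReal.div_le_div_right (ENNReal.ofReal_le_ofReal hsum) _)

end SameSignal

/-! ### Averaging over the phases. -/

section Phases

variable {Ω : Type*} [MeasurableSpace Ω] {μ : Measure Ω} [IsProbabilityMeasure μ]
  {φ : ℕ → Ω → ℝ}

/-- The cosine of a phase, as a bounded function of the phase factor. -/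
noncomputable def clippedRe (z : ℂ) : ℝ := max (-1) (min 1 z.re)

lemma measurable_clippedRe : Measurable clippedRe :=
  measurable_const.max (measurable_const.min Complex.measurable_re)

lemma abs_clippedRe_le (z : ℂ) : |clippedRe z| ≤ 1 :=
  abs_le.2 ⟨le_max_left _ _, max_le (by norm_num) (min_le_left _ _)⟩

/-- Clipping does nothing on the unit circle; it makes the observable bounded on all of sequence
space, as the ergodic lemma requires. -/
lemma clippedRe_exp (x : ℝ) : clippedRe (Complex.exp ((x : ℂ) * Complex.I)) = Real.cos x := by
  rw [clippedRe, Complex.exp_ofReal_mul_I_re, min_eq_right (Real.cos_le_one x),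
    max_eq_right (Real.neg_one_le_cos x)]

lemma measurable_phaseFactors (hφ : ∀ k, Measurable (φ k)) :
    Measurable fun ω (k : ℕ) => Complex.exp ((φ k ω : ℂ) * Complex.I) :=
  measurable_pi_lambda _ fun k => by have := hφ k; fun_prop

omit [IsProbabilityMeasure μ] in
-- The shift preserves the law, so the mean at time `0` propagates to all times.
lemma integral_cos_eq_zero (hφ : ∀ k, Measurable (φ k))
    (herg : IsStationaryErgodic μ (fun k ω => Complex.exp ((φ k ω : ℂ) * Complex.I)))
    (hmean : ∫ ω, Real.cos (φ 0 ω) ∂μ = 0) (k : ℕ) : ∫ ω, Real.cos (φ k ω) ∂μ = 0 := by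
  have hm := measurable_phaseFactors hφ
  have hc : ∀ k, Measurable fun s : ℕ → ℂ => clippedRe (s k) := fun k =>
    measurable_clippedRe.comp (measurable_pi_apply k)
  have h1 : ∀ k, ∫ ω, Real.cos (φ k ω) ∂μ
      = ∫ s, clippedRe (s k) ∂(μ.map fun ω k => Complex.exp ((φ k ω : ℂ) * Complex.I)) := fun k => by
    rw [integral_map hm.aemeasurable (hc k).aestronglyMeasurable]
    simp only [clippedRe_exp]
  induction k with
  | zero => exact hmean
  | succ k ih =>
    have hE : Ergodic _ _ := herg
    rw [h1, ← ih, h1, ← integral_map (f := fun s : ℕ → ℂ => clippedRe (s k))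
      (φ := fun (s : ℕ → ℂ) (k : ℕ) => s (k + 1)) hE.measurable.aemeasurable
      (hc k).aestronglyMeasurable, hE.toMeasurePreserving.map_eq]

/-- The ergodic theorem for the cosines of the phases. -/
lemma ae_sum_cos_le (hφ : ∀ k, Measurable (φ k))
    (herg : IsStationaryErgodic μ (fun k ω => Complex.exp ((φ k ω : ℂ) * Complex.I)))
    (hmean : ∫ ω, Real.cos (φ 0 ω) ∂μ = 0) (s : ℝ) {ε : ℝ} (hε : 0 < ε) :
    ∀ᵐ ω ∂μ, ∃ K : ℝ, ∀ n : ℕ, ∑ i ∈ Finset.range n, s * Real.cos (φ i ω) ≤ K + n * ε := by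
  have hm := measurable_phaseFactors hφ
  have := Measure.isProbabilityMeasure_map (μ := μ) hm.aemeasurable
  have hc : Measurable fun z : ℕ → ℂ => s * clippedRe (z 0) :=
    (measurable_clippedRe.comp (measurable_pi_apply 0)).const_mul s
  have h0 : ∫ z, s * clippedRe (z 0)
      ∂(μ.map fun ω k => Complex.exp ((φ k ω : ℂ) * Complex.I)) ≤ 0 := by
    rw [integral_map hm.aemeasurable hc.aestronglyMeasurable]
    simp only [clippedRe_exp, integral_const_mul, hmean, mul_zero, le_refl]
  have h1 := ae_birkhoffSum_le (T := fun (s : ℕ → ℂ) (k : ℕ) => s (k + 1)) herg hc (C := |s|)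
    (fun z => by
      rw [abs_mul]
      exact mul_le_of_le_one_right (abs_nonneg s) (abs_clippedRe_le _)) h0 hε
  have hiter : ∀ (i : ℕ) (z : ℕ → ℂ),
      ((fun (s : ℕ → ℂ) (k : ℕ) => s (k + 1))^[i] z) 0 = z i := fun i => by
    have : ∀ (z : ℕ → ℂ) (k : ℕ),
        ((fun (s : ℕ → ℂ) (k : ℕ) => s (k + 1))^[i] z) k = z (k + i) := by
      induction i with
      | zero => intro z k; rfl
      | succ i ih =>
        intro z k
        rw [Function.iterate_succ_apply, ih]
        congr 1
    intro z
    rw [this, zero_add]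
  filter_upwards [ae_of_ae_map hm.aemeasurable h1] with ω ⟨K, hK⟩
  refine ⟨K, fun n => ?_⟩
  have := hK n
  simpa only [birkhoffSum, hiter, clippedRe_exp] using this

variable {T : ℝ} (hT : 0 < T) (τ γ : ℝ) (P : ℝ≥0) {N : ℝ≥0} (hN : 0 < N) {ν : Measure ℂ}
  [IsProbabilityMeasure ν] (hν : Integrable (fun u : ℂ => ‖u‖ ^ 2) ν)

include hT hN hν

/-- The cosine sum in the linear bound is almost surely at most `K + n ε` for every `ε`, hence
negligible after division by `n`. -/
lemma ae_limsup_sameSignalInfo_le (hφ : ∀ k, Measurable (φ k))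
    (herg : IsStationaryErgodic μ (fun k ω => Complex.exp ((φ k ω : ℂ) * Complex.I)))
    (hmean : ∫ ω, Real.cos (φ 0 ω) ∂μ = 0) :
    ∀ᵐ ω ∂μ, limsup (fun n : ℕ => sameSignalInfo T τ γ P N ν (fun l => φ l ω) n / (n : ℝ≥0∞)) atTop
      ≤ ENNReal.ofReal (scalarInfo ν (P / N * (1 + γ ^ 2))) / ENNReal.ofReal (Real.log 2) := by
  obtain ⟨s, hs⟩ := exists_sameSignalInfo_le hT τ γ P hN hν
  set c := scalarInfo ν (P / N * (1 + γ ^ 2)) with hc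
  have hlog : ENNReal.ofReal (Real.log 2) ≠ 0 := by
    simp [Real.log_pos one_lt_two]
  have hae : ∀ᵐ ω ∂μ, ∀ m : ℕ, ∃ K : ℝ, ∀ n : ℕ,
      ∑ i ∈ Finset.range n, s * Real.cos (φ i ω) ≤ K + n * (1 / ((m : ℝ) + 1)) :=
    ae_all_iff.2 fun m => ae_sum_cos_le hφ herg hmean s Nat.one_div_pos_of_nat
  filter_upwards [hae] with ω hω
  -- One term `1 / (m + 1)` is the ergodic slack `ε`; the other absorbs `K / n` for large `n`.
  -- Countably many `ε` keep a single null set.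
  have hlim : Tendsto (fun m : ℕ => ENNReal.ofReal (c + (1 / ((m : ℝ) + 1) + 1 / ((m : ℝ) + 1)))
      / ENNReal.ofReal (Real.log 2)) atTop
      (nhds (ENNReal.ofReal c / ENNReal.ofReal (Real.log 2))) := by
    refine ENNReal.Tendsto.div_const (ENNReal.tendsto_ofReal ?_) (Or.inr hlog)
    have := tendsto_one_div_add_atTop_nhds_zero_nat (𝕜 := ℝ)
    simpa using (this.add this).const_add c
  refine ge_of_tendsto' hlim fun m => ?_
  obtain ⟨K, hK⟩ := hω m
  refine limsup_le_of_le (by isBoundedDefault) ?_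
  have hε : (0 : ℝ) < 1 / ((m : ℝ) + 1) := Nat.one_div_pos_of_nat
  obtain ⟨n₀, hn₀⟩ := exists_nat_ge (K / (1 / ((m : ℝ) + 1)))
  filter_upwards [eventually_ge_atTop (max n₀ 1)] with n hn
  have hn1 : 1 ≤ n := (le_max_right _ _).trans hn
  have hn2 : (n₀ : ℝ) ≤ n := by exact_mod_cast (le_max_left _ _).trans hn
  have hnpos : (0 : ℝ) < n := by exact_mod_cast hn1
  have h1 := (hs (fun l => φ l ω) n).2
  have h2 := hK n
  have h3 : K ≤ n * (1 / ((m : ℝ) + 1)) := by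
    rw [← div_le_iff₀ hε]
    exact hn₀.trans hn2
  have h4 : n * c + ∑ i ∈ Finset.range n, s * Real.cos (φ i ω)
      ≤ (c + (1 / ((m : ℝ) + 1) + 1 / ((m : ℝ) + 1))) * n := by
    linarith
  refine ENNReal.div_le_of_le_mul (h1.trans ?_)
  rw [← ENNReal.mul_div_right_comm]
  refine ENNReal.div_le_div_right ?_ _
  rw [← ENNReal.ofReal_natCast, ← ENNReal.ofReal_mul' (Nat.cast_nonneg n)]
  exact ENNReal.ofReal_le_ofReal h4

/-- The cosine sum has mean zero, so the linear bound integrates to the target for each `n ≥ 1`; of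
the hypothesis on the phases, stationarity suffices here. -/
lemma limsup_lintegral_sameSignalInfo_le (hφ : ∀ k, Measurable (φ k))
    (herg : IsStationaryErgodic μ (fun k ω => Complex.exp ((φ k ω : ℂ) * Complex.I)))
    (hmean : ∫ ω, Real.cos (φ 0 ω) ∂μ = 0) :
    limsup (fun n : ℕ =>
        (∫⁻ ω, sameSignalInfo T τ γ P N ν (fun l => φ l ω) n ∂μ) / (n : ℝ≥0∞)) atTop
      ≤ ENNReal.ofReal (scalarInfo ν (P / N * (1 + γ ^ 2))) / ENNReal.ofReal (Real.log 2) := by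
  obtain ⟨s, hs⟩ := exists_sameSignalInfo_le hT τ γ P hN hν
  set c := scalarInfo ν (P / N * (1 + γ ^ 2)) with hc
  have hci : ∀ i, Integrable (fun ω => s * Real.cos (φ i ω)) μ := fun i =>
    (Integrable.of_bound (Real.measurable_cos.comp (hφ i)).aestronglyMeasurable 1
      (Eventually.of_forall fun ω => Real.abs_cos_le_one _)).const_mul s
  refine limsup_le_of_le (by isBoundedDefault) ?_
  filter_upwards [eventually_ge_atTop 1] with n hn
  have hsi : Integrable (fun ω => ∑ i ∈ Finset.range n, s * Real.cos (φ i ω)) μ :=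
    integrable_finsetSum _ fun i _ => hci i
  have hint : Integrable (fun ω => n * c + ∑ i ∈ Finset.range n, s * Real.cos (φ i ω)) μ :=
    (integrable_const _).add hsi
  have hval : ∫ ω, (n * c + ∑ i ∈ Finset.range n, s * Real.cos (φ i ω)) ∂μ = n * c := by
    rw [integral_add (integrable_const _) hsi, integral_finsetSum _ fun i _ => hci i]
    simp [integral_const_mul, integral_cos_eq_zero hφ herg hmean]
  refine ENNReal.div_le_of_le_mul ?_
  calc ∫⁻ ω, sameSignalInfo T τ γ P N ν (fun l => φ l ω) n ∂μ
      ≤ ∫⁻ ω, ENNReal.ofReal (n * c + ∑ i ∈ Finset.range n, s * Real.cos (φ i ω))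
        / ENNReal.ofReal (Real.log 2) ∂μ :=
        lintegral_mono fun ω => (hs (fun l => φ l ω) n).2
    _ = (∫⁻ ω, ENNReal.ofReal (n * c + ∑ i ∈ Finset.range n, s * Real.cos (φ i ω)) ∂μ)
        / ENNReal.ofReal (Real.log 2) := by
        simp only [div_eq_mul_inv]
        exact lintegral_mul_const'' _ hint.1.aemeasurable.ennreal_ofReal
    _ = ENNReal.ofReal (n * c) / ENNReal.ofReal (Real.log 2) := by
        rw [← ofReal_integral_eq_lintegral_ofReal hint
          (Eventually.of_forall fun ω => (hs (fun l => φ l ω) n).1), hval]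
    _ = _ := by
        rw [mul_comm (n : ℝ), ENNReal.ofReal_mul' (Nat.cast_nonneg n), ENNReal.ofReal_natCast,
          ENNReal.mul_div_right_comm]

end Phases

/-! ### Alamouti's scheme and independent signals. -/

section TwoUsers

/-- The signal received from the first satellite and, through the relative gain `g`, from the
second one. -/
noncomputable def superposition (g : ℂ) (P : ℝ≥0) (u : ℂ × ℂ) : ℂ :=
  (Real.sqrt P : ℂ) * u.1 + g * ((Real.sqrt P : ℂ) * u.2)

/-- The signal received in the second slot of the Alamouti scheme. -/
noncomputable def alamoutiSecond (g : ℂ) (P : ℝ≥0) (u : ℂ × ℂ) : ℂ :=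
  starRingEnd ℂ ((Real.sqrt P : ℂ) * u.2) + g * (-(starRingEnd ℂ ((Real.sqrt P : ℂ) * u.1)))

lemma measurable_superposition (g : ℂ) (P : ℝ≥0) : Measurable (superposition g P) := by
  unfold superposition
  fun_prop

lemma measurable_alamoutiSecond (g : ℂ) (P : ℝ≥0) : Measurable (alamoutiSecond g P) := by
  have : Measurable (starRingEnd ℂ) := Complex.continuous_conj.measurable
  unfold alamoutiSecond
  fun_prop

lemma integrable_norm_add_sq {A : Type*} [MeasurableSpace A] {π : Measure A} {f g : A → ℂ}
    (hf : Measurable f) (hg : Measurable g) (hf2 : Integrable (fun a => ‖f a‖ ^ 2) π)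
    (hg2 : Integrable (fun a => ‖g a‖ ^ 2) π) : Integrable (fun a => ‖f a + g a‖ ^ 2) π := by
  have h := ((memLp_two_iff_integrable_sq_norm hf.aestronglyMeasurable).2 hf2).add
    ((memLp_two_iff_integrable_sq_norm hg.aestronglyMeasurable).2 hg2)
  exact (memLp_two_iff_integrable_sq_norm h.1).1 h

lemma complexForm_eq_re (v : ℝ≥0) (x y : ℂ) :
    complexForm v x y = 2 * (starRingEnd ℂ x * y).re / v := by
  simp [complexForm]

variable {ν : Measure ℂ} [IsProbabilityMeasure ν]

lemma integrable_norm_superposition_sq (hν : Integrable (fun u : ℂ => ‖u‖ ^ 2) ν) (g : ℂ)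
    (P : ℝ≥0) : Integrable (fun u => ‖superposition g P u‖ ^ 2) (ν.prod ν) := by
  refine integrable_norm_add_sq (by fun_prop) (by fun_prop)
    ((integrable_norm_const_mul_sq hν _).comp_fst ν) ?_
  have := (integrable_norm_const_mul_sq hν (g * (Real.sqrt P : ℂ))).comp_snd ν
  simpa only [mul_assoc] using this

lemma integrable_norm_alamoutiSecond_sq (hν : Integrable (fun u : ℂ => ‖u‖ ^ 2) ν) (g : ℂ)
    (P : ℝ≥0) : Integrable (fun u => ‖alamoutiSecond g P u‖ ^ 2) (ν.prod ν) := by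
  have hc : Measurable (starRingEnd ℂ) := Complex.continuous_conj.measurable
  refine integrable_norm_add_sq (by fun_prop) (by fun_prop) ?_ ?_
  · simp only [RCLike.norm_conj]
    exact (integrable_norm_const_mul_sq hν _).comp_snd ν
  · simp only [norm_mul, norm_neg, RCLike.norm_conj, mul_pow]
    exact ((hν.const_mul _).const_mul _).comp_fst ν

variable {N : ℝ≥0}

lemma independentRate_eq (hN : 0 < N) (hν : Integrable (fun u : ℂ => ‖u‖ ^ 2) ν) (γ θ : ℝ)
    (P : ℝ≥0) : independentRate γ θ P N ν
      = ENNReal.ofReal (gaussianInfo (complexGaussian N) (complexForm N) ((ν.prod ν).map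
        (superposition ((γ : ℂ) * Complex.exp ((θ : ℂ) * Complex.I)) P)))
        / ENNReal.ofReal (Real.log 2) := by
  exact mutualInfoBits_eq_gaussianInfo (isGaussianNoise_complexGaussian hN) (π := ν.prod ν)
    (X := fun u => ((Real.sqrt P : ℂ) * u.1, (Real.sqrt P : ℂ) * u.2)) (by fun_prop)
    (f := fun x => x.1 + (γ : ℂ) * Complex.exp ((θ : ℂ) * Complex.I) * x.2) (by fun_prop)
    (integrable_complexForm N (integrable_norm_superposition_sq hν _ P))

lemma alamoutiRate_eq (hN : 0 < N) (hν : Integrable (fun u : ℂ => ‖u‖ ^ 2) ν) (γ θ : ℝ)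
    (P : ℝ≥0) : alamoutiRate γ θ P N ν
      = ENNReal.ofReal (gaussianInfo ((complexGaussian N).prod (complexGaussian N))
          (prodForm (complexForm N) (complexForm N)) ((ν.prod ν).map fun u =>
          (superposition ((γ : ℂ) * Complex.exp ((θ : ℂ) * Complex.I)) P u,
            alamoutiSecond ((γ : ℂ) * Complex.exp ((θ : ℂ) * Complex.I)) P u)))
        / ENNReal.ofReal (Real.log 2) / 2 := by
  have hc : Measurable (starRingEnd ℂ) := Complex.continuous_conj.measurable
  have hG := isGaussianNoise_complexGaussian hN
  have := mutualInfoBits_eq_gaussianInfo (hG.prod hG) (π := ν.prod ν)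
    (X := fun u => ((Real.sqrt P : ℂ) * u.1, (Real.sqrt P : ℂ) * u.2)) (by fun_prop)
    (f := fun x => (x.1 + (γ : ℂ) * Complex.exp ((θ : ℂ) * Complex.I) * x.2,
      starRingEnd ℂ x.2 + (γ : ℂ) * Complex.exp ((θ : ℂ) * Complex.I) * (-(starRingEnd ℂ x.1))))
    (by fun_prop)
    ((integrable_complexForm N (integrable_norm_superposition_sq hν _ P)).add
      (integrable_complexForm N (integrable_norm_alamoutiSecond_sq hν _ P)))
  exact congrArg (· / 2) this

/-- The Alamouti scheme orthogonalizes the two symbols. -/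
lemma gaussianInfo_alamouti (hN : 0 < N) (hν : Integrable (fun u : ℂ => ‖u‖ ^ 2) ν) (γ θ : ℝ)
    (P : ℝ≥0) :
    gaussianInfo ((complexGaussian N).prod (complexGaussian N))
      (prodForm (complexForm N) (complexForm N)) ((ν.prod ν).map fun u =>
        (superposition ((γ : ℂ) * Complex.exp ((θ : ℂ) * Complex.I)) P u,
          alamoutiSecond ((γ : ℂ) * Complex.exp ((θ : ℂ) * Complex.I)) P u))
      = 2 * scalarInfo ν (P / N * (1 + γ ^ 2)) := by
  have hNr : (0 : ℝ) < N := hN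
  set e : ℂ := Complex.exp ((θ : ℂ) * Complex.I) with he
  have hee : e * starRingEnd ℂ e = 1 := by
    rw [Complex.mul_conj, Complex.normSq_eq_norm_sq, he, Complex.norm_exp_ofReal_mul_I]
    simp
  have hen : ‖e‖₊ = 1 := by
    ext
    rw [coe_nnnorm, he, Complex.norm_exp_ofReal_mul_I]
    rfl
  set c : ℝ := Real.sqrt (1 + γ ^ 2) with hc
  have hcpos : 0 < c := Real.sqrt_pos.2 (by positivity)
  have hcsq : c ^ 2 = 1 + γ ^ 2 := Real.sq_sqrt (by positivity)
  set a : ℝ := Real.sqrt N with ha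
  have hapos : 0 < a := Real.sqrt_pos.2 hNr
  have hasq : a ^ 2 = N := Real.sq_sqrt hNr.le
  set r : ℝ := P / N * (1 + γ ^ 2) with hr
  have hrs : Real.sqrt r = c * Real.sqrt P / a := by
    rw [hr, Real.sqrt_mul (by positivity), Real.sqrt_div (NNReal.coe_nonneg P)]
    ring
  have hconj : Measurable (starRingEnd ℂ) := Complex.continuous_conj.measurable
  -- The decoder is `S ∘ R ∘ Q`. `Q` conjugates the second slot and multiplies it by `e`, `R`
  -- rotates by `-arctan γ`, of cosine `1 / c` and sine `-γ / c`, and `S` normalizes the noise and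
  -- removes the phase of the second output. `Q` and `R` preserve the noise law.
  set S : ℂ × ℂ → ℂ × ℂ := Prod.map (fun z => ((1 / a : ℝ) : ℂ) * z)
    (fun z => (((1 / a : ℝ) : ℂ) * starRingEnd ℂ e) * z) with hS
  set R : ℂ × ℂ → ℂ × ℂ := fun p => ((Real.cos (-Real.arctan γ) : ℂ) * p.1
    + (Real.sin (-Real.arctan γ) : ℂ) * p.2,
    -(Real.sin (-Real.arctan γ) : ℂ) * p.1 + (Real.cos (-Real.arctan γ) : ℂ) * p.2) with hR
  set Q : ℂ × ℂ → ℂ × ℂ := Prod.map (fun z => z) (fun z => e * starRingEnd ℂ z) with hQ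
  have mS1 := measurable_const_mul_complex ((1 / a : ℝ) : ℂ)
  have mS2 := measurable_const_mul_complex (((1 / a : ℝ) : ℂ) * starRingEnd ℂ e)
  have mS : Measurable S := mS1.prodMap mS2
  have mR : Measurable R := by simp only [hR]; fun_prop
  have mQ2 : Measurable fun z : ℂ => e * starRingEnd ℂ z := by fun_prop
  have mQ : Measurable Q := measurable_id.prodMap mQ2
  have hcos : Real.cos (-Real.arctan γ) = 1 / c := by rw [Real.cos_neg, Real.cos_arctan]
  have hsin : Real.sin (-Real.arctan γ) = -(γ / c) := by rw [Real.sin_neg, Real.sin_arctan]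
  set t : ℂ × ℂ → ℂ × ℂ := fun y => S (R (Q y)) with ht
  have htval : ∀ y : ℂ × ℂ, t y = (((1 / a : ℝ) : ℂ) * ((1 / c : ℝ) * y.1
      + (-(γ / c) : ℝ) * (e * starRingEnd ℂ y.2)),
      (((1 / a : ℝ) : ℂ) * starRingEnd ℂ e) * (-((-(γ / c) : ℝ) : ℂ) * y.1
      + (1 / c : ℝ) * (e * starRingEnd ℂ y.2))) := fun y => by
    simp only [ht, hS, hR, hQ, hcos, hsin, Prod.map]
  have hQlaw : ((complexGaussian N).prod (complexGaussian N)).map Q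
      = (complexGaussian N).prod (complexGaussian N) := by
    rw [hQ, ← Measure.map_prod_map _ _ measurable_id' mQ2, Measure.map_id']
    congr 1
    have h1 : (fun z : ℂ => e * starRingEnd ℂ z) = (fun z => e * z) ∘ (starRingEnd ℂ) := rfl
    rw [h1, ← Measure.map_map (measurable_const_mul_complex e) hconj, complexGaussian_map_conj,
      complexGaussian_map_mul, hen]
    simp
  have hSlaw : ((complexGaussian N).prod (complexGaussian N)).map S
      = (complexGaussian 1).prod (complexGaussian 1) := by
    rw [hS, ← Measure.map_prod_map _ _ mS1 mS2, complexGaussian_map_mul, complexGaussian_map_mul]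
    have h1 : ‖((1 / a : ℝ) : ℂ)‖₊ ^ 2 * N = 1 := by
      ext
      rw [NNReal.coe_mul, NNReal.coe_pow, coe_nnnorm, Complex.norm_real, Real.norm_eq_abs, sq_abs,
        ← hasq, NNReal.coe_one]
      field_simp
    have h2 : ‖starRingEnd ℂ e‖₊ = 1 := by
      rw [← hen]
      ext
      simp
    rw [nnnorm_mul, h2, mul_one, h1]
  have hlaw : ((complexGaussian N).prod (complexGaussian N)).map t
      = (complexGaussian 1).prod (complexGaussian 1) := by
    have h1 : t = S ∘ R ∘ Q := rfl
    rw [h1, ← Measure.map_map mS (mR.comp mQ), ← Measure.map_map mR mQ, hQlaw,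
      complexGaussian_prod_map_rotation, hSlaw]
  set g : ℂ × ℂ → ℂ × ℂ := Prod.map (fun u => (Real.sqrt r : ℂ) * u)
    (fun u => (Real.sqrt r : ℂ) * u) with hg
  have mg1 := measurable_const_mul_complex (Real.sqrt r : ℂ)
  have hG := isGaussianNoise_complexGaussian hN
  have h1 := isGaussianNoise_complexGaussian one_pos
  have haC : (a : ℂ) ≠ 0 := by exact_mod_cast hapos.ne'
  have hcC : (c : ℂ) ≠ 0 := by exact_mod_cast hcpos.ne'
  have hcsqC : (c : ℂ) ^ 2 = 1 + (γ : ℂ) ^ 2 := by exact_mod_cast hcsq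
  have hsuff := gaussianInfo_map_eq_of_sufficient (hG.prod hG) (h1.prod h1)
    (mS.comp (mR.comp mQ)) hlaw (fun x y => ?_) (π := ν.prod ν)
    ((measurable_superposition (γ * e) P).prodMk (measurable_alamoutiSecond (γ * e) P))
    (g := g) (mg1.prodMap mg1) (fun u => ?_) (fun u y => ?_)
  · rw [hsuff, hg, ← Measure.map_prod_map _ _ mg1 mg1]
    have p := Measure.isProbabilityMeasure_map (μ := ν) mg1.aemeasurable
    have hi : Integrable (fun z => complexForm 1 z z)
        (ν.map fun u => (Real.sqrt r : ℂ) * u) := by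
      rw [integrable_map_measure h1.measurable_diag.aestronglyMeasurable mg1.aemeasurable]
      exact integrable_complexForm 1 (integrable_norm_const_mul_sq hν _)
    rw [h1.gaussianInfo_prod h1 hi hi, scalarInfo]
    ring
  · change t (x + y) = t x + t y
    simp only [htval, Prod.fst_add, Prod.snd_add, map_add, Prod.mk_add_mk]
    congr 1 <;> ring
  · change t _ = _
    rw [htval]
    simp only [superposition, alamoutiSecond, hg, Prod.map, hrs, map_add, map_mul, map_neg,
      Complex.conj_conj, Complex.conj_ofReal]
    push_cast
    congr 1
    · field_simp
      linear_combination (Real.sqrt P : ℂ) * ((γ : ℂ) ^ 2 * u.1 * hee - u.1 * hcsqC)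
    · field_simp
      linear_combination (Real.sqrt P : ℂ) * (((1 + (γ : ℂ) ^ 2) * u.2
        - starRingEnd ℂ e * γ * u.1) * hee - u.2 * hcsqC)
  · change prodForm _ _ _ _ = prodForm _ _ _ (t y)
    rw [htval]
    -- The decoder uses the conjugate of the second slot; moving the conjugation inside the real
    -- part reduces the equality of forms to one between complex numbers.
    have hre : ∀ z w : ℂ, (starRingEnd ℂ z * w).re = (z * starRingEnd ℂ w).re := fun z w => by
      simp
    have hNC : (N : ℝ) = a ^ 2 := hasq.symm
    simp only [prodForm, complexForm_eq_re]
    rw [hre (alamoutiSecond _ _ _), ← add_div, ← mul_add, ← Complex.add_re, ← add_div, ← mul_add,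
      ← Complex.add_re, NNReal.coe_one, div_one, hNC, mul_div_assoc, ← Complex.div_ofReal_re]
    congr 2
    simp only [superposition, alamoutiSecond, hg, Prod.map, hrs, map_add, map_mul,
      Complex.conj_ofReal]
    push_cast
    field_simp
    linear_combination (-(Real.sqrt P : ℂ) * starRingEnd ℂ u.2 * starRingEnd ℂ y.2) * hee

/-- Two observations in independent noises carry at most the sum of their informations. -/
lemma gaussianInfo_pair_le (hN : 0 < N) {A : Type*} [MeasurableSpace A] {π : Measure A}
    [IsProbabilityMeasure π] {f g : A → ℂ} (hf : Measurable f) (hg : Measurable g)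
    (hf2 : Integrable (fun a => ‖f a‖ ^ 2) π) (hg2 : Integrable (fun a => ‖g a‖ ^ 2) π) :
    gaussianInfo ((complexGaussian N).prod (complexGaussian N))
      (prodForm (complexForm N) (complexForm N)) (π.map fun a => (f a, g a))
      ≤ gaussianInfo (complexGaussian N) (complexForm N) (π.map f)
        + gaussianInfo (complexGaussian N) (complexForm N) (π.map g) := by
  have hG := isGaussianNoise_complexGaussian hN
  have h0 : ∀ y, complexForm N 0 y = 0 := hG.zero_left
  have hsnd : ∀ {F : Type} [AddCommGroup F] [MeasurableSpace F] [MeasurableAdd₂ F]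
      {γ' : Measure F} {B' : F → F → ℝ} (_ : IsGaussianNoise γ' B') {k : A → F}
      (_ : Measurable k), gaussianInfo ((complexGaussian N).prod γ') (prodForm (complexForm N) B')
        (π.map fun a => ((0 : ℂ), k a)) = gaussianInfo γ' B' (π.map k) := by
    intro F _ _ _ γ' B' h' k hk
    have := h'.isProbabilityMeasure
    refine gaussianInfo_map_eq_of_sufficient (hG.prod h') h' measurable_snd ?_ (fun _ _ => rfl)
      (measurable_const.prodMk hk) hk (fun _ => rfl) (fun a y => ?_)
    · rw [Measure.map_snd_prod]; simp
    · simp [prodForm, h0]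
  -- Submodularity with a void first observation is subadditivity.
  have hsub := hG.gaussianInfo_submodular hG hG (π := π) (f₁ := fun _ => 0) measurable_const hf hg
    (by simp [h0]) (integrable_complexForm N hf2) (integrable_complexForm N hg2)
  rw [hsnd (hG.prod hG) (hf.prodMk hg), hsnd hG hf, hsnd hG hg, gaussianInfo_dirac_zero hG,
    add_zero] at hsub
  exact hsub

/-- For symmetric inputs, the Alamouti scheme is not better than independent signals. -/
lemma scalarInfo_le_gaussianInfo_superposition (hN : 0 < N)
    (hν : Integrable (fun u : ℂ => ‖u‖ ^ 2) ν) (hsymm : ν.map (fun u => -u) = ν) (γ : ℝ)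
    (P : ℝ≥0) :
    scalarInfo ν (P / N * (1 + γ ^ 2)) ≤ gaussianInfo (complexGaussian N) (complexForm N)
      ((ν.prod ν).map (superposition ((γ : ℂ) * Complex.exp (((0 : ℝ) : ℂ) * Complex.I)) P)) := by
  have hG := isGaussianNoise_complexGaussian hN
  have hconj : Measurable (starRingEnd ℂ) := Complex.continuous_conj.measurable
  set g : ℂ := (γ : ℂ) * Complex.exp (((0 : ℝ) : ℂ) * Complex.I) with hg
  have hgγ : g = γ := by simp [hg]
  have h1 := gaussianInfo_alamouti hN hν γ 0 P
  have h2 := gaussianInfo_pair_le hN (measurable_superposition g P) (measurable_alamoutiSecond g P)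
    (integrable_norm_superposition_sq hν g P) (integrable_norm_alamoutiSecond_sq hν g P)
  -- The gain `g` is real, so the second Alamouti slot is the conjugate of the superposition of
  -- `(u₂, -u₁)`, a pair with the law of `(u₁, u₂)` by symmetry. Both slots thus carry the same
  -- information.
  set q : ℂ × ℂ → ℂ × ℂ := fun u => (u.2, -u.1) with hq
  have mneg : Measurable fun u : ℂ => -u := measurable_neg
  have mq : Measurable q := by fun_prop
  have hqlaw : (ν.prod ν).map q = ν.prod ν := by
    have e1 : q = Prod.map (fun u => u) (fun u => -u) ∘ Prod.swap := rfl
    rw [e1, ← Measure.map_map (measurable_id'.prodMap mneg) measurable_swap, Measure.prod_swap,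
      ← Measure.map_prod_map _ _ measurable_id' mneg, hsymm, Measure.map_id']
  have h3 : gaussianInfo (complexGaussian N) (complexForm N) ((ν.prod ν).map (alamoutiSecond g P))
      = gaussianInfo (complexGaussian N) (complexForm N)
        ((ν.prod ν).map fun u => superposition g P (q u)) := by
    refine gaussianInfo_map_eq_of_sufficient hG hG hconj (complexGaussian_map_conj N)
      (fun x y => map_add _ x y) (measurable_alamoutiSecond g P)
      ((measurable_superposition g P).comp mq) (fun u => ?_) (fun u y => ?_)
    · simp only [alamoutiSecond, superposition, hq, hgγ, map_add, map_mul, map_neg,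
        Complex.conj_conj, Complex.conj_ofReal]
      ring
    · have : starRingEnd ℂ (alamoutiSecond g P u) = superposition g P (q u) := by
        simp only [alamoutiSecond, superposition, hq, hgγ, map_add, map_mul, map_neg,
          Complex.conj_conj, Complex.conj_ofReal]
        ring
      rw [← this]
      simp [complexForm]
  have h4 : (ν.prod ν).map (fun u => superposition g P (q u))
      = (ν.prod ν).map (superposition g P) := by
    conv_rhs => rw [← hqlaw, Measure.map_map (measurable_superposition g P) mq]
    rfl
  rw [h3, h4] at h2
  have h5 := h1.symm.le.trans h2
  linarith

end TwoUsers

/-! ### Gaussian inputs. -/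

section GaussianInput

lemma integrable_norm_sq_complexGaussian (v : ℝ≥0) :
    Integrable (fun z : ℂ => ‖z‖ ^ 2) (complexGaussian v) := by
  have := isGaussian_complexGaussian v
  exact (memLp_two_iff_integrable_sq_norm measurable_id.aestronglyMeasurable).1
    (IsGaussian.memLp_two_id (μ := complexGaussian v))

lemma integral_norm_sq_complexGaussian (v : ℝ≥0) :
    ∫ z : ℂ, ‖z‖ ^ 2 ∂complexGaussian v = v := by
  have hre : ∫ x : ℝ, x ^ 2 ∂gaussianReal 0 (v / 2) = v / 2 := by
    have h1 := variance_id_gaussianReal (μ := 0) (v := v / 2)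
    rw [variance_eq_integral measurable_id.aemeasurable] at h1
    simpa using h1
  have hi : Integrable (fun x : ℝ => x ^ 2) (gaussianReal 0 (v / 2)) :=
    (memLp_id_gaussianReal (μ := 0) (v := v / 2) 2).integrable_sq
  rw [complexGaussian, integral_map (by fun_prop) (by fun_prop)]
  have h2 : ∀ p : ℝ × ℝ, ‖(p.1 : ℂ) + (p.2 : ℂ) * Complex.I‖ ^ 2 = p.1 ^ 2 + p.2 ^ 2 := fun p => by
    rw [Complex.sq_norm, Complex.normSq_add_mul_I]
  simp only [h2]
  rw [integral_add (hi.comp_fst _) (hi.comp_snd _),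
    integral_fun_fst (fun x : ℝ => x ^ 2), integral_fun_snd (fun x : ℝ => x ^ 2), hre]
  simp

/-- The exponential tilt of a centered Gaussian law. -/
lemma lintegral_exp_gaussianReal {v : ℝ≥0} (hv : 0 < v) (y : ℝ) :
    ∫⁻ x, ENNReal.ofReal (Real.exp (2 * x * y - x ^ 2)) ∂gaussianReal 0 (v / 2)
      = ENNReal.ofReal ((Real.sqrt (1 + v))⁻¹ * Real.exp (v * y ^ 2 / (1 + v))) := by
  have hv' : (0 : ℝ) < v := hv
  have h1v : (0 : ℝ) < 1 + v := by linarith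
  -- Completing the square turns the tilted density into a multiple of the Gaussian density of
  -- variance `s` and mean `2 s y`.
  set s : ℝ≥0 := v / (2 * (1 + v)) with hs
  have hs0 : s ≠ 0 := by positivity
  have hsr : (s : ℝ) = v / (2 * (1 + v)) := by simp [hs]
  have hpt : ∀ x : ℝ, gaussianPDF 0 (v / 2) x * ENNReal.ofReal (Real.exp (2 * x * y - x ^ 2))
      = ENNReal.ofReal ((Real.sqrt (1 + v))⁻¹ * Real.exp (v * y ^ 2 / (1 + v)))
        * gaussianPDF (2 * s * y) s x := fun x => by
    rw [gaussianPDF, gaussianPDF, ← ENNReal.ofReal_mul (gaussianPDFReal_nonneg _ _ _),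
      ← ENNReal.ofReal_mul (by positivity)]
    congr 1
    simp only [gaussianPDFReal, hsr]
    have e1 : Real.sqrt (2 * Real.pi * ((v / 2 : ℝ≥0) : ℝ))
        = Real.sqrt (1 + v) * Real.sqrt (2 * Real.pi * (v / (2 * (1 + v)))) := by
      rw [← Real.sqrt_mul h1v.le]
      congr 1
      push_cast
      field_simp
    rw [e1, mul_inv]
    have e2 : Real.exp (-(x - 0) ^ 2 / (2 * ((v / 2 : ℝ≥0) : ℝ))) * Real.exp (2 * x * y - x ^ 2)
        = Real.exp (v * y ^ 2 / (1 + v)) * Real.exp (-(x - 2 * (v / (2 * (1 + v))) * y) ^ 2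
          / (2 * (v / (2 * (1 + v))))) := by
      rw [← Real.exp_add, ← Real.exp_add]
      congr 1
      push_cast
      field_simp
      ring
    rw [mul_assoc ((Real.sqrt (1 + v))⁻¹ * _), e2]
    ring
  rw [gaussianReal_of_var_ne_zero _ (half_pos hv).ne',
    lintegral_withDensity_eq_lintegral_mul _ (measurable_gaussianPDF _ _) (by fun_prop)]
  simp only [Pi.mul_apply, hpt]
  rw [lintegral_const_mul _ (measurable_gaussianPDF _ _), lintegral_gaussianPDF_eq_one _ hs0,
    mul_one]

lemma IsGaussianNoise.measurable_likelihood_left {E : Type*} [AddCommGroup E] [MeasurableSpace E]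
    {γ : Measure E} {B : E → E → ℝ} (h : IsGaussianNoise γ B) (y : E) :
    Measurable fun c => ENNReal.ofReal (Real.exp (logLikelihood B c y)) :=
  h.measurable_likelihood.comp measurable_prodMk_right

/-- Real and imaginary parts separate, and each contributes one real Gaussian tilt. -/
lemma outputDensity_complexGaussian {v : ℝ≥0} (hv : 0 < v) (y : ℂ) :
    outputDensity (complexForm 1) (complexGaussian v) y
      = ENNReal.ofReal ((1 + v : ℝ)⁻¹ * Real.exp (v * ‖y‖ ^ 2 / (1 + v))) := by
  have hm := (isGaussianNoise_complexGaussian one_pos).measurable_likelihood_left y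
  rw [outputDensity, complexGaussian, lintegral_map hm (by fun_prop)]
  have h1 : ∀ p : ℝ × ℝ, ENNReal.ofReal (Real.exp (logLikelihood (complexForm 1)
      ((p.1 : ℂ) + (p.2 : ℂ) * Complex.I) y))
      = ENNReal.ofReal (Real.exp (2 * p.1 * y.re - p.1 ^ 2))
        * ENNReal.ofReal (Real.exp (2 * p.2 * y.im - p.2 ^ 2)) := fun p => by
    rw [← ofReal_exp_add]
    congr 2
    simp [logLikelihood, complexForm]
    ring
  simp only [h1]
  rw [lintegral_prod_mul (f := fun x : ℝ => ENNReal.ofReal (Real.exp (2 * x * y.re - x ^ 2)))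
    (g := fun x : ℝ => ENNReal.ofReal (Real.exp (2 * x * y.im - x ^ 2))) (by fun_prop)
    (by fun_prop), lintegral_exp_gaussianReal hv, lintegral_exp_gaussianReal hv,
    ← ENNReal.ofReal_mul (by positivity)]
  congr 1
  have h2 : (Real.sqrt (1 + v))⁻¹ * (Real.sqrt (1 + v))⁻¹ = (1 + v : ℝ)⁻¹ := by
    rw [← mul_inv, Real.mul_self_sqrt (by positivity)]
  have h3 : Real.exp (v * ‖y‖ ^ 2 / (1 + v))
      = Real.exp (v * y.re ^ 2 / (1 + v)) * Real.exp (v * y.im ^ 2 / (1 + v)) := by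
    rw [← Real.exp_add, Complex.sq_norm, Complex.normSq_apply]
    congr 1
    ring
  rw [h3, ← h2]
  ring

/-- The capacity formula: the information of the scalar channel with a Gaussian input. -/
lemma gaussianInfo_complexGaussian (v : ℝ≥0) :
    gaussianInfo (complexGaussian 1) (complexForm 1) (complexGaussian v) = Real.log (1 + v) := by
  have h := isGaussianNoise_complexGaussian one_pos
  rcases eq_zero_or_pos v with rfl | hv
  · have h0 : complexGaussian 0 = (complexGaussian 1).map fun _ => (0 : ℂ) := by
      have := complexGaussian_map_mul 1 0
      simpa using this.symm
    rw [h0, gaussianInfo_dirac_zero h]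
    simp
  have hlog : ∀ y, logOutput (complexForm 1) (complexGaussian v) y
      = v / (1 + v) * ‖y‖ ^ 2 - Real.log (1 + v) := fun y => by
    rw [logOutput, outputDensity_complexGaussian hv, ENNReal.toReal_ofReal (by positivity),
      Real.log_mul (by positivity) (Real.exp_pos _).ne', Real.log_inv, Real.log_exp]
    ring
  -- The squared norms have means `1 + v` and `1`, and `1 - v / (1 + v) = 1 / (1 + v)`: the
  -- quadratic terms cancel on average and the logarithm remains.
  have hpt : ∀ p : ℂ × ℂ, logLikelihood (complexForm 1) p.1 (p.1 + p.2)
      - logOutput (complexForm 1) (complexGaussian v) (p.1 + p.2)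
      = (1 - v / (1 + v)) * ‖p.1 + p.2‖ ^ 2 - ‖p.2‖ ^ 2 + Real.log (1 + v) := fun p => by
    rw [hlog]
    simp only [logLikelihood, complexForm, Complex.sq_norm, Complex.normSq_apply, Complex.add_re,
      Complex.add_im, NNReal.coe_one]
    ring
  have hi2 : Integrable (fun p : ℂ × ℂ => ‖p.2‖ ^ 2)
      ((complexGaussian v).prod (complexGaussian 1)) :=
    (integrable_norm_sq_complexGaussian 1).comp_snd _
  have hsum := complexGaussian_prod_map_add v 1
  have madd : Measurable fun p : ℂ × ℂ => p.1 + p.2 := measurable_add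
  have hms : AEStronglyMeasurable (fun z : ℂ => ‖z‖ ^ 2)
      (((complexGaussian v).prod (complexGaussian 1)).map fun p => p.1 + p.2) := by fun_prop
  have hi12 : Integrable (fun p : ℂ × ℂ => ‖p.1 + p.2‖ ^ 2)
      ((complexGaussian v).prod (complexGaussian 1)) := by
    have := integrable_norm_sq_complexGaussian (v + 1)
    rw [← hsum] at this
    exact this.comp_measurable madd
  have hv12 : ∫ p : ℂ × ℂ, ‖p.1 + p.2‖ ^ 2 ∂((complexGaussian v).prod (complexGaussian 1))
      = v + 1 := by
    have := integral_norm_sq_complexGaussian (v + 1)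
    rw [← hsum, integral_map madd.aemeasurable hms] at this
    simpa using this
  rw [gaussianInfo]
  simp only [hpt]
  have hi3 : Integrable (fun p : ℂ × ℂ => (1 - v / (1 + v)) * ‖p.1 + p.2‖ ^ 2 - ‖p.2‖ ^ 2)
      ((complexGaussian v).prod (complexGaussian 1)) := (hi12.const_mul _).sub hi2
  rw [integral_add hi3 (integrable_const _),
    integral_sub (hi12.const_mul _) hi2, integral_const_mul, hv12,
    integral_fun_snd (fun z : ℂ => ‖z‖ ^ 2), integral_norm_sq_complexGaussian]
  have : (1 + v : ℝ) ≠ 0 := by positivity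
  simp
  field_simp
  ring

lemma scalarInfo_complexGaussian (r : ℝ≥0) :
    scalarInfo (complexGaussian 1) r = Real.log (1 + r) := by
  rw [scalarInfo, complexGaussian_map_mul, ← gaussianInfo_complexGaussian]
  congr 2
  ext
  simp

/-- Gaussian signals superpose to a Gaussian signal. -/
lemma gaussianInfo_superposition_complexGaussian {N : ℝ≥0} (hN : 0 < N) (γ θ : ℝ) (P : ℝ≥0) :
    gaussianInfo (complexGaussian N) (complexForm N)
      (((complexGaussian 1).prod (complexGaussian 1)).map
        (superposition ((γ : ℂ) * Complex.exp ((θ : ℂ) * Complex.I)) P))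
      = scalarInfo (complexGaussian 1) (P / N * (1 + γ ^ 2)) := by
  have hNr : (0 : ℝ) < N := hN
  set g : ℂ := (γ : ℂ) * Complex.exp ((θ : ℂ) * Complex.I) with hg
  set a : ℝ := Real.sqrt N with ha
  have hapos : 0 < a := Real.sqrt_pos.2 hNr
  have hasq : a ^ 2 = N := Real.sq_sqrt hNr.le
  set r : ℝ := P / N * (1 + γ ^ 2) with hr
  have hr0 : 0 ≤ r := by positivity
  -- Both sides are complex Gaussian of variance `P (1 + γ²)`; circular symmetry removes the phase
  -- `θ`.
  have hlaw : ((complexGaussian 1).prod (complexGaussian 1)).map (superposition g P)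
      = (complexGaussian 1).map fun u => ((a * Real.sqrt r : ℝ) : ℂ) * u := by
    have m1 := measurable_const_mul_complex (Real.sqrt P : ℂ)
    have m2 := measurable_const_mul_complex (g * (Real.sqrt P : ℂ))
    have e1 : superposition g P = (fun p : ℂ × ℂ => p.1 + p.2)
        ∘ Prod.map (fun u => (Real.sqrt P : ℂ) * u) (fun u => (g * (Real.sqrt P : ℂ)) * u) := by
      ext u
      simp [superposition, mul_assoc]
    rw [e1, ← Measure.map_map measurable_add (m1.prodMap m2), ← Measure.map_prod_map _ _ m1 m2,
      complexGaussian_map_mul, complexGaussian_map_mul, complexGaussian_prod_map_add,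
      complexGaussian_map_mul]
    congr 1
    ext
    simp only [NNReal.coe_add, NNReal.coe_pow, coe_nnnorm, mul_one, norm_mul, Complex.norm_real, Real.norm_eq_abs, sq_abs, mul_pow, hg,
      Complex.norm_exp_ofReal_mul_I, Real.sq_sqrt (NNReal.coe_nonneg P), hasq, Real.sq_sqrt hr0]
    rw [hr]
    field_simp
  have haC : (a : ℂ) ≠ 0 := by exact_mod_cast hapos.ne'
  rw [hlaw]
  refine IsScalarStatistic.gaussianInfo_eq (t := fun y => ((1 / a : ℝ) : ℂ) * y)
    ⟨measurable_const_mul_complex _, measurable_const_mul_complex _, ?_, fun x y => mul_add _ _ _,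
      fun u => ?_, fun u y => ?_⟩ (isGaussianNoise_complexGaussian hN) _
  · rw [complexGaussian_map_mul]
    congr 1
    ext
    rw [NNReal.coe_mul, NNReal.coe_pow, coe_nnnorm, Complex.norm_real, Real.norm_eq_abs, sq_abs,
      ← hasq, NNReal.coe_one]
    field_simp
  · push_cast
    field_simp
  · simp only [complexForm, Complex.re_ofReal_mul, Complex.im_ofReal_mul, NNReal.coe_one, ← hasq]
    field_simp

end GaussianInput

/-! ### The theorem. -/

theorem mainTheorem3 {Ω : Type*} [MeasurableSpace Ω] (μ : Measure Ω) [IsProbabilityMeasure μ]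
    (φ : ℕ → Ω → ℝ) (hφ : ∀ k, Measurable (φ k))
    (herg : IsStationaryErgodic μ (fun k ω => Complex.exp ((φ k ω : ℂ) * Complex.I)))
    (hmean : ∫ ω, Real.cos (φ 0 ω) ∂μ = 0)
    (T τ γ : ℝ) (hT : 0 < T) (P N : ℝ≥0) (hN : 0 < N)
    (ν : Measure ℂ) [IsProbabilityMeasure ν] (hν : ∫ u, ‖u‖ ^ 2 ∂ν = 1) :
    -- the channel is a time-varying frequency-selective channel
    (∀ (ω : Ω) (n : ℕ) (x : Fin n → ℂ) (k : ℕ),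
      sameSignalSample T τ γ (fun l => φ l ω) x k =
        ∑ i : Fin n, impulseResponse T τ γ (fun l => φ l ω) k ((k : ℤ) - (i : ℤ)) * x i) ∧
    -- its rate per symbol, for almost every realization of the phases
    (∀ᵐ ω ∂μ,
      limsup (fun n : ℕ => sameSignalInfo T τ γ P N ν (fun l => φ l ω) n / (n : ℝ≥0∞)) atTop
        ≤ scalarRate ν ((1 + Real.toNNReal (γ ^ 2)) * (P / N))) ∧
    -- its ergodic rate per symbol, averaged over the phases
    limsup (fun n : ℕ =>
        (∫⁻ ω, sameSignalInfo T τ γ P N ν (fun l => φ l ω) n ∂μ) / (n : ℝ≥0∞)) atTop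
      ≤ scalarRate ν ((1 + Real.toNNReal (γ ^ 2)) * (P / N)) ∧
    -- the bound is the rate of the Alamouti scheme with the same input distribution
    (∀ θ : ℝ, alamoutiRate γ θ P N ν = scalarRate ν ((1 + Real.toNNReal (γ ^ 2)) * (P / N))) ∧
    -- for symmetric inputs it is at most the rate with independent signals
    (ν.map (fun u => -u) = ν →
      scalarRate ν ((1 + Real.toNNReal (γ ^ 2)) * (P / N)) ≤ independentRate γ 0 P N ν) ∧
    -- for Gaussian inputs it is the rate with independent signals
    (ν = complexGaussian 1 →
      (∀ θ : ℝ, independentRate γ θ P N ν =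
        scalarRate ν ((1 + Real.toNNReal (γ ^ 2)) * (P / N))) ∧
      scalarRate ν ((1 + Real.toNNReal (γ ^ 2)) * (P / N)) =
        ENNReal.ofReal (Real.logb 2 (1 + (1 + γ ^ 2) * ((P : ℝ) / N)))) := by
  -- A non-integrable function would have integral `0`, not `1`.
  have hint : Integrable (fun u : ℂ => ‖u‖ ^ 2) ν :=
    not_imp_comm.1 integral_undef (by rw [hν]; exact one_ne_zero)
  have hcoe : (((1 + Real.toNNReal (γ ^ 2)) * (P / N) : ℝ≥0) : ℝ) = P / N * (1 + γ ^ 2) := by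
    push_cast
    rw [Real.coe_toNNReal _ (sq_nonneg γ)]
    ring
  have hrate : scalarRate ν ((1 + Real.toNNReal (γ ^ 2)) * (P / N))
      = ENNReal.ofReal (scalarInfo ν (P / N * (1 + γ ^ 2))) / ENNReal.ofReal (Real.log 2) := by
    rw [scalarRate_eq hint, hcoe]
  refine ⟨fun ω n x k => sameSignalSample_eq_sum hT τ γ _ x k, ?_, ?_, fun θ => ?_,
    fun hsymm => ?_, fun hgauss => ⟨fun θ => ?_, ?_⟩⟩
  · rw [hrate]
    exact ae_limsup_sameSignalInfo_le hT τ γ P hN hint hφ herg hmean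
  · rw [hrate]
    exact limsup_lintegral_sameSignalInfo_le hT τ γ P hN hint hφ herg hmean
  · rw [hrate, alamoutiRate_eq hN hint, gaussianInfo_alamouti hN hint,
      ENNReal.ofReal_mul zero_le_two, ENNReal.ofReal_ofNat, mul_comm, ENNReal.mul_div_right_comm,
      ENNReal.mul_div_cancel_right two_ne_zero ENNReal.ofNat_ne_top]
  · rw [hrate, independentRate_eq hN hint]
    exact ENNReal.div_le_div_right (ENNReal.ofReal_le_ofReal
      (scalarInfo_le_gaussianInfo_superposition hN hint hsymm γ P)) _
  · rw [hrate, independentRate_eq hN hint, hgauss, gaussianInfo_superposition_complexGaussian hN]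
  · rw [hrate, hgauss, ← hcoe, scalarInfo_complexGaussian, hcoe, Real.logb,
      ENNReal.ofReal_div_of_pos (Real.log_pos one_lt_two)]
    congr 4
    ring
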